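/- Let $m\ge 1$, $n\ge 0$, $\varepsilon>0$, $R_0>0$, let $B_r\subset\mathbb R^m$ be the ball of radius $r$ about the origin, and let $S^n\subset\mathbb R^{n+1}$ be the unit sphere. For $v\in W^{2,2}\cap W^{1,m+1}(B_{R_0},S^n)$ set $$\mathbb H_\varepsilon(v)=\int_{B_{R_0}}|\Delta v|^2+\varepsilon|\nabla v|^{m+1}\,dx .$$ Let $u=u_\varepsilon$ be a minimizer of $\mathbb H_\varepsilon$ on $B_{R_0}$: $u\in W^{2,2}\cap W^{1,m+1}(B_{R_0},S^n)$ and $\mathbb H_\varepsilon(u)\le\mathbb H_\varepsilon(v)$ for all $v$ in this class with $v-u=0$ and $\nabla(v-u)=0$ on $\partial B_{R_0}$ (that is, the extension of $v-u$ by zero belongs to $W^{2,2}(\mathbb R^m)$). Greek subscripts denote (weak) partial derivatives and repeated indices are summed. Then for almost every $\tau\in(0,R_0/2)$ the boundary integral $$b(\tau)=2\int_{\partial B_\tau}\Big(-\frac{x^\alpha u_{\beta}\cdot u_{\alpha\beta}}{|x|^{m-3}}+2\frac{|x^\alpha u_\alpha|^2}{|x|^{m-1}}-2\frac{|\nabla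 u|^2}{|x|^{m-3}}\Big)\,d\sigma$$ converges absolutely, and $b$ agrees almost everywhere on $(0,R_0/2)$ with a continuous function, again denoted by $b$. For all $0<\rho<r<R_0/2$, $$r^{4-m}\int_{B_r}|\Delta u|^2+\varepsilon|\nabla u|^{m+1}\,dx-\rho^{4-m}\int_{B_\rho}|\Delta u|^2+\varepsilon|\nabla u|^{m+1}\,dx=P+R+Q,$$ where $$P=4\int_{B_r\setminus B_\rho}\Big(\frac{|u_\beta+x^\alpha u_{\alpha\beta}|^2}{|x|^{m-2}}+\frac{(m-2)|x^\alpha u_\alpha|^2}{|x|^m}\Big)dx+\varepsilon(m+1)\int_{B_r\setminus B_\rho}\frac{|\nabla u|^{m-1}|x^\alpha u_\alpha|^2}{|x|^{m-2}}\,dx,$$ $$R=b(r)-b(\rho),\qquad Q=\varepsilon(3-m)\int_\rho^r\tau^{3-m}\int_{B_\tau}|\nabla u|^{m+1}\,dx\,d\tau,$$ all these integrals being absolutely convergent. Moreover $P\ge 0$ if $m\ge 2$. (In particular, for almost all $\rho,r$ the term $R$ is the difference of the boundary integrals over $\partial B_r$ and $\partial B_\rho$.) -/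

import Mathlib

open MeasureTheory Set Metric Filter Topology
open scoped ContDiff

noncomputable section

/-- `g` is the weak partial derivative `∂f/∂x_i` on the set `U ⊆ ℝ^m` (intended: `U` open), in the
sense of integration by parts against test functions `φ ∈ C_c^∞(U)`. -/
def HasWeakPartial {m k : ℕ} (U : Set (EuclideanSpace ℝ (Fin m))) (i : Fin m)
    (f g : EuclideanSpace ℝ (Fin m) → EuclideanSpace ℝ (Fin k)) : Prop :=
  LocallyIntegrableOn f U ∧ LocallyIntegrableOn g U ∧
    ∀ φ : EuclideanSpace ℝ (Fin m) → ℝ, ContDiff ℝ ∞ φ → HasCompactSupport φ → tsupport φ ⊆ U →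
      ∫ x in U, (fderiv ℝ φ x (EuclideanSpace.single i 1)) • f x = - ∫ x in U, φ x • g x

/-- A map of class `W^{2,2} ∩ W^{1,m+1}(B_R, S^n)`, `B_R ⊆ ℝ^m` the open ball about the origin,
`S^n ⊆ ℝ^{n+1}` the unit sphere. Its weak first and second derivatives, which are determined by
the map almost everywhere on `B_R`, are recorded with it: `grad i = u_i` and `hess i j = u_{ij}`. -/
structure SobolevSphereMap (m n : ℕ) (R : ℝ) where
  toFun : EuclideanSpace ℝ (Fin m) → EuclideanSpace ℝ (Fin (n + 1))
  grad : Fin m → EuclideanSpace ℝ (Fin m) → EuclideanSpace ℝ (Fin (n + 1))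
  hess : Fin m → Fin m → EuclideanSpace ℝ (Fin m) → EuclideanSpace ℝ (Fin (n + 1))
  hasWeakPartial_toFun : ∀ i, HasWeakPartial (ball 0 R) i toFun (grad i)
  hasWeakPartial_grad : ∀ i j, HasWeakPartial (ball 0 R) j (grad i) (hess i j)
  memLp_toFun : MemLp toFun 2 (volume.restrict (ball 0 R))
  memLp_grad : ∀ i, MemLp (grad i) 2 (volume.restrict (ball 0 R))
  memLp_hess : ∀ i j, MemLp (hess i j) 2 (volume.restrict (ball 0 R))
  memLp_toFun' : MemLp toFun ((m + 1 : ℕ) : ENNReal) (volume.restrict (ball 0 R))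
  memLp_grad' : ∀ i, MemLp (grad i) ((m + 1 : ℕ) : ENNReal) (volume.restrict (ball 0 R))
  norm_eq_one : ∀ᵐ x ∂(volume.restrict (ball 0 R)), ‖toFun x‖ = 1

namespace SobolevSphereMap

variable {m n : ℕ} {R : ℝ}

/-- The Laplacian `Δu = u_{αα}`. -/
def laplacian (u : SobolevSphereMap m n R) (x : EuclideanSpace ℝ (Fin m)) :
    EuclideanSpace ℝ (Fin (n + 1)) :=
  ∑ α, u.hess α α x

/-- The Euclidean (Frobenius) norm `|∇u|`. -/
def gradNorm (u : SobolevSphereMap m n R) (x : EuclideanSpace ℝ (Fin m)) : ℝ :=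
  Real.sqrt (∑ α, ‖u.grad α x‖ ^ 2)

/-- `x^α u_α`. -/
def radial (u : SobolevSphereMap m n R) (x : EuclideanSpace ℝ (Fin m)) :
    EuclideanSpace ℝ (Fin (n + 1)) :=
  ∑ α, x α • u.grad α x

/-- `|Δu|² + ε |∇u|^{m+1}`. -/
def energyDensity (ε : ℝ) (u : SobolevSphereMap m n R) (x : EuclideanSpace ℝ (Fin m)) : ℝ :=
  ‖u.laplacian x‖ ^ 2 + ε * u.gradNorm x ^ (m + 1)

/-- The energy `∫_{B_r} |Δu|² + ε |∇u|^{m+1} dx`; for `r = R` it is `H_ε(u)` on `B_R`. -/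
def energy (ε : ℝ) (u : SobolevSphereMap m n R) (r : ℝ) : ℝ :=
  ∫ x in ball (0 : EuclideanSpace ℝ (Fin m)) r, u.energyDensity ε x

/-- `u` and `v` have the same boundary values and the same first derivatives on `∂B_R`: the
difference `v - u`, extended by zero outside `B_R`, is in `W^{2,2}(ℝ^m)`, that is, the extensions
by zero of its derivatives are the weak derivatives of its extension by zero. -/
def SameBoundaryData (u v : SobolevSphereMap m n R) : Prop :=
  (∀ i, HasWeakPartial univ i
    ((ball 0 R).indicator (fun x => v.toFun x - u.toFun x))
    ((ball 0 R).indicator (fun x => v.grad i x - u.grad i x))) ∧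
  (∀ i j, HasWeakPartial univ j
    ((ball 0 R).indicator (fun x => v.grad i x - u.grad i x))
    ((ball 0 R).indicator (fun x => v.hess i j x - u.hess i j x)))

/-- `u` minimizes `H_ε` on `B_R` among all maps in `W^{2,2} ∩ W^{1,m+1}(B_R, S^n)` with the same
boundary data as `u`. -/
def IsMinimizer (ε : ℝ) (u : SobolevSphereMap m n R) : Prop :=
  ∀ v : SobolevSphereMap m n R, SameBoundaryData u v → u.energy ε R ≤ v.energy ε R

/-- `4 (|u_β + x^α u_{αβ}|² / |x|^{m-2} + (m-2) |x^α u_α|² / |x|^m)`. -/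
def bulkDensity (u : SobolevSphereMap m n R) (x : EuclideanSpace ℝ (Fin m)) : ℝ :=
  4 * ((∑ β, ‖u.grad β x + ∑ α, x α • u.hess α β x‖ ^ 2) / ‖x‖ ^ ((m : ℤ) - 2)
    + ((m : ℝ) - 2) * ‖u.radial x‖ ^ 2 / ‖x‖ ^ m)

/-- `|∇u|^{m-1} |x^α u_α|² / |x|^{m-2}`. -/
def bulkDensityEps (u : SobolevSphereMap m n R) (x : EuclideanSpace ℝ (Fin m)) : ℝ :=
  u.gradNorm x ^ (m - 1) * ‖u.radial x‖ ^ 2 / ‖x‖ ^ ((m : ℤ) - 2)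

/-- The bulk term `P`, an integral over the shell `B_r \ B_ρ`. -/
def bulkTerm (ε : ℝ) (u : SobolevSphereMap m n R) (ρ r : ℝ) : ℝ :=
  (∫ x in ball (0 : EuclideanSpace ℝ (Fin m)) r \ ball 0 ρ, u.bulkDensity x)
    + ε * ((m : ℝ) + 1) *
      ∫ x in ball (0 : EuclideanSpace ℝ (Fin m)) r \ ball 0 ρ, u.bulkDensityEps x

/-- `2 (- x^α ⟨u_β, u_{αβ}⟩ / |x|^{m-3} + 2 |x^α u_α|² / |x|^{m-1} - 2 |∇u|² / |x|^{m-3})`. -/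
def boundaryDensity (u : SobolevSphereMap m n R) (x : EuclideanSpace ℝ (Fin m)) : ℝ :=
  2 * (-(∑ α, ∑ β, x α * inner ℝ (u.grad β x) (u.hess α β x)) / ‖x‖ ^ ((m : ℤ) - 3)
    + 2 * ‖u.radial x‖ ^ 2 / ‖x‖ ^ ((m : ℤ) - 1)
    - 2 * u.gradNorm x ^ 2 / ‖x‖ ^ ((m : ℤ) - 3))

/-- The boundary density is integrable over the sphere `∂B_τ`. -/
def BoundaryIntegrable (u : SobolevSphereMap m n R) (τ : ℝ) : Prop :=
  Integrable (fun y : sphere (0 : EuclideanSpace ℝ (Fin m)) 1 =>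
    u.boundaryDensity (τ • (y : EuclideanSpace ℝ (Fin m)))) volume.toSphere

/-- `∫_{∂B_τ} (boundary density) dσ`. The surface measure of `∂B_τ` is `τ^{m-1}` times the surface
measure `volume.toSphere` of the unit sphere, transported by `y ↦ τ y`. -/
def boundaryIntegral (u : SobolevSphereMap m n R) (τ : ℝ) : ℝ :=
  τ ^ (m - 1) * ∫ y : sphere (0 : EuclideanSpace ℝ (Fin m)) 1,
    u.boundaryDensity (τ • (y : EuclideanSpace ℝ (Fin m))) ∂volume.toSphere

/-- `τ^{3-m} ∫_{B_τ} |∇u|^{m+1} dx`. -/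
def scaledGradEnergy (u : SobolevSphereMap m n R) (τ : ℝ) : ℝ :=
  τ ^ (3 - (m : ℤ)) * ∫ x in ball (0 : EuclideanSpace ℝ (Fin m)) τ, u.gradNorm x ^ (m + 1)

/-- The term `Q`. -/
def extraTerm (ε : ℝ) (u : SobolevSphereMap m n R) (ρ r : ℝ) : ℝ :=
  ε * (3 - (m : ℝ)) * ∫ τ in ρ..r, u.scaledGradEnergy τ

end SobolevSphereMap

end

/-! ### Calculus of weak partial derivatives. -/

section WeakPartial

/-! The formula comes from inner variations. For smooth compactly supported h with h(s) = 0 for s ≥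
b, where b < R², and for small t, the map Ψ(y) = (1 + t h(|y|²)) y is a diffeomorphism of the ball
which is the identity near the boundary. Hence u ∘ Ψ⁻¹ still takes values in the sphere, has the
boundary data of u, and is an admissible competitor. Its energy, written as an integral in y, is
differentiable at t = 0 and minimal there. The resulting first variation
(`IsMinimizer.integral_eq_zero`) contains |Δu|², the ε-terms, and the mixed products ⟨Δu, Du⟩ and
⟨Δu, D²u⟩, where D = x^α ∂_α is the Euler operator.

The mixed products have no sign. They are removed by an identity that holds for every W^{2,2} map
and does not use minimality (`integral_ball_kinematicForm`). For smooth maps it is a combination of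
five integrals of divergences, arranged so that all third derivatives cancel. It passes to W^{2,2}
by cutting off and mollifying, since the integrand is quadratic in the second-order jet and so its
integral is continuous in L². With the weight -2h' its mixed products are exactly those of the first
variation, and the difference contains |∇(Du)|², |Du|², |∇u|² and ⟨∇u, ∇Du⟩ instead.

Now let ζ be a test function on (0, R) and choose h with d/dτ h(τ²) = -ζ(τ) τ^{3-m}
(`exists_radialProfile`). Then h is constant near the origin, so the singular weights |x|^{-k} never
meet it. With this choice the terms carrying ζ are those of P, and the terms carrying ζ' are those
of the boundary density (`IsMinimizer.integral_densities_eq_zero`). In polar coordinates, with one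
integration by parts in the radius, the identity becomes ∫ (ζ q + ζ' b) = 0 with q = `boundaryDeriv`
locally integrable on (0, R) (`IsMinimizer.integral_boundaryDeriv`). So q is the distributional
derivative of the boundary integral b.

By the lemma of du Bois-Reymond (`exists_ae_eq_add_integral_of_forall_integral_eq_zero`), b is
almost everywhere a primitive of q, which is the continuous representative. Finally q is the
derivative of τ^{4-m} times the energy on B_τ, minus the radial densities of P and Q. Its integral
from ρ to r is the asserted identity. -/

theorem integrable_smul_of_tsupport_subset {X F : Type*} [TopologicalSpace X] [T2Space X]
    [MeasurableSpace X] [OpensMeasurableSpace X] [SecondCountableTopology X]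
    [NormedAddCommGroup F] [NormedSpace ℝ F] {μ : Measure X}
    {U : Set X} {φ : X → ℝ} {f : X → F} (hU : MeasurableSet U) (hφ : Continuous φ)
    (hc : HasCompactSupport φ) (hs : tsupport φ ⊆ U) (hf : LocallyIntegrableOn f U μ) :
    Integrable (fun x => φ x • f x) (μ.restrict U) := by
  have h1 : IntegrableOn f (tsupport φ) μ := hf.integrableOn_compact_subset hs hc
  have h2 : IntegrableOn (fun x => φ x • f x) (tsupport φ) μ :=
    h1.continuousOn_smul hφ.continuousOn hc
  refine h2.of_forall_sdiff_eq_zero hU ?_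
  intro x hx
  simp [image_eq_zero_of_notMem_tsupport hx.2]

variable {m k : ℕ} {U : Set (EuclideanSpace ℝ (Fin m))} {i : Fin m}
  {f g f' g' : EuclideanSpace ℝ (Fin m) → EuclideanSpace ℝ (Fin k)}

theorem contDiff_fderiv_single {F : Type*} [NormedAddCommGroup F] [NormedSpace ℝ F]
    {φ : EuclideanSpace ℝ (Fin m) → F} (hφ : ContDiff ℝ ∞ φ) (v : EuclideanSpace ℝ (Fin m)) :
    ContDiff ℝ ∞ (fun x => fderiv ℝ φ x v) :=
  (hφ.fderiv_right (m := ∞) (by simp)).clm_apply contDiff_const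

theorem hasCompactSupport_fderiv_single {F : Type*} [NormedAddCommGroup F] [NormedSpace ℝ F]
    {φ : EuclideanSpace ℝ (Fin m) → F} (hc : HasCompactSupport φ) (v : EuclideanSpace ℝ (Fin m)) :
    HasCompactSupport (fun x => fderiv ℝ φ x v) :=
  hc.fderiv_apply ℝ v

theorem tsupport_fderiv_single_subset {F : Type*} [NormedAddCommGroup F] [NormedSpace ℝ F]
    (φ : EuclideanSpace ℝ (Fin m) → F) (v : EuclideanSpace ℝ (Fin m)) :
    tsupport (fun x => fderiv ℝ φ x v) ⊆ tsupport φ :=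
  tsupport_fderiv_apply_subset ℝ v

theorem HasWeakPartial.add (hU : MeasurableSet U) (h : HasWeakPartial U i f g)
    (h' : HasWeakPartial U i f' g') :
    HasWeakPartial U i (fun x => f x + f' x) (fun x => g x + g' x) := by
  refine ⟨h.1.add h'.1, h.2.1.add h'.2.1, fun φ hφ hc hs => ?_⟩
  have hd := contDiff_fderiv_single hφ (EuclideanSpace.single i 1)
  have hdc := hasCompactSupport_fderiv_single hc (EuclideanSpace.single i 1)
  have hds := (tsupport_fderiv_single_subset φ (EuclideanSpace.single i 1)).trans hs
  simp only [smul_add]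
  rw [integral_add (integrable_smul_of_tsupport_subset hU hd.continuous hdc hds h.1)
    (integrable_smul_of_tsupport_subset hU hd.continuous hdc hds h'.1),
    integral_add (integrable_smul_of_tsupport_subset hU hφ.continuous hc hs h.2.1)
    (integrable_smul_of_tsupport_subset hU hφ.continuous hc hs h'.2.1),
    h.2.2 φ hφ hc hs, h'.2.2 φ hφ hc hs, neg_add]

theorem HasWeakPartial.zero : HasWeakPartial U i
    (fun _ => (0 : EuclideanSpace ℝ (Fin k))) (fun _ => 0) := by
  refine ⟨locallyIntegrableOn_zero, locallyIntegrableOn_zero, fun φ _ _ _ => by simp⟩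

theorem HasWeakPartial.sum {ι : Type*} (s : Finset ι) (hU : MeasurableSet U)
    {f g : ι → EuclideanSpace ℝ (Fin m) → EuclideanSpace ℝ (Fin k)}
    (h : ∀ a ∈ s, HasWeakPartial U i (f a) (g a)) :
    HasWeakPartial U i (fun x => ∑ a ∈ s, f a x) (fun x => ∑ a ∈ s, g a x) := by
  classical
  induction s using Finset.induction_on with
  | empty => simpa using HasWeakPartial.zero
  | insert a s ha ih =>
    simp only [Finset.sum_insert ha]
    exact (h a (by simp)).add hU (ih fun b hb => h b (by simp [hb]))

/-- The product of a test function and a smooth function is again a test function, so the product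
rule is the definition applied to `φ * a`. -/
theorem HasWeakPartial.smul (hU : IsOpen U) {a : EuclideanSpace ℝ (Fin m) → ℝ}
    (ha : ContDiff ℝ ∞ a) (h : HasWeakPartial U i f g) :
    HasWeakPartial U i (fun x => a x • f x)
      (fun x => fderiv ℝ a x (EuclideanSpace.single i 1) • f x + a x • g x) := by
  have hda := contDiff_fderiv_single ha (EuclideanSpace.single i 1)
  have hl := hU.isLocallyClosed
  refine ⟨h.1.continuousOn_smul hl ha.continuous.continuousOn,
    (h.1.continuousOn_smul hl hda.continuous.continuousOn).add
      (h.2.1.continuousOn_smul hl ha.continuous.continuousOn), fun φ hφ hc hs => ?_⟩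
  have key := h.2.2 (fun x => φ x * a x) (hφ.mul ha) hc.mul_right
    (tsupport_mul_subset_left.trans hs)
  have hd : ∀ x, fderiv ℝ (fun x => φ x * a x) x (EuclideanSpace.single i 1)
      = φ x * fderiv ℝ a x (EuclideanSpace.single i 1)
        + a x * fderiv ℝ φ x (EuclideanSpace.single i 1) := by
    intro x
    rw [fderiv_fun_mul (hφ.differentiable (by simp) x) (ha.differentiable (by simp) x)]
    simp
  have hdφ := contDiff_fderiv_single hφ (EuclideanSpace.single i 1)
  have i1 : Integrable (fun x => (φ x * fderiv ℝ a x (EuclideanSpace.single i 1)) • f x)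
      (volume.restrict U) :=
    integrable_smul_of_tsupport_subset hU.measurableSet (hφ.mul hda).continuous hc.mul_right
      (tsupport_mul_subset_left.trans hs) h.1
  have i2 : Integrable (fun x => (a x * fderiv ℝ φ x (EuclideanSpace.single i 1)) • f x)
      (volume.restrict U) :=
    integrable_smul_of_tsupport_subset hU.measurableSet (ha.mul hdφ).continuous
      (hasCompactSupport_fderiv_single hc _).mul_left
      ((tsupport_mul_subset_right.trans (tsupport_fderiv_single_subset φ _)).trans hs) h.1
  have i3 : Integrable (fun x => (φ x * a x) • g x) (volume.restrict U) :=
    integrable_smul_of_tsupport_subset hU.measurableSet (hφ.mul ha).continuous hc.mul_right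
      (tsupport_mul_subset_left.trans hs) h.2.1
  simp only [hd, add_smul] at key
  rw [integral_add i1 i2] at key
  simp only [smul_add, smul_smul]
  rw [integral_add i1 i3, neg_add, ← key]
  simp only [mul_comm (a _)]
  abel

theorem HasWeakPartial.congr (hU : MeasurableSet U) (h : HasWeakPartial U i f g)
    (hf : ∀ x ∈ U, f x = f' x) (hg : ∀ x ∈ U, g x = g' x) : HasWeakPartial U i f' g' := by
  have aux : ∀ {p q : EuclideanSpace ℝ (Fin m) → EuclideanSpace ℝ (Fin k)},
      LocallyIntegrableOn p U → (∀ x ∈ U, p x = q x) → LocallyIntegrableOn q U := by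
    intro p q hp hpq x hx
    obtain ⟨s, hs, hi⟩ := hp x hx
    refine ⟨s ∩ U, inter_mem hs self_mem_nhdsWithin, ?_⟩
    have hi' : IntegrableOn p (s ∩ U) := hi.mono_set inter_subset_left
    exact hi'.congr (ae_restrict_of_ae_restrict_of_subset inter_subset_right
      (by filter_upwards [ae_restrict_mem hU] with x hx using hpq x hx))
  refine ⟨aux h.1 hf, aux h.2.1 hg, fun φ hφ hc hs => ?_⟩
  have l : ∫ x in U, fderiv ℝ φ x (EuclideanSpace.single i 1) • f x
      = ∫ x in U, fderiv ℝ φ x (EuclideanSpace.single i 1) • f' x :=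
    setIntegral_congr_fun hU fun x hx => by simp only [hf x hx]
  have r : ∫ x in U, φ x • g x = ∫ x in U, φ x • g' x :=
    setIntegral_congr_fun hU fun x hx => by simp only [hg x hx]
  rw [← l, ← r, h.2.2 φ hφ hc hs]

/-- A weak partial derivative on a ball of functions that vanish near the boundary of the ball is
a weak partial derivative on the whole space after extension by zero. -/
theorem HasWeakPartial.indicator_ball {R r : ℝ} (hr : 0 < r) (hrR : r < R)
    (h : HasWeakPartial (ball 0 R) i f g)
    (hfi : IntegrableOn f (ball 0 R)) (hgi : IntegrableOn g (ball 0 R))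
    (hf : ∀ x ∈ ball 0 R, r < ‖x‖ → f x = 0) (hg : ∀ x ∈ ball 0 R, r < ‖x‖ → g x = 0) :
    HasWeakPartial univ i ((ball 0 R).indicator f) ((ball 0 R).indicator g) := by
  refine ⟨((integrable_indicator_iff measurableSet_ball).2 hfi).locallyIntegrable.locallyIntegrableOn _,
    ((integrable_indicator_iff measurableSet_ball).2 hgi).locallyIntegrable.locallyIntegrableOn _,
    fun φ hφ hc _ => ?_⟩
  -- The two radii trisect the interval from `r` to `R`: the cut-off is 1 near the closed ball of
  -- radius `r`, outside which `f` and `g` vanish, and its support lies inside the open ball of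
  -- radius `R`.
  let χ : ContDiffBump (0 : EuclideanSpace ℝ (Fin m)) :=
    ⟨(2 * r + R) / 3, (r + 2 * R) / 3, by linarith, by linarith⟩
  have hχ : ContDiff ℝ ∞ χ := χ.contDiff
  have hχs : tsupport χ ⊆ ball 0 R := by
    rw [χ.tsupport_eq]
    exact closedBall_subset_ball (show (r + 2 * R) / 3 < R by linarith)
  have hχ1 : ∀ x, ‖x‖ ≤ r → χ =ᶠ[𝓝 x] fun _ => (1 : ℝ) := by
    intro x hx
    have : x ∈ ball (0 : EuclideanSpace ℝ (Fin m)) ((2 * r + R) / 3) := by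
      rw [mem_ball_zero_iff]; linarith
    filter_upwards [isOpen_ball.mem_nhds this] with y hy
    exact χ.one_of_mem_closedBall (ball_subset_closedBall hy)
  have key := h.2.2 (fun x => φ x * χ x) (hφ.mul hχ) hc.mul_right
    (tsupport_mul_subset_right.trans hχs)
  have e1 : ∀ x ∈ ball (0 : EuclideanSpace ℝ (Fin m)) R,
      fderiv ℝ (fun x => φ x * χ x) x (EuclideanSpace.single i 1) • f x
      = fderiv ℝ φ x (EuclideanSpace.single i 1) • f x := by
    intro x hx
    rcases lt_or_ge r ‖x‖ with h1 | h1
    · simp [hf x hx h1]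
    · congr 2
      apply Filter.EventuallyEq.fderiv_eq
      filter_upwards [hχ1 x h1] with y hy
      simp [hy]
  have e2 : ∀ x ∈ ball (0 : EuclideanSpace ℝ (Fin m)) R, (φ x * χ x) • g x = φ x • g x := by
    intro x hx
    rcases lt_or_ge r ‖x‖ with h1 | h1
    · simp [hg x hx h1]
    · simp [(hχ1 x h1).self_of_nhds]
  rw [setIntegral_congr_fun measurableSet_ball e1, setIntegral_congr_fun measurableSet_ball e2]
    at key
  simp only [Measure.restrict_univ]
  rw [← integral_indicator measurableSet_ball, ← integral_indicator measurableSet_ball] at key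
  rwa [Set.indicator_smul, Set.indicator_smul] at key

theorem HasWeakPartial.neg (h : HasWeakPartial U i f g) :
    HasWeakPartial U i (fun x => - f x) (fun x => - g x) := by
  refine ⟨h.1.neg, h.2.1.neg, fun φ hφ hc hs => ?_⟩
  simp [integral_neg, h.2.2 φ hφ hc hs]

end WeakPartial

/-! ### Mollification in L². -/

section Mollification

theorem eLpNorm_two_pow_two {α F : Type*} [MeasurableSpace α] [NormedAddCommGroup F]
    {ν : Measure α} (g : α → F) :
    eLpNorm g 2 ν ^ 2 = ∫⁻ t, ‖g t‖ₑ ^ 2 ∂ν := by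
  rw [eLpNorm_eq_lintegral_rpow_enorm_toReal (by norm_num) (by norm_num)]
  simp only [ENNReal.toReal_ofNat, one_div]
  rw [← ENNReal.rpow_natCast, ← ENNReal.rpow_mul]
  norm_num

/-- Jensen's inequality: for the probability measure with density `φ` the L¹ norm is at most the L²
norm. -/
theorem enorm_integral_smul_sq_le {G F : Type*} [MeasurableSpace G] [NormedAddCommGroup F]
    [NormedSpace ℝ F] {μ : Measure G} {φ : G → ℝ} (hφ : Measurable φ) (h0 : ∀ x, 0 ≤ φ x)
    (h1 : ∫⁻ x, ENNReal.ofReal (φ x) ∂μ = 1) {g : G → F} (hg : StronglyMeasurable g) :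
    ‖∫ t, φ t • g t ∂μ‖ₑ ^ 2 ≤ ∫⁻ t, ENNReal.ofReal (φ t) * ‖g t‖ₑ ^ 2 ∂μ := by
  let ν : Measure G := μ.withDensity fun x => ENNReal.ofReal (φ x)
  have hm : Measurable fun x => ENNReal.ofReal (φ x) := hφ.ennreal_ofReal
  have : IsProbabilityMeasure ν := ⟨by rw [withDensity_apply _ MeasurableSet.univ]; simpa using h1⟩
  have hlin : ∀ p : G → ENNReal, Measurable p →
      ∫⁻ t, p t ∂ν = ∫⁻ t, ENNReal.ofReal (φ t) * p t ∂μ := fun p hp =>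
    lintegral_withDensity_eq_lintegral_mul _ hm hp
  have a1 : ‖∫ t, φ t • g t ∂μ‖ₑ ≤ eLpNorm g 1 ν := by
    rw [eLpNorm_one_eq_lintegral_enorm, hlin _ hg.enorm]
    refine (enorm_integral_le_lintegral_enorm _).trans (le_of_eq ?_)
    refine lintegral_congr fun t => ?_
    rw [enorm_smul, Real.enorm_eq_ofReal (h0 t)]
  have a2 : eLpNorm g 1 ν ≤ eLpNorm g 2 ν :=
    eLpNorm_le_eLpNorm_of_exponent_le (by norm_num) hg.aestronglyMeasurable
  calc _ ≤ eLpNorm g 2 ν ^ 2 := by gcongr; exact a1.trans a2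
    _ = _ := by rw [eLpNorm_two_pow_two, hlin _ (by exact hg.enorm.pow_const 2)]

variable {G F : Type*} [NormedAddCommGroup G] [NormedSpace ℝ G] [FiniteDimensional ℝ G]
  [MeasurableSpace G] [BorelSpace G] [NormedAddCommGroup F] [NormedSpace ℝ F]
  {μ : Measure G} [μ.IsAddHaarMeasure]

/-- Convolution with a probability density is a contraction of `L²`. -/
theorem eLpNorm_two_convolution_le {φ : G → ℝ} (hφ : Measurable φ) (h0 : ∀ x, 0 ≤ φ x)
    (h1 : ∫⁻ x, ENNReal.ofReal (φ x) ∂μ = 1) {f : G → F} (hf : AEStronglyMeasurable f μ) :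
    eLpNorm (convolution φ f (ContinuousLinearMap.lsmul ℝ ℝ) μ) 2 μ ≤ eLpNorm f 2 μ := by
  -- A strongly measurable representative makes `(x, t) ↦ f' (x - t)` jointly measurable, as
  -- Tonelli's theorem requires.
  obtain ⟨f', hf', hff'⟩ := hf
  have e : convolution φ f (ContinuousLinearMap.lsmul ℝ ℝ) μ
      = convolution φ f' (ContinuousLinearMap.lsmul ℝ ℝ) μ := by
    ext x
    refine integral_congr_ae ?_
    have := (quasiMeasurePreserving_sub_left μ x).ae_eq_comp hff'
    filter_upwards [this] with t ht
    simp only [Function.comp_apply] at ht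
    simp [ht]
  rw [e, eLpNorm_congr_ae hff', ← ENNReal.pow_le_pow_left_iff two_ne_zero, eLpNorm_two_pow_two,
    eLpNorm_two_pow_two]
  have hm : Measurable fun x => ENNReal.ofReal (φ x) := hφ.ennreal_ofReal
  have hF : Measurable fun x => ‖f' x‖ₑ ^ 2 := by exact hf'.enorm.pow_const 2
  -- Jensen at each point, then Tonelli and translation invariance.
  calc ∫⁻ x, ‖convolution φ f' (ContinuousLinearMap.lsmul ℝ ℝ) μ x‖ₑ ^ 2 ∂μ
      ≤ ∫⁻ x, ∫⁻ t, ENNReal.ofReal (φ t) * ‖f' (x - t)‖ₑ ^ 2 ∂μ ∂μ := by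
        refine lintegral_mono fun x => ?_
        exact enorm_integral_smul_sq_le hφ h0 h1 (hf'.comp_measurable (measurable_const.sub measurable_id))
    _ = ∫⁻ t, ∫⁻ x, ENNReal.ofReal (φ t) * ‖f' (x - t)‖ₑ ^ 2 ∂μ ∂μ := by
        refine lintegral_lintegral_swap (Measurable.aemeasurable ?_)
        exact (hm.comp measurable_snd).mul (hF.comp (measurable_fst.sub measurable_snd))
    _ = ∫⁻ t, ENNReal.ofReal (φ t) * ∫⁻ x, ‖f' x‖ₑ ^ 2 ∂μ ∂μ := by
        refine lintegral_congr fun t => ?_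
        rw [lintegral_const_mul (f := fun x => ‖f' (x - t)‖ₑ ^ 2) _
            (hF.comp (measurable_id.sub_const t)),
          lintegral_sub_right_eq_self (fun x => ‖f' x‖ₑ ^ 2) t]
    _ = ∫⁻ x, ‖f' x‖ₑ ^ 2 ∂μ := by rw [lintegral_mul_const _ hm, h1, one_mul]

theorem ContDiffBump.lintegral_ofReal_normed (φ : ContDiffBump (0 : G)) :
    ∫⁻ x, ENNReal.ofReal (φ.normed μ x) ∂μ = 1 := by
  rw [← ofReal_integral_eq_lintegral_ofReal φ.integrable_normed
    (Eventually.of_forall fun x => φ.nonneg_normed x), φ.integral_normed, ENNReal.ofReal_one]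

theorem ContDiffBump.memLp_two_convolution (φ : ContDiffBump (0 : G)) {f : G → F}
    (hf : MemLp f 2 μ) :
    MemLp (convolution (φ.normed μ) f (ContinuousLinearMap.lsmul ℝ ℝ) μ) 2 μ := by
  refine ⟨?_, lt_of_le_of_lt (eLpNorm_two_convolution_le φ.continuous_normed.measurable
    φ.nonneg_normed φ.lintegral_ofReal_normed hf.1) hf.2⟩
  exact (φ.hasCompactSupport_normed.continuous_convolution_left _ φ.continuous_normed
    (hf.locallyIntegrable (by norm_num))).aestronglyMeasurable

variable [CompleteSpace F]

/-- Mollifications of an `L²` function converge to it in `L²`. -/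
theorem tendsto_eLpNorm_two_convolution {φ : ℕ → ContDiffBump (0 : G)}
    (hφ : Tendsto (fun n => (φ n).rOut) atTop (𝓝 0)) {f : G → F} (hf : MemLp f 2 μ) :
    Tendsto (fun n => eLpNorm
      (convolution ((φ n).normed μ) f (ContinuousLinearMap.lsmul ℝ ℝ) μ - f) 2 μ) atTop (𝓝 0) := by
  rw [ENNReal.tendsto_nhds_zero]
  intro ε hε
  have hε3 : ε / 3 ≠ 0 := (ENNReal.div_pos hε.ne' (by norm_num)).ne'
  -- Three-ε argument. Convolution is an L² contraction, so `f` may be replaced by a continuous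
  -- compactly supported `g`. For `g` uniform continuity gives uniform closeness on the fixed
  -- compact set `K`, which contains the supports once the radius of the mollifier is below 1.
  obtain ⟨g, hgc, hfg, hg, hgL⟩ := hf.exists_hasCompactSupport_eLpNorm_sub_le (by norm_num) hε3
  let K := cthickening 1 (tsupport g)
  have hK : IsCompact K := hgc.cthickening
  have hgK : Function.support g ⊆ K := (subset_tsupport g).trans (self_subset_cthickening _)
  obtain ⟨c, hc0, hc⟩ : ∃ c : ℝ, 0 < c ∧
      ENNReal.ofReal c * μ K ^ (1 / (2 : ENNReal).toReal) ≤ ε / 3 := by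
    have hfin : μ K ^ (1 / (2 : ENNReal).toReal) ≠ ⊤ :=
      ENNReal.rpow_ne_top_of_nonneg (by norm_num) hK.measure_lt_top.ne
    have ht : Tendsto (fun c : ℝ => ENNReal.ofReal c * μ K ^ (1 / (2 : ENNReal).toReal)) (𝓝[>] 0)
        (𝓝 0) := by
      have := ENNReal.Tendsto.mul_const (b := μ K ^ (1 / (2 : ENNReal).toReal))
        (ENNReal.tendsto_ofReal (tendsto_id (α := ℝ) (x := 𝓝 0))) (Or.inr hfin)
      simp only [id_eq, ENNReal.ofReal_zero, zero_mul] at this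
      exact this.mono_left nhdsWithin_le_nhds
    obtain ⟨c, h1, h2⟩ := ((ENNReal.tendsto_nhds_zero.1 ht (ε / 3)
      (pos_iff_ne_zero.2 hε3)).and self_mem_nhdsWithin).exists
    exact ⟨c, h2, h1⟩
  obtain ⟨δ, hδ0, hδ⟩ := Metric.uniformContinuous_iff.1
    (hgc.uniformContinuous_of_continuous hg) c hc0
  have hev : ∀ᶠ n in atTop, (φ n).rOut < min δ 1 :=
    hφ.eventually (gt_mem_nhds (lt_min hδ0 one_pos))
  filter_upwards [hev] with n hn
  set T : (G → F) → G → F := fun f =>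
    convolution ((φ n).normed μ) f (ContinuousLinearMap.lsmul ℝ ℝ) μ with hT
  have hloc : ∀ {p : G → F}, MemLp p 2 μ → LocallyIntegrable p μ := fun hp =>
    hp.locallyIntegrable (by norm_num)
  have hTsub : T (f - g) = T f - T g := by
    ext x
    have c1 := (φ n).hasCompactSupport_normed (μ := μ)
      |>.convolutionExists_left (ContinuousLinearMap.lsmul ℝ ℝ) (φ n).continuous_normed (hloc hf) x
    have c2 := (φ n).hasCompactSupport_normed (μ := μ)
      |>.convolutionExists_left (ContinuousLinearMap.lsmul ℝ ℝ) (φ n).continuous_normed (hloc hgL) x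
    simp only [hT, convolution_def, Pi.sub_apply]
    rw [← integral_sub c1 c2]
    simp [smul_sub]
  have h1 : eLpNorm (T f - T g) 2 μ ≤ ε / 3 := by
    rw [← hTsub]
    exact (eLpNorm_two_convolution_le (φ n).continuous_normed.measurable (φ n).nonneg_normed
      (φ n).lintegral_ofReal_normed (hf.sub hgL).1).trans hfg
  have h2 : eLpNorm (T g - g) 2 μ ≤ ε / 3 := by
    refine (eLpNorm_sub_le_of_dist_bdd μ (by norm_num) hK.measurableSet hc0.le ?_ ?_ hgK).trans hc
    · intro x
      refine ContDiffBump.dist_normed_convolution_le hg.aestronglyMeasurable fun y hy => ?_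
      exact (hδ (lt_of_lt_of_le (mem_ball.1 hy) (hn.le.trans (min_le_left _ _)))).le
    · refine (support_convolution_subset _).trans ?_
      rintro _ ⟨a, ha, b, hb, rfl⟩
      rw [(φ n).support_normed_eq, mem_ball_zero_iff] at ha
      refine mem_cthickening_of_dist_le (a + b) b 1 _ (subset_tsupport g hb) ?_
      simpa using (ha.trans (hn.trans_le (min_le_right _ _))).le
  have h3 : eLpNorm (g - f) 2 μ ≤ ε / 3 := by rwa [eLpNorm_sub_comm]
  have mT : ∀ {p : G → F}, MemLp p 2 μ → AEStronglyMeasurable (T p) μ := fun hp =>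
    ((φ n).memLp_two_convolution hp).1
  calc eLpNorm (T f - f) 2 μ
      = eLpNorm ((T f - T g) + ((T g - g) + (g - f))) 2 μ := by congr 1; abel
    _ ≤ eLpNorm (T f - T g) 2 μ + (eLpNorm (T g - g) 2 μ + eLpNorm (g - f) 2 μ) := by
        refine (eLpNorm_add_le ((mT hf).sub (mT hgL))
          (((mT hgL).sub hgL.1).add (hgL.1.sub hf.1)) (by norm_num)).trans ?_
        gcongr
        exact eLpNorm_add_le ((mT hgL).sub hgL.1) (hgL.1.sub hf.1) (by norm_num)
    _ ≤ ε / 3 + (ε / 3 + ε / 3) := by gcongr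
    _ = ε := by rw [← add_assoc]; exact ENNReal.add_thirds ε

end Mollification

/-- The derivative falls on the kernel, and `t ↦ φ (x - t)` is a test function. The sign from the
reflection cancels the sign in the definition of the weak derivative. -/
theorem HasWeakPartial.fderiv_convolution {m k : ℕ} {i : Fin m}
    {f g : EuclideanSpace ℝ (Fin m) → EuclideanSpace ℝ (Fin k)}
    (h : HasWeakPartial univ i f g) {φ : EuclideanSpace ℝ (Fin m) → ℝ} (hφ : ContDiff ℝ ∞ φ)
    (hc : HasCompactSupport φ) (x : EuclideanSpace ℝ (Fin m)) :
    fderiv ℝ (convolution φ f (ContinuousLinearMap.lsmul ℝ ℝ) volume) x (EuclideanSpace.single i 1)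
      = convolution φ g (ContinuousLinearMap.lsmul ℝ ℝ) volume x := by
  have hf : LocallyIntegrable f volume := by simpa [locallyIntegrableOn_univ] using h.1
  rw [(hc.hasFDerivAt_convolution_left (ContinuousLinearMap.lsmul ℝ ℝ) (hφ.of_le (by simp)) hf
    x).fderiv, convolution_lsmul_swap, convolution_eq_swap]
  have hcont : Continuous (fderiv ℝ φ) := hφ.continuous_fderiv (by simp)
  have hex := (hc.fderiv (𝕜 := ℝ)).convolutionExists_left
    (ContinuousLinearMap.precompL (EuclideanSpace ℝ (Fin m)) (ContinuousLinearMap.lsmul ℝ ℝ))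
    hcont hf x
  rw [ContinuousLinearMap.integral_apply (by exact hex.integrable_swap)]
  have hψ : ContDiff ℝ ∞ fun t => φ (x - t) := hφ.comp (contDiff_const.sub contDiff_id)
  have hψc : HasCompactSupport fun t => φ (x - t) :=
    hc.comp_homeomorph (Homeomorph.subLeft x)
  have key := h.2.2 _ hψ hψc (subset_univ _)
  have hd : ∀ t, fderiv ℝ (fun t => φ (x - t)) t (EuclideanSpace.single i 1)
      = - fderiv ℝ φ (x - t) (EuclideanSpace.single i 1) := by
    intro t
    have h1 : HasFDerivAt (fun t => x - t) (-(ContinuousLinearMap.id ℝ _)) t :=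
      (hasFDerivAt_id t).const_sub x
    have h2 := ((hφ.differentiable (by simp)) (x - t)).hasFDerivAt.comp t h1
    rw [show (fun t => φ (x - t)) = φ ∘ fun t => x - t from rfl, h2.fderiv]
    simp
  simp only [hd, neg_smul, integral_neg, neg_inj, Measure.restrict_univ] at key
  rw [← key]
  rfl

/-! ### The kinematic identity for smooth maps. -/

section KinematicSmooth

/-- The quadratic form in a first and second order jet `(g, h)` at `x` whose integral vanishes for
the jets of a `W^{2,2}` map; `a` is the value and `a'` the derivative of the weight at `‖x‖²`. -/
noncomputable def kinematicForm {m k : ℕ} (a a' : ℝ) (x : EuclideanSpace ℝ (Fin m))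
    (g : Fin m → EuclideanSpace ℝ (Fin k)) (h : Fin m → Fin m → EuclideanSpace ℝ (Fin k)) : ℝ :=
  4 * a * inner ℝ (∑ α, h α α) (∑ β, x β • (g β + ∑ α, x α • h α β))
    + 2 * (2 * ‖x‖ ^ 2 * a' + m * a) * inner ℝ (∑ α, h α α) (∑ α, x α • g α)
    - 4 * a * ∑ β, ‖g β + ∑ α, x α • h α β‖ ^ 2
    + 8 * a' * ‖∑ α, x α • g α‖ ^ 2
    - (2 * ‖x‖ ^ 2 * a' + (m - 2) * a) *
      (2 * ∑ β, inner ℝ (g β) (g β + ∑ α, x α • h α β) + 2 * ∑ β, ‖g β‖ ^ 2)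

variable {m k : ℕ}

theorem EuclideanSpace.sum_smul_single (x : EuclideanSpace ℝ (Fin m)) :
    ∑ i, x i • EuclideanSpace.single i (1 : ℝ) = x := by
  ext j
  simp [Pi.single_apply]

theorem ContinuousLinearMap.apply_eq_sum_single {F : Type*} [NormedAddCommGroup F]
    [NormedSpace ℝ F] (A : EuclideanSpace ℝ (Fin m) →L[ℝ] F) (x : EuclideanSpace ℝ (Fin m)) :
    A x = ∑ i, x i • A (EuclideanSpace.single i 1) := by
  conv_lhs => rw [← EuclideanSpace.sum_smul_single x]
  simp

theorem EuclideanSpace.contDiff_coord (i : Fin m) :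
    ContDiff ℝ ∞ fun x : EuclideanSpace ℝ (Fin m) => x i :=
  (EuclideanSpace.proj i : EuclideanSpace ℝ (Fin m) →L[ℝ] ℝ).contDiff

theorem EuclideanSpace.fderiv_coord (i : Fin m) (x v : EuclideanSpace ℝ (Fin m)) :
    fderiv ℝ (fun x : EuclideanSpace ℝ (Fin m) => x i) x v = v i := by
  have := (EuclideanSpace.proj i : EuclideanSpace ℝ (Fin m) →L[ℝ] ℝ).hasFDerivAt (x := x)
  rw [show (fun x : EuclideanSpace ℝ (Fin m) => x i)
    = (EuclideanSpace.proj i : EuclideanSpace ℝ (Fin m) →L[ℝ] ℝ) from rfl, this.fderiv]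
  rfl

theorem contDiff_comp_normSq {a : ℝ → ℝ} (ha : ContDiff ℝ ∞ a) :
    ContDiff ℝ ∞ fun x : EuclideanSpace ℝ (Fin m) => a (‖x‖ ^ 2) :=
  ha.comp (contDiff_norm_sq ℝ)

theorem hasFDerivAt_comp_normSq {a : ℝ → ℝ} (ha : Differentiable ℝ a)
    (x : EuclideanSpace ℝ (Fin m)) :
    HasFDerivAt (fun x : EuclideanSpace ℝ (Fin m) => a (‖x‖ ^ 2))
      ((2 * deriv a (‖x‖ ^ 2)) • innerSL ℝ x) x := by
  have h1 := (hasStrictFDerivAt_norm_sq x).hasFDerivAt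
  have h2 := (ha (‖x‖ ^ 2)).hasDerivAt.comp_hasFDerivAt x h1
  refine h2.congr_fderiv ?_
  ext v
  simp
  ring

theorem fderiv_comp_normSq {a : ℝ → ℝ} (ha : Differentiable ℝ a)
    (x v : EuclideanSpace ℝ (Fin m)) :
    fderiv ℝ (fun x : EuclideanSpace ℝ (Fin m) => a (‖x‖ ^ 2)) x v
      = 2 * deriv a (‖x‖ ^ 2) * inner ℝ x v := by
  rw [(hasFDerivAt_comp_normSq ha x).fderiv]
  simp

theorem hasCompactSupport_comp_normSq {a : ℝ → ℝ} (ha : HasCompactSupport a) :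
    HasCompactSupport fun x : EuclideanSpace ℝ (Fin m) => a (‖x‖ ^ 2) := by
  obtain ⟨r, hr⟩ := ha.isCompact.isBounded.subset_closedBall 0
  refine HasCompactSupport.intro (isCompact_closedBall (0 : EuclideanSpace ℝ (Fin m)) (|r| + 1)) ?_
  intro x hx
  rw [mem_closedBall_zero_iff, not_le] at hx
  by_contra hne
  have := hr (subset_tsupport a hne)
  rw [mem_closedBall_zero_iff, Real.norm_eq_abs, abs_of_nonneg (by positivity)] at this
  nlinarith [abs_nonneg r, le_abs_self r]

section

variable {F : Type*} [NormedAddCommGroup F] [NormedSpace ℝ F]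

theorem ContDiff.isSymmSndFDerivAt_infty {E : Type*} [NormedAddCommGroup E] [NormedSpace ℝ E]
    {f : E → F} (hf : ContDiff ℝ ∞ f) (x : E) : IsSymmSndFDerivAt ℝ f x := by
  refine (hf.contDiffAt (x := x)).isSymmSndFDerivAt ?_
  simp only [minSmoothness_of_isRCLikeNormedField]
  exact WithTop.coe_le_coe.2 (le_top : (2 : ℕ∞) ≤ ⊤)

theorem contDiff_fderiv_self {f : EuclideanSpace ℝ (Fin m) → F} (hf : ContDiff ℝ ∞ f) :
    ContDiff ℝ ∞ fun x => fderiv ℝ f x x :=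
  (hf.fderiv_right (m := ∞) (by simp)).clm_apply contDiff_id

/-- Differentiation in a fixed direction against the Euler operator `f ↦ (x ↦ Df(x) x)`. -/
theorem fderiv_fderiv_self {f : EuclideanSpace ℝ (Fin m) → F} (hf : ContDiff ℝ ∞ f)
    (x v : EuclideanSpace ℝ (Fin m)) :
    fderiv ℝ (fun x => fderiv ℝ f x x) x v
      = fderiv ℝ f x v + fderiv ℝ (fun y => fderiv ℝ f y v) x x := by
  have hd : DifferentiableAt ℝ (fderiv ℝ f) x :=
    (hf.fderiv_right (m := ∞) (by simp)).differentiable (by simp) x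
  have h1 := hd.hasFDerivAt.clm_apply (hasFDerivAt_id x)
  have h2 := hd.hasFDerivAt.clm_apply (hasFDerivAt_const v x)
  have hs : IsSymmSndFDerivAt ℝ f x := hf.isSymmSndFDerivAt_infty x
  simp only [id_eq] at h1
  rw [h1.fderiv, h2.fderiv]
  simp [hs.eq x v]

/-- The integrand is the divergence of the compactly supported field `g x`. -/
theorem integral_euler_add {g : EuclideanSpace ℝ (Fin m) → ℝ} (hg : ContDiff ℝ ∞ g)
    (hc : HasCompactSupport g) :
    Integrable (fun x => m * g x + fderiv ℝ g x x) ∧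
      ∫ x, (m * g x + fderiv ℝ g x x) = 0 := by
  have i0 : Integrable g := hg.continuous.integrable_of_hasCompactSupport hc
  have i1 : ∀ i : Fin m, Integrable fun x => x i * fderiv ℝ g x (EuclideanSpace.single i 1) :=
    fun i => ((EuclideanSpace.contDiff_coord i).mul
      (contDiff_fderiv_single hg _)).continuous.integrable_of_hasCompactSupport
      (hasCompactSupport_fderiv_single hc _).mul_left
  have i2 : ∀ i : Fin m, Integrable fun x : EuclideanSpace ℝ (Fin m) => x i * g x :=
    fun i => ((EuclideanSpace.contDiff_coord i).mul hg).continuous.integrable_of_hasCompactSupport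
      hc.mul_left
  have e : ∀ x, fderiv ℝ g x x = ∑ i, x i * fderiv ℝ g x (EuclideanSpace.single i 1) := by
    intro x
    rw [ContinuousLinearMap.apply_eq_sum_single]
    rfl
  have i3 : Integrable fun x => fderiv ℝ g x x := by
    simp only [e]
    exact integrable_finsetSum _ fun i _ => i1 i
  refine ⟨(i0.const_mul _).add i3, ?_⟩
  rw [integral_add (i0.const_mul _) i3, integral_const_mul]
  simp only [e]
  rw [integral_finsetSum _ fun i _ => i1 i]
  have key : ∀ i : Fin m, ∫ x : EuclideanSpace ℝ (Fin m),
      x i * fderiv ℝ g x (EuclideanSpace.single i 1) = - ∫ x, g x := by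
    intro i
    rw [integral_mul_fderiv_eq_neg_fderiv_mul_of_integrable (by simpa [EuclideanSpace.fderiv_coord] using i0)
      (i1 i) (i2 i) (fun x _ => (EuclideanSpace.contDiff_coord i).differentiable (by simp) x)
      (fun x _ => hg.differentiable (by simp) x)]
    simp [EuclideanSpace.fderiv_coord]
  simp [key]

end

/-- The `i`-th summand is the `i`-th derivative of `⟨∂_i f, Y⟩`, which has compact support. -/
theorem integral_inner_laplacian_add {f Y : EuclideanSpace ℝ (Fin m) → EuclideanSpace ℝ (Fin k)}
    (hf : ContDiff ℝ ∞ f) (hY : ContDiff ℝ ∞ Y) (hc : HasCompactSupport Y) :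
    Integrable (fun x => ∑ i, (inner ℝ (fderiv ℝ (fun y => fderiv ℝ f y (EuclideanSpace.single i 1)) x
        (EuclideanSpace.single i 1)) (Y x) + inner ℝ (fderiv ℝ f x (EuclideanSpace.single i 1))
          (fderiv ℝ Y x (EuclideanSpace.single i 1)))) ∧
      ∫ x, ∑ i, (inner ℝ (fderiv ℝ (fun y => fderiv ℝ f y (EuclideanSpace.single i 1)) x
        (EuclideanSpace.single i 1)) (Y x) + inner ℝ (fderiv ℝ f x (EuclideanSpace.single i 1))
          (fderiv ℝ Y x (EuclideanSpace.single i 1))) = 0 := by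
  have hint : ∀ {p q : EuclideanSpace ℝ (Fin m) → EuclideanSpace ℝ (Fin k)}, ContDiff ℝ ∞ p →
      ContDiff ℝ ∞ q → HasCompactSupport q → Integrable fun x => inner ℝ (p x) (q x) := by
    intro p q hp hq hqc
    refine (hp.inner ℝ hq).continuous.integrable_of_hasCompactSupport ?_
    refine hqc.mono fun x hx => ?_
    contrapose! hx
    simp only [Function.mem_support, not_not] at hx ⊢
    simp [hx]
  have h1 := fun i : Fin m => contDiff_fderiv_single hf (EuclideanSpace.single i 1)
  have h2 := fun i : Fin m => contDiff_fderiv_single (h1 i) (EuclideanSpace.single i 1)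
  have h3 := fun i : Fin m => contDiff_fderiv_single hY (EuclideanSpace.single i 1)
  have h4 := fun i : Fin m => hasCompactSupport_fderiv_single hc (EuclideanSpace.single i 1)
  have i1 := fun i => hint (h2 i) hY hc
  have i2 := fun i => hint (h1 i) (h3 i) (h4 i)
  refine ⟨integrable_finsetSum _ fun i _ => (i1 i).add (i2 i), ?_⟩
  rw [integral_finsetSum _ fun i _ => by exact (i1 i).add (i2 i)]
  refine Finset.sum_eq_zero fun i _ => ?_
  rw [integral_add (i1 i) (i2 i)]
  have := integral_bilinear_fderiv_right_eq_neg_left_of_integrable (μ := volume)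
    (f := fun x => fderiv ℝ f x (EuclideanSpace.single i 1)) (g := Y)
    (v := EuclideanSpace.single i (1 : ℝ)) (B := innerSL ℝ)
    (by exact i1 i) (by exact i2 i)
    (by exact hint (h1 i) hY hc) (fun x _ => (h1 i).differentiable (by simp) x)
    (fun x _ => hY.differentiable (by simp) x)
  exact (congrArg _ this).trans (add_neg_cancel _)

/-- The kinematic identity for smooth maps. -/
theorem integral_kinematicForm_of_contDiff
    {f : EuclideanSpace ℝ (Fin m) → EuclideanSpace ℝ (Fin k)} (hf : ContDiff ℝ ∞ f)
    {a : ℝ → ℝ} (ha : ContDiff ℝ ∞ a) (hc : HasCompactSupport a) :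
    ∫ x, kinematicForm (a (‖x‖ ^ 2)) (deriv a (‖x‖ ^ 2)) x
      (fun i => fderiv ℝ f x (EuclideanSpace.single i 1))
      (fun i j => fderiv ℝ (fun y => fderiv ℝ f y (EuclideanSpace.single i 1)) x
        (EuclideanSpace.single j 1)) = 0 := by
  have ha1 : ContDiff ℝ ∞ (deriv a) := by simpa using ha.iterate_deriv 1
  have ha2 : ContDiff ℝ ∞ (deriv (deriv a)) := by simpa using ha1.iterate_deriv 1
  have hw := contDiff_comp_normSq (m := m) ha
  have hw1 := contDiff_comp_normSq (m := m) ha1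
  have hwc := hasCompactSupport_comp_normSq (m := m) hc
  have hwc1 := hasCompactSupport_comp_normSq (m := m) hc.deriv
  -- This is the coefficient of `⟨Δf, x^α f_α⟩` in the kinematic form.
  let ψ : ℝ → ℝ := fun s => 4 * s * deriv a s + 2 * m * a s
  have hψ : ContDiff ℝ ∞ ψ := by fun_prop
  have hψc : HasCompactSupport ψ := (hc.deriv.mul_left).add (hc.mul_left)
  have hψ' : ∀ s, deriv ψ s = 4 * deriv a s + 4 * s * deriv (deriv a) s + 2 * m * deriv a s := by
    intro s
    have d1 := (ha1.differentiable (by simp) s).hasDerivAt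
    have d0 := (ha.differentiable (by simp) s).hasDerivAt
    have := (((hasDerivAt_id s).const_mul 4).mul d1).add (d0.const_mul (2 * (m : ℝ)))
    simp only [id_eq] at this
    rw [show ψ = ((fun y => 4 * y) * deriv a + fun y => 2 * (m : ℝ) * a y) from rfl, this.deriv]
    ring
  set e : Fin m → EuclideanSpace ℝ (Fin m) := fun i => EuclideanSpace.single i 1 with he
  let X := fun x => fderiv ℝ f x x
  let fi := fun i x => fderiv ℝ f x (e i)
  let Y := fun i x => fderiv ℝ X x (e i)
  let DX := fun x => fderiv ℝ X x x
  have hX : ContDiff ℝ ∞ X := contDiff_fderiv_self hf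
  have hfi : ∀ i, ContDiff ℝ ∞ (fi i) := fun i => contDiff_fderiv_single hf _
  have hY : ∀ i, ContDiff ℝ ∞ (Y i) := fun i => contDiff_fderiv_single hX _
  have hDX : ContDiff ℝ ∞ DX := contDiff_fderiv_self hX
  let S1 := fun x => ∑ i, inner ℝ (fi i x) (Y i x)
  let N := fun x => ∑ i, inner ℝ (fi i x) (fi i x)
  have hS1 : ContDiff ℝ ∞ S1 := ContDiff.sum fun i _ => (hfi i).inner ℝ (hY i)
  have hN : ContDiff ℝ ∞ N := ContDiff.sum fun i _ => (hfi i).inner ℝ (hfi i)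
  -- Write `D` for the Euler operator, `X = Df`, `Y i = ∂_i X`. The integral `I1` produces `⟨Δf,
  -- D²f⟩` together with the third-order terms `⟨∂_i f, D Y_i⟩`, which `I2` removes at the price of
  -- `|Y|²`. Then `I3` removes `⟨X, DX⟩`, as well as the second derivative of `a` that `I4` brings
  -- in with `⟨Δf, X⟩`. Finally `I5` gives `⟨∂_i f, Y_i⟩` and `|∇f|²` the common factor `2 s a' + (m
  -- - 2) a`.
  have I1 := integral_inner_laplacian_add hf (hw.smul hDX) hwc.smul_right
  have I2 := integral_euler_add (hw.mul hS1) hwc.mul_right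
  have I3 := integral_euler_add (hw1.mul (hX.inner ℝ hX)) hwc1.mul_right
  have I4 := integral_inner_laplacian_add hf ((contDiff_comp_normSq hψ).smul hX)
    (hasCompactSupport_comp_normSq hψc).smul_right
  have I5 := integral_euler_add (hw.mul hN) hwc.mul_right
  have hpt : ∀ x, kinematicForm (a (‖x‖ ^ 2)) (deriv a (‖x‖ ^ 2)) x
      (fun i => fderiv ℝ f x (EuclideanSpace.single i 1))
      (fun i j => fderiv ℝ (fun y => fderiv ℝ f y (EuclideanSpace.single i 1)) x
        (EuclideanSpace.single j 1)) = 
      4 * (∑ i, (inner ℝ (fderiv ℝ (fun y => fderiv ℝ f y (EuclideanSpace.single i 1)) x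
        (EuclideanSpace.single i 1)) (a (‖x‖ ^ 2) • DX x) + inner ℝ (fderiv ℝ f x (EuclideanSpace.single i 1))
          (fderiv ℝ (fun x => a (‖x‖ ^ 2) • DX x) x (EuclideanSpace.single i 1)))) -
      4 * (m * (a (‖x‖ ^ 2) * S1 x) + fderiv ℝ (fun x => a (‖x‖ ^ 2) * S1 x) x x) -
      4 * (m * (deriv a (‖x‖ ^ 2) * inner ℝ (X x) (X x))
        + fderiv ℝ (fun x => deriv a (‖x‖ ^ 2) * inner ℝ (X x) (X x)) x x) +
      (∑ i, (inner ℝ (fderiv ℝ (fun y => fderiv ℝ f y (EuclideanSpace.single i 1)) x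
        (EuclideanSpace.single i 1)) (ψ (‖x‖ ^ 2) • X x) + inner ℝ (fderiv ℝ f x (EuclideanSpace.single i 1))
          (fderiv ℝ (fun x => ψ (‖x‖ ^ 2) • X x) x (EuclideanSpace.single i 1)))) -
      2 * (m * (a (‖x‖ ^ 2) * N x) + fderiv ℝ (fun x => a (‖x‖ ^ 2) * N x) x x) := by
    intro x
    have dfi : ∀ (i : Fin m), fderiv ℝ (fi i) x x = Y i x - fi i x := by
      intro i
      have := fderiv_fderiv_self hf x (e i)
      simp only [Y, X, fi, this]
      abel
    -- By symmetry of the second derivative the contraction of the Hessian with `x` is `D (∂_β f)`,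
    -- and the commutator of `∂_β` and `D` is `∂_β`.
    have hh : ∀ β, ∑ α, x α • fderiv ℝ (fun y => fderiv ℝ f y (e α)) x (e β)
        = Y β x - fi β x := by
      intro β
      rw [← dfi β]
      have hd : DifferentiableAt ℝ (fderiv ℝ f) x :=
        (hf.fderiv_right (m := ∞) (by simp)).differentiable (by simp) x
      have hs : IsSymmSndFDerivAt ℝ f x := hf.isSymmSndFDerivAt_infty x
      have h2 : ∀ v w, fderiv ℝ (fun y => fderiv ℝ f y v) x w = fderiv ℝ (fderiv ℝ f) x w v := by
        intro v w
        have := hd.hasFDerivAt.clm_apply (hasFDerivAt_const v x)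
        rw [this.fderiv]
        simp
      simp only [fi, h2]
      rw [hs.eq x (e β), ← ContinuousLinearMap.apply_eq_sum_single]
    have hXs : ∑ α, x α • fderiv ℝ f x (e α) = X x :=
      (ContinuousLinearMap.apply_eq_sum_single _ _).symm
    have hDXs : ∑ β, x β • Y β x = DX x := (ContinuousLinearMap.apply_eq_sum_single _ _).symm
    have dDX : ∀ i, fderiv ℝ DX x (e i) = Y i x + fderiv ℝ (Y i) x x := fun i =>
      fderiv_fderiv_self hX x (e i)
    have hxe : ∀ i, inner ℝ x (e i) = x i := fun i => by
      simp [he, EuclideanSpace.inner_single_right]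
    have hda := ha.differentiable (by simp)
    have hda1 := ha1.differentiable (by simp)
    have diffw : ∀ {b : ℝ → ℝ} (hb : ContDiff ℝ ∞ b) {p : EuclideanSpace ℝ (Fin m) → ℝ}
        (hp : ContDiff ℝ ∞ p), fderiv ℝ (fun x => b (‖x‖ ^ 2) * p x) x x
          = 2 * ‖x‖ ^ 2 * deriv b (‖x‖ ^ 2) * p x + b (‖x‖ ^ 2) * fderiv ℝ p x x := by
      intro b hb p hp
      have h1 := (hasFDerivAt_comp_normSq (hb.differentiable (by simp)) x).mul
        (hp.differentiable (by simp) x).hasFDerivAt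
      rw [show (fun x : EuclideanSpace ℝ (Fin m) => b (‖x‖ ^ 2) * p x)
        = (fun x => b (‖x‖ ^ 2)) * p from rfl, h1.fderiv]
      simp
      ring
    have diffs : ∀ {b : ℝ → ℝ} (hb : ContDiff ℝ ∞ b)
        {p : EuclideanSpace ℝ (Fin m) → EuclideanSpace ℝ (Fin k)}
        (hp : ContDiff ℝ ∞ p) (i : Fin m), fderiv ℝ (fun x => b (‖x‖ ^ 2) • p x) x (e i)
          = (2 * deriv b (‖x‖ ^ 2) * x i) • p x + b (‖x‖ ^ 2) • fderiv ℝ p x (e i) := by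
      intro b hb p hp i
      have h1 := (hasFDerivAt_comp_normSq (hb.differentiable (by simp)) x).smul
        (hp.differentiable (by simp) x).hasFDerivAt
      rw [HasFDerivAt.fderiv (f := fun x : EuclideanSpace ℝ (Fin m) => b (‖x‖ ^ 2) • p x) h1]
      simp [hxe, add_comm]
    have dinner : ∀ {p q : EuclideanSpace ℝ (Fin m) → EuclideanSpace ℝ (Fin k)}
        (hp : ContDiff ℝ ∞ p) (hq : ContDiff ℝ ∞ q),
        fderiv ℝ (fun x => inner ℝ (p x) (q x)) x x
          = inner ℝ (p x) (fderiv ℝ q x x) + inner ℝ (fderiv ℝ p x x) (q x) := fun hp hq =>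
      fderiv_inner_apply ℝ (hp.differentiable (by simp) x) (hq.differentiable (by simp) x) x
    have dS1 : fderiv ℝ S1 x x = ∑ i, inner ℝ (fi i x) (fderiv ℝ (Y i) x x)
        + ∑ i, ‖Y i x‖ ^ 2 - S1 x := by
      rw [fderiv_fun_sum fun i _ => ((hfi i).inner ℝ (hY i)).differentiable (by simp) x]
      simp only [sum_apply, dinner (hfi _) (hY _), dfi, S1, inner_sub_left,
        Finset.sum_add_distrib, Finset.sum_sub_distrib, real_inner_self_eq_norm_sq]
      ring
    have dN : fderiv ℝ N x x = 2 * S1 x - 2 * N x := by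
      rw [fderiv_fun_sum fun i _ => ((hfi i).inner ℝ (hfi i)).differentiable (by simp) x]
      simp only [sum_apply, dinner (hfi _) (hfi _), dfi, S1, N, inner_sub_left,
        inner_sub_right, Finset.sum_add_distrib, Finset.sum_sub_distrib,
        real_inner_comm (fi _ x) (Y _ x)]
      ring
    have dXX : fderiv ℝ (fun x => inner ℝ (X x) (X x)) x x = 2 * inner ℝ (X x) (DX x) := by
      have : inner ℝ (fderiv ℝ X x x) (X x) = inner ℝ (X x) (DX x) := real_inner_comm _ _
      rw [dinner hX hX, this, two_mul]
    have hsum : ∀ (c : ℝ) (V : EuclideanSpace ℝ (Fin k)),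
        ∑ i, inner ℝ (fi i x) ((c * x i) • V) = c * inner ℝ (X x) V := by
      intro c V
      rw [← hXs, sum_inner, Finset.mul_sum]
      refine Finset.sum_congr rfl fun i _ => ?_
      rw [inner_smul_right, inner_smul_left]
      simp only [fi, RCLike.conj_to_real]
      ring
    have hN' : ∑ i, ‖fi i x‖ ^ 2 = N x := by simp [N]
    have hYadd : ∀ β, fi β x + (Y β x - fi β x) = Y β x := fun β => by abel
    unfold kinematicForm
    have hh' : ∀ β, fi β x + ∑ α, x α • fderiv ℝ (fi α) x (e β) = Y β x := fun β => by
      rw [hh β, hYadd]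
    change 4 * a (‖x‖ ^ 2) * inner ℝ (∑ α, fderiv ℝ (fi α) x (e α))
      (∑ β, x β • (fi β x + ∑ α, x α • fderiv ℝ (fi α) x (e β))) + 2 * (2 * ‖x‖ ^ 2 * deriv a (‖x‖ ^ 2)
        + m * a (‖x‖ ^ 2)) * inner ℝ (∑ α, fderiv ℝ (fi α) x (e α)) (∑ α, x α • fi α x)
      - 4 * a (‖x‖ ^ 2) * ∑ β, ‖fi β x + ∑ α, x α • fderiv ℝ (fi α) x (e β)‖ ^ 2
      + 8 * deriv a (‖x‖ ^ 2) * ‖∑ α, x α • fi α x‖ ^ 2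
      - (2 * ‖x‖ ^ 2 * deriv a (‖x‖ ^ 2) + (m - 2) * a (‖x‖ ^ 2)) *
        (2 * ∑ β, inner ℝ (fi β x) (fi β x + ∑ α, x α • fderiv ℝ (fi α) x (e β))
          + 2 * ∑ β, ‖fi β x‖ ^ 2) = _
    have hXs' : ∑ α, x α • fi α x = X x := hXs
    simp only [hh', hXs', hDXs, hN']
    change _ = 4 * (∑ i, (inner ℝ (fderiv ℝ (fi i) x (e i)) (a (‖x‖ ^ 2) • DX x) + inner ℝ (fi i x)
          (fderiv ℝ (fun x => a (‖x‖ ^ 2) • DX x) x (e i)))) -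
      4 * (m * (a (‖x‖ ^ 2) * S1 x) + fderiv ℝ (fun x => a (‖x‖ ^ 2) * S1 x) x x) -
      4 * (m * (deriv a (‖x‖ ^ 2) * inner ℝ (X x) (X x))
        + fderiv ℝ (fun x => deriv a (‖x‖ ^ 2) * inner ℝ (X x) (X x)) x x) +
      (∑ i, (inner ℝ (fderiv ℝ (fi i) x (e i)) (ψ (‖x‖ ^ 2) • X x) + inner ℝ (fi i x)
          (fderiv ℝ (fun x => ψ (‖x‖ ^ 2) • X x) x (e i)))) -
      2 * (m * (a (‖x‖ ^ 2) * N x) + fderiv ℝ (fun x => a (‖x‖ ^ 2) * N x) x x)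
    rw [diffw ha hS1, diffw ha1 (hX.inner ℝ hX), diffw ha hN, dS1, dN, dXX]
    simp only [diffs ha hDX, diffs hψ hX, dDX, hψ', Finset.sum_add_distrib, inner_add_right, hsum]
    simp only [inner_smul_right, smul_add, inner_add_right,
      Finset.sum_add_distrib, ← Finset.mul_sum, sum_inner, real_inner_self_eq_norm_sq]
    have hS1' : ∑ i, inner ℝ (fi i x) (Y i x) = S1 x := rfl
    have hYi : ∑ i, inner ℝ (fi i x) (fderiv ℝ X x (e i)) = S1 x := rfl
    simp only [hS1', hYi, ψ]
    ring
  simp only [hpt]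
  have Z : ∀ {p q : EuclideanSpace ℝ (Fin m) → ℝ} (c : ℝ), (Integrable p ∧ ∫ x, p x = 0) →
      (Integrable q ∧ ∫ x, q x = 0) →
      (Integrable (fun x => p x - c * q x) ∧ ∫ x, (p x - c * q x) = 0) := by
    intro p q c hp hq
    refine ⟨hp.1.sub (hq.1.const_mul c), ?_⟩
    rw [integral_sub hp.1 (hq.1.const_mul c), integral_const_mul, hp.2, hq.2]
    simp
  have Z' : ∀ {p q : EuclideanSpace ℝ (Fin m) → ℝ}, (Integrable p ∧ ∫ x, p x = 0) →
      (Integrable q ∧ ∫ x, q x = 0) →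
      (Integrable (fun x => p x + q x) ∧ ∫ x, (p x + q x) = 0) := by
    intro p q hp hq
    refine ⟨hp.1.add hq.1, ?_⟩
    rw [integral_add hp.1 hq.1, hp.2, hq.2, add_zero]
  exact (Z 2 (Z' (Z 4 (Z 4 ⟨I1.1.const_mul 4, by rw [integral_const_mul, I1.2, mul_zero]⟩ I2) I3) I4)
    I5).2

end KinematicSmooth

/-! ### L² convergence and convergence of integrals of products. -/

section L2Convergence

variable {α F : Type*} [MeasurableSpace α] [NormedAddCommGroup F] [InnerProductSpace ℝ F]
  {μ : Measure α}

/-- Convergence in `L²`, for functions rather than classes. -/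
def TendstoL2 {α F : Type*} [MeasurableSpace α] [NormedAddCommGroup F] (μ : Measure α) (p : ℕ → α → F) (q : α → F) : Prop :=
  (∀ n, MemLp (p n) 2 μ) ∧ MemLp q 2 μ ∧
    Tendsto (fun n => eLpNorm (p n - q) 2 μ) atTop (𝓝 0)

theorem TendstoL2.mono_measure {α F : Type*} [MeasurableSpace α] [NormedAddCommGroup F]
    {μ ν : Measure α} (hν : ν ≤ μ) {p : ℕ → α → F} {q : α → F}
    (h : TendstoL2 μ p q) : TendstoL2 ν p q :=
  ⟨fun n => (h.1 n).mono_measure hν, h.2.1.mono_measure hν,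
    tendsto_of_tendsto_of_tendsto_of_le_of_le tendsto_const_nhds h.2.2 (fun _ => zero_le)
      fun _ => eLpNorm_mono_measure _ hν⟩

theorem TendstoL2.add {α F : Type*} [MeasurableSpace α] [NormedAddCommGroup F]
    {μ : Measure α} {p p' : ℕ → α → F} {q q' : α → F} (h : TendstoL2 μ p q)
    (h' : TendstoL2 μ p' q') : TendstoL2 μ (fun n x => p n x + p' n x) (fun x => q x + q' x) := by
  refine ⟨fun n => (h.1 n).add (h'.1 n), h.2.1.add h'.2.1, ?_⟩
  have ht := h.2.2.add h'.2.2
  rw [add_zero] at ht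
  have hb : ∀ n, eLpNorm ((fun x => p n x + p' n x) - fun x => q x + q' x) 2 μ
      ≤ eLpNorm (p n - q) 2 μ + eLpNorm (p' n - q') 2 μ := by
    intro n
    have e : ((fun x => p n x + p' n x) - fun x => q x + q' x) = (p n - q) + (p' n - q') := by
      ext x
      simp only [Pi.sub_apply, Pi.add_apply]
      abel
    rw [e]
    exact eLpNorm_add_le ((h.1 n).sub h.2.1).1 ((h'.1 n).sub h'.2.1).1 (by norm_num)
  exact tendsto_of_tendsto_of_tendsto_of_le_of_le tendsto_const_nhds ht (fun _ => zero_le) hb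

theorem TendstoL2.sum {α F ι : Type*} [MeasurableSpace α] [NormedAddCommGroup F]
    {μ : Measure α} (s : Finset ι) {p : ι → ℕ → α → F} {q : ι → α → F}
    (h : ∀ i ∈ s, TendstoL2 μ (p i) (q i)) :
    TendstoL2 μ (fun n x => ∑ i ∈ s, p i n x) (fun x => ∑ i ∈ s, q i x) := by
  classical
  induction s using Finset.induction_on with
  | empty => exact ⟨fun n => by simp, by simp, by simp⟩
  | insert a s ha ih =>
    simp only [Finset.sum_insert ha]
    exact (h a (by simp)).add (ih fun b hb => h b (by simp [hb]))

/-- Convergence of integrals of integrable functions. -/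
def TendstoIntegral (μ : Measure α) (p : ℕ → α → ℝ) (q : α → ℝ) : Prop :=
  (∀ n, Integrable (p n) μ) ∧ Integrable q μ ∧
    Tendsto (fun n => ∫ x, p n x ∂μ) atTop (𝓝 (∫ x, q x ∂μ))

/-- Continuity of the inner product of the Hilbert space L². -/
theorem TendstoL2.integral_inner {p p' : ℕ → α → F} {q q' : α → F} (h : TendstoL2 μ p q)
    (h' : TendstoL2 μ p' q') :
    TendstoIntegral μ (fun n x => inner ℝ (p n x) (p' n x)) (fun x => inner ℝ (q x) (q' x)) := by
  have e : ∀ {f g : α → F} (hf : MemLp f 2 μ) (hg : MemLp g 2 μ),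
      Integrable (fun x => inner ℝ (f x) (g x)) μ ∧
        ∫ x, inner ℝ (f x) (g x) ∂μ = inner ℝ (hf.toLp f) (hg.toLp g) := by
    intro f g hf hg
    have hae : (fun x => inner ℝ (hf.toLp f x) (hg.toLp g x)) =ᵐ[μ]
        fun x => inner ℝ (f x) (g x) := by
      filter_upwards [hf.coeFn_toLp, hg.coeFn_toLp] with x h1 h2
      rw [h1, h2]
    exact ⟨(L2.integrable_inner (𝕜 := ℝ) (hf.toLp f) (hg.toLp g)).congr hae,
      by rw [L2.inner_def, integral_congr_ae hae]⟩
  have t : ∀ {p : ℕ → α → F} {q : α → F} (h : TendstoL2 μ p q),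
      Tendsto (fun n => (h.1 n).toLp (p n)) atTop (𝓝 (h.2.1.toLp q)) := by
    intro p q h
    rw [Lp.tendsto_Lp_iff_tendsto_eLpNorm'']
    exact h.2.2
  refine ⟨fun n => (e (h.1 n) (h'.1 n)).1, (e h.2.1 h'.2.1).1, ?_⟩
  rw [(e h.2.1 h'.2.1).2]
  simp only [fun n => (e (h.1 n) (h'.1 n)).2]
  exact (t h).inner (t h')

theorem TendstoL2.smul {p : ℕ → α → F} {q : α → F} (h : TendstoL2 μ p q) {c : α → ℝ}
    (hc : AEStronglyMeasurable c μ) {C : ℝ} (hC : ∀ᵐ x ∂μ, ‖c x‖ ≤ C) :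
    TendstoL2 μ (fun n x => c x • p n x) (fun x => c x • q x) := by
  have hm : MemLp c ⊤ μ := memLp_top_of_bound hc C hC
  refine ⟨fun n => (h.1 n).smul hm, h.2.1.smul hm, ?_⟩
  have hb : ∀ n, eLpNorm ((fun x => c x • p n x) - fun x => c x • q x) 2 μ
      ≤ eLpNorm c ⊤ μ * eLpNorm (p n - q) 2 μ := by
    intro n
    have : ((fun x => c x • p n x) - fun x => c x • q x) = c • (p n - q) := by
      ext x
      simp [smul_sub]
    rw [this]
    exact eLpNorm_smul_le_mul_eLpNorm (p := ⊤) (q := 2) (r := 2)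
      ((h.1 n).sub h.2.1).1 hc
  have := ENNReal.Tendsto.const_mul h.2.2 (Or.inr hm.2.ne)
  rw [mul_zero] at this
  exact tendsto_of_tendsto_of_tendsto_of_le_of_le tendsto_const_nhds this (fun _ => zero_le) hb

theorem TendstoIntegral.add {p p' : ℕ → α → ℝ} {q q' : α → ℝ} (h : TendstoIntegral μ p q)
    (h' : TendstoIntegral μ p' q') :
    TendstoIntegral μ (fun n x => p n x + p' n x) (fun x => q x + q' x) := by
  refine ⟨fun n => (h.1 n).add (h'.1 n), h.2.1.add h'.2.1, ?_⟩
  rw [integral_add h.2.1 h'.2.1]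
  simp only [fun n => integral_add (h.1 n) (h'.1 n)]
  exact h.2.2.add h'.2.2

theorem TendstoIntegral.sub {p p' : ℕ → α → ℝ} {q q' : α → ℝ} (h : TendstoIntegral μ p q)
    (h' : TendstoIntegral μ p' q') :
    TendstoIntegral μ (fun n x => p n x - p' n x) (fun x => q x - q' x) := by
  refine ⟨fun n => (h.1 n).sub (h'.1 n), h.2.1.sub h'.2.1, ?_⟩
  rw [integral_sub h.2.1 h'.2.1]
  simp only [fun n => integral_sub (h.1 n) (h'.1 n)]
  exact h.2.2.sub h'.2.2

theorem TendstoIntegral.sum {ι : Type*} (s : Finset ι) {p : ι → ℕ → α → ℝ} {q : ι → α → ℝ}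
    (h : ∀ i ∈ s, TendstoIntegral μ (p i) (q i)) :
    TendstoIntegral μ (fun n x => ∑ i ∈ s, p i n x) (fun x => ∑ i ∈ s, q i x) := by
  classical
  induction s using Finset.induction_on with
  | empty => exact ⟨fun n => by simp, by simp, by simp⟩
  | insert a s ha ih =>
    simp only [Finset.sum_insert ha]
    exact (h a (by simp)).add (ih fun b hb => h b (by simp [hb]))

end L2Convergence

/-! ### The kinematic identity for W^{2,2} maps on the whole space. -/

section KinematicSobolev

variable {m k : ℕ}

/-- Each weight is moved into one slot of an inner product, so that every term pairs two L²
convergent sequences, one of them multiplied by a bounded function. -/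
theorem kinematicForm_eq_inner (a a' : ℝ) (x : EuclideanSpace ℝ (Fin m))
    (g : Fin m → EuclideanSpace ℝ (Fin k)) (h : Fin m → Fin m → EuclideanSpace ℝ (Fin k)) :
    kinematicForm a a' x g h =
      inner ℝ ((4 * a) • ∑ α, h α α) (∑ β, x β • (g β + ∑ α, x α • h α β))
      + inner ℝ ((2 * (2 * ‖x‖ ^ 2 * a' + m * a)) • ∑ α, h α α) (∑ α, x α • g α)
      - (∑ β, inner ℝ ((4 * a) • (g β + ∑ α, x α • h α β)) (g β + ∑ α, x α • h α β))
      + inner ℝ ((8 * a') • ∑ α, x α • g α) (∑ α, x α • g α)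
      - ((∑ β, inner ℝ ((2 * (2 * ‖x‖ ^ 2 * a' + (m - 2) * a)) • g β) (g β + ∑ α, x α • h α β))
        + ∑ β, inner ℝ ((2 * (2 * ‖x‖ ^ 2 * a' + (m - 2) * a)) • g β) (g β)) := by
  unfold kinematicForm
  simp only [real_inner_smul_left, real_inner_self_eq_norm_sq, ← Finset.mul_sum]
  ring

/-- The kinematic form depends continuously on jets in `L²`. -/
theorem tendstoIntegral_kinematicForm {μ : Measure (EuclideanSpace ℝ (Fin m))} {a a' : ℝ → ℝ}
    (ha : Continuous a) (ha' : Continuous a') {r : ℝ} (hr : ∀ᵐ x ∂μ, ‖x‖ ≤ r)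
    {g : ℕ → Fin m → EuclideanSpace ℝ (Fin m) → EuclideanSpace ℝ (Fin k)}
    {h : ℕ → Fin m → Fin m → EuclideanSpace ℝ (Fin m) → EuclideanSpace ℝ (Fin k)}
    {g₀ : Fin m → EuclideanSpace ℝ (Fin m) → EuclideanSpace ℝ (Fin k)}
    {h₀ : Fin m → Fin m → EuclideanSpace ℝ (Fin m) → EuclideanSpace ℝ (Fin k)}
    (hg : ∀ i, TendstoL2 μ (fun n => g n i) (g₀ i))
    (hh : ∀ i j, TendstoL2 μ (fun n => h n i j) (h₀ i j)) :
    TendstoIntegral μ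
      (fun n x => kinematicForm (a (‖x‖ ^ 2)) (a' (‖x‖ ^ 2)) x (fun i => g n i x) fun i j => h n i j x)
      (fun x => kinematicForm (a (‖x‖ ^ 2)) (a' (‖x‖ ^ 2)) x (fun i => g₀ i x)
        fun i j => h₀ i j x) := by
  have bdd : ∀ {c : EuclideanSpace ℝ (Fin m) → ℝ}, Continuous c → ∃ C, ∀ᵐ x ∂μ, ‖c x‖ ≤ C := by
    intro c hc
    obtain ⟨C, hC⟩ := (isCompact_closedBall (0 : EuclideanSpace ℝ (Fin m)) r).exists_bound_of_continuousOn
      hc.continuousOn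
    exact ⟨C, by filter_upwards [hr] with x hx using hC x (by simpa using hx)⟩
  have sm : ∀ {c : EuclideanSpace ℝ (Fin m) → ℝ} (_ : Continuous c)
      {p : ℕ → EuclideanSpace ℝ (Fin m) → EuclideanSpace ℝ (Fin k)}
      {q : EuclideanSpace ℝ (Fin m) → EuclideanSpace ℝ (Fin k)}, TendstoL2 μ p q →
      TendstoL2 μ (fun n x => c x • p n x) (fun x => c x • q x) := by
    intro c hc p q h
    obtain ⟨C, hC⟩ := bdd hc
    exact h.smul hc.aestronglyMeasurable hC
  have hx : ∀ i : Fin m, Continuous fun x : EuclideanSpace ℝ (Fin m) => x i := fun i =>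
    (EuclideanSpace.contDiff_coord i).continuous
  have hX := TendstoL2.sum Finset.univ fun i _ => sm (hx i) (hg i)
  have hL := TendstoL2.sum Finset.univ fun i _ => hh i i
  have hY := fun j => (hg j).add (TendstoL2.sum Finset.univ fun i _ => sm (hx i) (hh i j))
  have hDX := TendstoL2.sum Finset.univ fun j _ => sm (hx j) (hY j)
  simp only [kinematicForm_eq_inner]
  have c1 : Continuous fun x : EuclideanSpace ℝ (Fin m) => 4 * a (‖x‖ ^ 2) := by fun_prop
  have c2 : Continuous fun x : EuclideanSpace ℝ (Fin m) =>
    2 * (2 * ‖x‖ ^ 2 * a' (‖x‖ ^ 2) + m * a (‖x‖ ^ 2)) := by fun_prop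
  have c3 : Continuous fun x : EuclideanSpace ℝ (Fin m) => 8 * a' (‖x‖ ^ 2) := by fun_prop
  have c4 : Continuous fun x : EuclideanSpace ℝ (Fin m) =>
    2 * (2 * ‖x‖ ^ 2 * a' (‖x‖ ^ 2) + (m - 2) * a (‖x‖ ^ 2)) := by fun_prop
  exact (((((sm c1 hL).integral_inner hDX).add ((sm c2 hL).integral_inner hX)).sub
    (TendstoIntegral.sum Finset.univ fun j _ => (sm c1 (hY j)).integral_inner (hY j))).add
    ((sm c3 hX).integral_inner hX)).sub
    ((TendstoIntegral.sum Finset.univ fun j _ => (sm c4 (hg j)).integral_inner (hY j)).add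
      (TendstoIntegral.sum Finset.univ fun j _ => (sm c4 (hg j)).integral_inner (hg j)))

/-- The kinematic identity for maps in `W^{2,2}(ℝ^m)`. -/
theorem integral_kinematicForm_of_hasWeakPartial
    {w : EuclideanSpace ℝ (Fin m) → EuclideanSpace ℝ (Fin k)}
    {g : Fin m → EuclideanSpace ℝ (Fin m) → EuclideanSpace ℝ (Fin k)}
    {h : Fin m → Fin m → EuclideanSpace ℝ (Fin m) → EuclideanSpace ℝ (Fin k)}
    (hwl : LocallyIntegrable w) (hw : ∀ i, HasWeakPartial univ i w (g i)) (hgh : ∀ i j, HasWeakPartial univ j (g i) (h i j))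
    (hg : ∀ i, MemLp (g i) 2 volume) (hh : ∀ i j, MemLp (h i j) 2 volume)
    {a : ℝ → ℝ} (ha : ContDiff ℝ ∞ a) (hc : HasCompactSupport a) :
    ∫ x, kinematicForm (a (‖x‖ ^ 2)) (deriv a (‖x‖ ^ 2)) x (fun i => g i x)
      (fun i j => h i j x) = 0 := by
  have ha1 : ContDiff ℝ ∞ (deriv a) := by simpa using ha.iterate_deriv 1
  let φ : ℕ → ContDiffBump (0 : EuclideanSpace ℝ (Fin m)) := fun n =>
    ⟨1 / ((n : ℝ) + 2), 1 / ((n : ℝ) + 1), by positivity,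
      one_div_lt_one_div_of_lt (by positivity) (by linarith)⟩
  have hφ : Tendsto (fun n => (φ n).rOut) atTop (𝓝 0) := tendsto_one_div_add_atTop_nhds_zero_nat
  let T : ℕ → (EuclideanSpace ℝ (Fin m) → EuclideanSpace ℝ (Fin k)) →
    EuclideanSpace ℝ (Fin m) → EuclideanSpace ℝ (Fin k) := fun n p =>
    convolution ((φ n).normed volume) p (ContinuousLinearMap.lsmul ℝ ℝ) volume
  have hT : ∀ {p}, MemLp p 2 volume → TendstoL2 volume (fun n => T n p) p := fun hp =>
    ⟨fun n => (φ n).memLp_two_convolution hp, hp, tendsto_eLpNorm_two_convolution hφ hp⟩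
  obtain ⟨r, hr⟩ : ∃ r : ℝ, ∀ x : EuclideanSpace ℝ (Fin m), r < ‖x‖ →
      a (‖x‖ ^ 2) = 0 ∧ deriv a (‖x‖ ^ 2) = 0 := by
    obtain ⟨r1, h1⟩ := (hasCompactSupport_comp_normSq (m := m) hc).isCompact.isBounded.subset_closedBall 0
    obtain ⟨r2, h2⟩ :=
      (hasCompactSupport_comp_normSq (m := m) hc.deriv).isCompact.isBounded.subset_closedBall 0
    refine ⟨max r1 r2, fun x hx => ⟨?_, ?_⟩⟩
    · by_contra hne
      have := h1 (subset_tsupport _ hne)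
      rw [mem_closedBall_zero_iff] at this
      exact absurd (this.trans (le_max_left r1 r2)) (not_le.2 hx)
    · by_contra hne
      have := h2 (subset_tsupport _ hne)
      rw [mem_closedBall_zero_iff] at this
      exact absurd (this.trans (le_max_right r1 r2)) (not_le.2 hx)
  -- The coefficients involve `x` and are bounded only on balls. The convergence is therefore taken
  -- on a ball outside which the weight and its derivative vanish.
  have hres : ∀ (g : Fin m → EuclideanSpace ℝ (Fin m) → EuclideanSpace ℝ (Fin k))
      (h : Fin m → Fin m → EuclideanSpace ℝ (Fin m) → EuclideanSpace ℝ (Fin k)),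
      ∫ x in closedBall 0 r, kinematicForm (a (‖x‖ ^ 2)) (deriv a (‖x‖ ^ 2)) x (fun i => g i x)
        (fun i j => h i j x) = ∫ x, kinematicForm (a (‖x‖ ^ 2)) (deriv a (‖x‖ ^ 2)) x
          (fun i => g i x) (fun i j => h i j x) := by
    intro g h
    refine setIntegral_eq_integral_of_forall_compl_eq_zero fun x hx => ?_
    have := hr x (by simpa using hx)
    simp [kinematicForm, this.1, this.2]
  have key := (tendstoIntegral_kinematicForm (μ := volume.restrict (closedBall 0 r))
    ha.continuous ha1.continuous
    (by filter_upwards [ae_restrict_mem measurableSet_closedBall] with x hx using by simpa using hx)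
    (fun i => (hT (hg i)).mono_measure Measure.restrict_le_self)
    (fun i j => (hT (hh i j)).mono_measure Measure.restrict_le_self)).2.2
  simp only [hres] at key
  have hz : ∀ n, ∫ x, kinematicForm (a (‖x‖ ^ 2)) (deriv a (‖x‖ ^ 2)) x (fun i => T n (g i) x)
      (fun i j => T n (h i j) x) = 0 := by
    intro n
    have hs := (φ n).contDiff_normed (μ := volume) (n := (⊤ : ℕ∞))
    have hcs := (φ n).hasCompactSupport_normed (μ := volume)
    have hd1 : ∀ i, ∀ x, fderiv ℝ (T n w) x (EuclideanSpace.single i 1) = T n (g i) x := fun i x =>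
      (hw i).fderiv_convolution hs hcs x
    have hd2 : ∀ i j, ∀ x, fderiv ℝ (T n (g i)) x (EuclideanSpace.single j 1) = T n (h i j) x :=
      fun i j x => (hgh i j).fderiv_convolution hs hcs x
    have hsm : ContDiff ℝ ∞ (T n w) := hcs.contDiff_convolution_left _ hs hwl
    have := integral_kinematicForm_of_contDiff hsm ha hc
    simpa only [hd1, hd2] using this
  simp only [hz] at key
  exact tendsto_nhds_unique key tendsto_const_nhds

end KinematicSobolev

/-! ### The kinematic identity on a ball, by cutting off. -/

section BallKinematic

variable {m k : ℕ}

theorem MemLp.continuous_smul_ball {F : Type*} [NormedAddCommGroup F] [NormedSpace ℝ F]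
    {R : ℝ} {c : EuclideanSpace ℝ (Fin m) → ℝ} (hc : Continuous c)
    {f : EuclideanSpace ℝ (Fin m) → F} {p : ENNReal}
    (hf : MemLp f p (volume.restrict (ball 0 R))) :
    MemLp (fun x => c x • f x) p (volume.restrict (ball 0 R)) := by
  obtain ⟨C, hC⟩ := (isCompact_closedBall (0 : EuclideanSpace ℝ (Fin m)) R).exists_bound_of_continuousOn
    hc.continuousOn
  have hm : MemLp c ⊤ (volume.restrict (ball 0 R)) := by
    refine memLp_top_of_bound hc.aestronglyMeasurable C ?_
    filter_upwards [ae_restrict_mem measurableSet_ball] with x hx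
      using hC x (ball_subset_closedBall hx)
  exact hf.smul hm

theorem deriv_eq_zero_of_forall_ge {a : ℝ → ℝ} {b : ℝ} (hab : ∀ s, b ≤ s → a s = 0) {s : ℝ}
    (hs : b < s) : deriv a s = 0 := by
  have : a =ᶠ[𝓝 s] fun _ => (0 : ℝ) := by
    filter_upwards [lt_mem_nhds hs] with t ht using hab t ht.le
  rw [this.deriv_eq, deriv_const]

/-- The kinematic identity for maps in `W^{2,2}` of a ball and weights supported in the ball. -/
theorem integral_ball_kinematicForm {R b : ℝ} (hR : 0 < R) (hb : b < R ^ 2)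
    {f : EuclideanSpace ℝ (Fin m) → EuclideanSpace ℝ (Fin k)}
    {g : Fin m → EuclideanSpace ℝ (Fin m) → EuclideanSpace ℝ (Fin k)}
    {h : Fin m → Fin m → EuclideanSpace ℝ (Fin m) → EuclideanSpace ℝ (Fin k)}
    (hfg : ∀ i, HasWeakPartial (ball 0 R) i f (g i))
    (hgh : ∀ i j, HasWeakPartial (ball 0 R) j (g i) (h i j))
    (hf : MemLp f 2 (volume.restrict (ball 0 R))) (hg : ∀ i, MemLp (g i) 2 (volume.restrict (ball 0 R)))
    (hh : ∀ i j, MemLp (h i j) 2 (volume.restrict (ball 0 R)))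
    {a : ℝ → ℝ} (ha : ContDiff ℝ ∞ a) (hc : HasCompactSupport a) (hab : ∀ s, b ≤ s → a s = 0) :
    ∫ x in ball 0 R, kinematicForm (a (‖x‖ ^ 2)) (deriv a (‖x‖ ^ 2)) x (fun i => g i x)
      (fun i j => h i j x) = 0 := by
  obtain ⟨r, hr0, hrR, hrb⟩ : ∃ r, 0 < r ∧ r < R ∧ b < r ^ 2 := by
    rcases le_or_gt b 0 with h0 | h0
    · exact ⟨R / 2, by linarith, by linarith, by nlinarith⟩
    · have h1 : √b < R := by
        rw [Real.sqrt_lt' hR]; exact hb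
      refine ⟨(√b + R) / 2, by positivity, by linarith, ?_⟩
      have h2 := Real.sq_sqrt h0.le
      nlinarith [Real.sqrt_nonneg b]
  -- The cut-off map `χ f` extends by zero to a W^{2,2} map on the whole space. It agrees with `f`
  -- for `‖x‖ < r`, and for `‖x‖ ≥ r` one has `‖x‖² > b`, so that the weight and its derivative
  -- vanish there. The integrand is thus unchanged.
  let χ : ContDiffBump (0 : EuclideanSpace ℝ (Fin m)) :=
    ⟨r, (r + R) / 2, hr0, by linarith⟩
  have hχ : ContDiff ℝ ∞ χ := χ.contDiff
  let e : Fin m → EuclideanSpace ℝ (Fin m) := fun i => EuclideanSpace.single i 1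
  have hχ1 : ∀ i, ContDiff ℝ ∞ fun x => fderiv ℝ χ x (e i) := fun i => contDiff_fderiv_single hχ _
  have hχ2 : ∀ i j, ContDiff ℝ ∞ fun x => fderiv ℝ (fun y => fderiv ℝ χ y (e i)) x (e j) :=
    fun i j => contDiff_fderiv_single (hχ1 i) _
  let g' : Fin m → EuclideanSpace ℝ (Fin m) → EuclideanSpace ℝ (Fin k) := fun i x =>
    fderiv ℝ χ x (e i) • f x + χ x • g i x
  let h' : Fin m → Fin m → EuclideanSpace ℝ (Fin m) → EuclideanSpace ℝ (Fin k) := fun i j x =>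
    (fderiv ℝ (fun y => fderiv ℝ χ y (e i)) x (e j) • f x + fderiv ℝ χ x (e i) • g j x)
      + (fderiv ℝ χ x (e j) • g i x + χ x • h i j x)
  have w1 : ∀ i, HasWeakPartial (ball 0 R) i (fun x => χ x • f x) (g' i) := fun i =>
    (hfg i).smul isOpen_ball hχ
  have w2 : ∀ i j, HasWeakPartial (ball 0 R) j (g' i) (h' i j) := fun i j =>
    ((hfg j).smul isOpen_ball (hχ1 i)).add measurableSet_ball ((hgh i j).smul isOpen_ball hχ)
  have m0 : MemLp (fun x => χ x • f x) 2 (volume.restrict (ball 0 R)) :=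
    MemLp.continuous_smul_ball hχ.continuous hf
  have m1 : ∀ i, MemLp (g' i) 2 (volume.restrict (ball 0 R)) := fun i =>
    (MemLp.continuous_smul_ball (hχ1 i).continuous hf).add
      (MemLp.continuous_smul_ball hχ.continuous (hg i))
  have m2 : ∀ i j, MemLp (h' i j) 2 (volume.restrict (ball 0 R)) := fun i j =>
    ((MemLp.continuous_smul_ball (hχ2 i j).continuous hf).add
      (MemLp.continuous_smul_ball (hχ1 i).continuous (hg j))).add
    ((MemLp.continuous_smul_ball (hχ1 j).continuous (hg i)).add
      (MemLp.continuous_smul_ball hχ.continuous (hh i j)))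
  have int : ∀ {p : EuclideanSpace ℝ (Fin m) → EuclideanSpace ℝ (Fin k)},
      MemLp p 2 (volume.restrict (ball 0 R)) → IntegrableOn p (ball 0 R) := fun hp =>
    have : IsFiniteMeasure (volume.restrict (ball (0 : EuclideanSpace ℝ (Fin m)) R)) :=
      ⟨by simpa using measure_ball_lt_top⟩
    hp.integrable (by norm_num)
  have hχz : ∀ x, (r + R) / 2 < ‖x‖ → χ =ᶠ[𝓝 x] fun _ => (0 : ℝ) := by
    intro x hx
    have : x ∉ tsupport χ := by
      rw [χ.tsupport_eq, mem_closedBall_zero_iff, not_le]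
      exact hx
    exact notMem_tsupport_iff_eventuallyEq.1 this
  have hχo : ∀ x, ‖x‖ < r → χ =ᶠ[𝓝 x] fun _ => (1 : ℝ) := by
    intro x hx
    filter_upwards [isOpen_ball.mem_nhds (mem_ball_zero_iff.2 hx)] with y hy
    exact χ.one_of_mem_closedBall (ball_subset_closedBall hy)
  have hloc : ∀ {c : ℝ} {x : EuclideanSpace ℝ (Fin m)}, (χ =ᶠ[𝓝 x] fun _ => c) → χ x = c ∧ (∀ i, fderiv ℝ χ x (e i) = 0) ∧
      ∀ i j, fderiv ℝ (fun y => fderiv ℝ χ y (e i)) x (e j) = 0 := by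
    intro c x hx
    refine ⟨hx.self_of_nhds, fun i => by rw [hx.fderiv_eq]; simp, fun i j => ?_⟩
    have : (fun y => fderiv ℝ (χ : EuclideanSpace ℝ (Fin m) → ℝ) y (e i)) =ᶠ[𝓝 x] fun _ => (0 : ℝ) := by
      filter_upwards [hx.fderiv (𝕜 := ℝ)] with y hy
      rw [hy]
      simp
    rw [this.fderiv_eq]
    simp
  have z0 : ∀ x ∈ ball (0 : EuclideanSpace ℝ (Fin m)) R, (r + R) / 2 < ‖x‖ → χ x • f x = 0 :=
    fun x _ hx => by simp [(hloc (hχz x hx)).1]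
  have z1 : ∀ i, ∀ x ∈ ball (0 : EuclideanSpace ℝ (Fin m)) R, (r + R) / 2 < ‖x‖ → g' i x = 0 :=
    fun i x _ hx => by simp only [g', (hloc (hχz x hx)).1, (hloc (hχz x hx)).2.1]; simp
  have z2 : ∀ i j, ∀ x ∈ ball (0 : EuclideanSpace ℝ (Fin m)) R, (r + R) / 2 < ‖x‖ → h' i j x = 0 :=
    fun i j x _ hx => by
      simp only [h', (hloc (hχz x hx)).1, (hloc (hχz x hx)).2.1, (hloc (hχz x hx)).2.2]; simp
  have hρ : 0 < (r + R) / 2 := by linarith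
  have hρR : (r + R) / 2 < R := by linarith
  have key := integral_kinematicForm_of_hasWeakPartial
    ((integrable_indicator_iff measurableSet_ball).2 (int m0)).locallyIntegrable
    (fun i => (w1 i).indicator_ball hρ hρR (int m0) (int (m1 i)) z0 (z1 i))
    (fun i j => (w2 i j).indicator_ball hρ hρR (int (m1 i)) (int (m2 i j)) (z1 i) (z2 i j))
    (fun i => (memLp_indicator_iff_restrict measurableSet_ball).2 (m1 i))
    (fun i j => (memLp_indicator_iff_restrict measurableSet_ball).2 (m2 i j)) ha hc
  rw [← key, ← integral_indicator measurableSet_ball]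
  refine integral_congr_ae (Eventually.of_forall fun x => ?_)
  simp only
  by_cases hxr : ‖x‖ < r
  · have hxB : x ∈ ball (0 : EuclideanSpace ℝ (Fin m)) R := by
      rw [mem_ball_zero_iff]; linarith
    obtain ⟨l0, l1, l2⟩ := hloc (hχo x hxr)
    simp only [indicator_of_mem hxB, g', h', l0, l1, l2, zero_smul, one_smul, zero_add]
  · have hs : b < ‖x‖ ^ 2 := hrb.trans_le (by gcongr; exact not_lt.1 hxr)
    have e0 := hab _ hs.le
    have e1 := deriv_eq_zero_of_forall_ge hab hs
    rw [e0, e1]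
    have : ∀ g h, kinematicForm (m := m) (k := k) 0 0 x g h = 0 := fun g h => by
      simp [kinematicForm]
    rw [this]
    exact indicator_apply_eq_zero.2 fun _ => by rw [e0, e1, this]

end BallKinematic

/-! ### Radial diffeomorphisms and weak gradients of composites. -/

/-- A radial diffeomorphism `y ↦ l(|y|²) y` of `ℝ^m` that is the identity near the complement of
the ball of radius `R`. -/
structure RadialDiffeo (m : ℕ) (R : ℝ) where
  l : ℝ → ℝ
  contDiff_l : ContDiff ℝ ∞ l
  l_pos : ∀ s, 0 < l s
  radial_pos : ∀ s, 0 < l s + 2 * s * deriv l s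
  b : ℝ
  b_pos : 0 < b
  b_lt : b < R ^ 2
  l_eq_one : ∀ s, b ≤ s → l s = 1
  toHomeo : EuclideanSpace ℝ (Fin m) ≃ₜ EuclideanSpace ℝ (Fin m)
  toHomeo_apply : ∀ y, toHomeo y = l (‖y‖ ^ 2) • y

namespace RadialDiffeo

noncomputable section

variable {m : ℕ} {R : ℝ} (D : RadialDiffeo m R)

/-- The radial stretching factor. -/
def σ (s : ℝ) : ℝ := D.l s + 2 * s * deriv D.l s

/-- The inverse Jacobian matrix at `y` is `p δ + q y ⊗ y`. -/
def p (s : ℝ) : ℝ := (D.l s)⁻¹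

/-- The radial part of the inverse differential, in terms of `s = |y|²`. -/
def q (s : ℝ) : ℝ := -(2 * deriv D.l s) / (D.l s * D.σ s)

/-- The Jacobian determinant. -/
def jac (s : ℝ) : ℝ := D.l s ^ m * D.σ s / D.l s

theorem l_ne (s : ℝ) : D.l s ≠ 0 := (D.l_pos s).ne'

theorem σ_pos (s : ℝ) : 0 < D.σ s := D.radial_pos s

theorem σ_ne (s : ℝ) : D.σ s ≠ 0 := (D.σ_pos s).ne'

theorem jac_pos (s : ℝ) : 0 < D.jac s :=
  div_pos (mul_pos (pow_pos (D.l_pos s) _) (D.σ_pos s)) (D.l_pos s)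

theorem contDiff_deriv_l : ContDiff ℝ ∞ (deriv D.l) := by
  simpa using D.contDiff_l.iterate_deriv 1

theorem contDiff_σ : ContDiff ℝ ∞ D.σ := by
  have := D.contDiff_l
  have := D.contDiff_deriv_l
  unfold σ
  fun_prop

theorem contDiff_p : ContDiff ℝ ∞ D.p := D.contDiff_l.inv D.l_ne

theorem contDiff_q : ContDiff ℝ ∞ D.q :=
  ((contDiff_const.mul D.contDiff_deriv_l).neg).div (D.contDiff_l.mul D.contDiff_σ)
    fun s => mul_ne_zero (D.l_ne s) (D.σ_ne s)

theorem contDiff_jac : ContDiff ℝ ∞ D.jac :=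
  ((D.contDiff_l.pow m).mul D.contDiff_σ).div D.contDiff_l D.l_ne

theorem deriv_l_eq_zero {s : ℝ} (hs : D.b < s) : deriv D.l s = 0 := by
  have : D.l =ᶠ[𝓝 s] fun _ => (1 : ℝ) := by
    filter_upwards [lt_mem_nhds hs] with t ht using D.l_eq_one t ht.le
  rw [this.deriv_eq, deriv_const]

/-- The differential at `y`. -/
def diff (y : EuclideanSpace ℝ (Fin m)) : EuclideanSpace ℝ (Fin m) →L[ℝ] EuclideanSpace ℝ (Fin m) :=
  D.l (‖y‖ ^ 2) • ContinuousLinearMap.id ℝ _ +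
    ((2 * deriv D.l (‖y‖ ^ 2)) • innerSL ℝ y).smulRight y

theorem diff_apply (y v : EuclideanSpace ℝ (Fin m)) : D.diff y v
    = D.l (‖y‖ ^ 2) • v + (2 * deriv D.l (‖y‖ ^ 2) * inner ℝ y v) • y := by
  simp [diff]

theorem hasFDerivAt (y : EuclideanSpace ℝ (Fin m)) : HasFDerivAt D.toHomeo (D.diff y) y := by
  have h := (hasFDerivAt_comp_normSq (D.contDiff_l.differentiable (by simp)) y).smul
    (hasFDerivAt_id y)
  have e : (D.toHomeo : EuclideanSpace ℝ (Fin m) → EuclideanSpace ℝ (Fin m))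
      = fun y => D.l (‖y‖ ^ 2) • id y := funext D.toHomeo_apply
  rw [e]
  exact h

/-- The differential is `l` times a rank-one perturbation of the identity, of determinant `1 + 2 s
l' / l = σ / l`. The factor `l ^ m` comes from the scalar multiple. -/
theorem det_diff (y : EuclideanSpace ℝ (Fin m)) : (D.diff y).det = D.jac (‖y‖ ^ 2) := by
  have e : (D.diff y : EuclideanSpace ℝ (Fin m) →ₗ[ℝ] EuclideanSpace ℝ (Fin m))
      = D.l (‖y‖ ^ 2) • LinearMap.transvection ((innerSL ℝ y : EuclideanSpace ℝ (Fin m) →L[ℝ] ℝ) :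
        EuclideanSpace ℝ (Fin m) →ₗ[ℝ] ℝ)
        ((2 * deriv D.l (‖y‖ ^ 2) / D.l (‖y‖ ^ 2)) • y) := by
    ext1 v
    have := D.l_ne (‖y‖ ^ 2)
    simp only [ContinuousLinearMap.coe_coe, diff_apply, LinearMap.smul_apply,
      LinearMap.transvection.apply, smul_add, smul_smul, innerSL_apply_apply]
    congr 2
    field_simp
  rw [ContinuousLinearMap.det, e, LinearMap.det_smul, LinearMap.transvection.det]
  have := D.l_ne (‖y‖ ^ 2)
  simp [jac, σ]
  field_simp

theorem toHomeo_eq_self {y : EuclideanSpace ℝ (Fin m)} (hy : D.b ≤ ‖y‖ ^ 2) : D.toHomeo y = y := by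
  rw [D.toHomeo_apply, D.l_eq_one _ hy, one_smul]

/-- Points of norm at least `R` are fixed, and by injectivity no point of the ball can be sent to
one of them. -/
theorem mem_ball_iff (hR : 0 < R) (y : EuclideanSpace ℝ (Fin m)) :
    D.toHomeo y ∈ ball (0 : EuclideanSpace ℝ (Fin m)) R ↔ y ∈ ball 0 R := by
  have key : ∀ z : EuclideanSpace ℝ (Fin m), R ≤ ‖z‖ → D.toHomeo z = z := fun z hz =>
    D.toHomeo_eq_self (D.b_lt.le.trans (by gcongr))
  simp only [mem_ball_zero_iff]
  constructor
  · intro h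
    by_contra hy
    rw [not_lt] at hy
    rw [key y hy] at h
    linarith
  · intro h
    by_contra hy
    rw [not_lt] at hy
    have := D.toHomeo.injective (key _ hy)
    rw [this] at hy
    linarith

theorem image_ball (hR : 0 < R) : D.toHomeo '' ball 0 R = ball 0 R := by
  ext x
  constructor
  · rintro ⟨y, hy, rfl⟩
    exact (D.mem_ball_iff hR y).2 hy
  · intro hx
    exact ⟨D.toHomeo.symm x, (D.mem_ball_iff hR _).1 (by simpa using hx), by simp⟩

theorem preimage_ball (hR : 0 < R) : D.toHomeo ⁻¹' ball 0 R = ball 0 R := by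
  ext x
  exact D.mem_ball_iff hR x

theorem setIntegral_ball {F : Type*} [NormedAddCommGroup F] [NormedSpace ℝ F] (hR : 0 < R)
    (g : EuclideanSpace ℝ (Fin m) → F) :
    ∫ x in ball 0 R, g x = ∫ y in ball 0 R, D.jac (‖y‖ ^ 2) • g (D.toHomeo y) := by
  have := integral_image_eq_integral_abs_det_fderiv_smul volume
    (measurableSet_ball (x := (0 : EuclideanSpace ℝ (Fin m))) (ε := R))
    (fun x _ => (D.hasFDerivAt x).hasFDerivWithinAt) D.toHomeo.injective.injOn g
  rw [D.image_ball hR] at this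
  rw [this]
  simp only [det_diff, abs_of_pos (D.jac_pos _)]

/-- The image of a set has measure the integral of the Jacobian, which is bounded on the ball. This
domination is what carries L^p membership and null sets over to composites with the inverse. -/
theorem exists_map_symm_le (hR : 0 < R) :
    ∃ C : ℝ, Measure.map D.toHomeo.symm (volume.restrict (ball 0 R))
      ≤ ENNReal.ofReal C • (volume.restrict (ball (0 : EuclideanSpace ℝ (Fin m)) R)) := by
  have hcont : Continuous fun y : EuclideanSpace ℝ (Fin m) => D.jac (‖y‖ ^ 2) :=
    D.contDiff_jac.continuous.comp (by fun_prop)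
  obtain ⟨C, hC⟩ := (isCompact_closedBall (0 : EuclideanSpace ℝ (Fin m)) R).exists_bound_of_continuousOn
    hcont.continuousOn
  refine ⟨C, Measure.le_iff.2 fun S hS => ?_⟩
  have hms : Measurable D.toHomeo.symm := D.toHomeo.symm.continuous.measurable
  rw [Measure.map_apply hms hS, Measure.restrict_apply (hms hS), Measure.smul_apply,
    Measure.restrict_apply hS, smul_eq_mul]
  have e : D.toHomeo.symm ⁻¹' S ∩ ball 0 R = D.toHomeo '' (S ∩ ball 0 R) := by
    rw [image_inter D.toHomeo.injective, D.image_ball hR, Homeomorph.preimage_symm]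
  rw [e, ← lintegral_abs_det_fderiv_eq_addHaar_image volume (hS.inter measurableSet_ball)
    (fun x _ => (D.hasFDerivAt x).hasFDerivWithinAt) D.toHomeo.injective.injOn,
    ← setLIntegral_const]
  refine setLIntegral_mono measurable_const fun y hy => ?_
  rw [det_diff]
  exact ENNReal.ofReal_le_ofReal (hC y (ball_subset_closedBall hy.2))

theorem memLp_comp_symm {F : Type*} [NormedAddCommGroup F] (hR : 0 < R)
    {g : EuclideanSpace ℝ (Fin m) → F} {r : ENNReal} (hg : MemLp g r (volume.restrict (ball 0 R))) :
    MemLp (fun x => g (D.toHomeo.symm x)) r (volume.restrict (ball 0 R)) := by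
  obtain ⟨C, hle⟩ := D.exists_map_symm_le hR
  have h1 : MemLp g r (Measure.map D.toHomeo.symm (volume.restrict (ball 0 R))) :=
    hg.of_measure_le_smul ENNReal.ofReal_ne_top hle
  exact (memLp_map_measure_iff h1.1 D.toHomeo.symm.continuous.measurable.aemeasurable).1 h1

theorem ae_comp_symm (hR : 0 < R) {P : EuclideanSpace ℝ (Fin m) → Prop}
    (h : ∀ᵐ x ∂(volume.restrict (ball 0 R)), P x) :
    ∀ᵐ x ∂(volume.restrict (ball 0 R)), P (D.toHomeo.symm x) := by
  obtain ⟨C, hle⟩ := D.exists_map_symm_le hR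
  exact ae_of_ae_map D.toHomeo.symm.continuous.measurable.aemeasurable
    ((Measure.absolutelyContinuous_of_le_smul hle).ae_le h)

/-- The weak gradient of `f ∘ Ψ⁻¹`, pulled back by `Ψ`. -/
def pullGrad {k : ℕ} (g : Fin m → EuclideanSpace ℝ (Fin m) → EuclideanSpace ℝ (Fin k))
    (i : Fin m) (y : EuclideanSpace ℝ (Fin m)) : EuclideanSpace ℝ (Fin k) :=
  D.p (‖y‖ ^ 2) • g i y + (D.q (‖y‖ ^ 2) * y i) • ∑ α, y α • g α y

theorem continuous_p : Continuous fun y : EuclideanSpace ℝ (Fin m) => D.p (‖y‖ ^ 2) :=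
  (contDiff_comp_normSq D.contDiff_p).continuous

theorem continuous_q : Continuous fun y : EuclideanSpace ℝ (Fin m) => D.q (‖y‖ ^ 2) :=
  (contDiff_comp_normSq D.contDiff_q).continuous

theorem memLp_pullGrad {k : ℕ} {g : Fin m → EuclideanSpace ℝ (Fin m) → EuclideanSpace ℝ (Fin k)}
    {r : ENNReal} (hg : ∀ i, MemLp (g i) r (volume.restrict (ball 0 R))) (i : Fin m) :
    MemLp (D.pullGrad g i) r (volume.restrict (ball 0 R)) := by
  have hx : ∀ i : Fin m, Continuous fun x : EuclideanSpace ℝ (Fin m) => x i := fun i =>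
    (EuclideanSpace.contDiff_coord i).continuous
  refine (MemLp.continuous_smul_ball D.continuous_p (hg i)).add
    (MemLp.continuous_smul_ball (D.continuous_q.mul (hx i)) ?_)
  exact memLp_finsetSum _ fun α _ => MemLp.continuous_smul_ball (hx α) (hg α)

/-- Change variables `x = Ψ y` and put `ψ = φ ∘ Ψ`, a test function on the same ball. The cofactor
matrix `jac (DΨ)⁻¹ = A δ + B y ⊗ y` has divergence-free rows (Piola identity), so `jac (∂_i φ) ∘ Ψ`
is the divergence of `ψ` times its `i`-th row. The claim is then the definition of the weak
derivatives of `f`, applied to the entries of `ψ` times that row. -/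
theorem hasWeakPartial_comp_symm {k : ℕ} (hR : 0 < R)
    {f : EuclideanSpace ℝ (Fin m) → EuclideanSpace ℝ (Fin k)}
    {g : Fin m → EuclideanSpace ℝ (Fin m) → EuclideanSpace ℝ (Fin k)}
    (h : ∀ i, HasWeakPartial (ball 0 R) i f (g i))
    (hf : MemLp f 2 (volume.restrict (ball 0 R)))
    (hg : ∀ i, MemLp (g i) 2 (volume.restrict (ball 0 R))) (i : Fin m) :
    HasWeakPartial (ball 0 R) i (fun x => f (D.toHomeo.symm x))
      (fun x => D.pullGrad g i (D.toHomeo.symm x)) := by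
  have : IsFiniteMeasure (volume.restrict (ball (0 : EuclideanSpace ℝ (Fin m)) R)) :=
    ⟨by simpa using measure_ball_lt_top⟩
  have loc : ∀ {p : EuclideanSpace ℝ (Fin m) → EuclideanSpace ℝ (Fin k)},
      MemLp p 2 (volume.restrict (ball 0 R)) → LocallyIntegrableOn p (ball 0 R) := fun hp =>
    IntegrableOn.locallyIntegrableOn (hp.integrable (by norm_num))
  refine ⟨loc (D.memLp_comp_symm hR hf), loc (D.memLp_comp_symm hR (D.memLp_pullGrad hg i)),
    fun φ hφ hc hs => ?_⟩
  rw [D.setIntegral_ball hR fun x => φ x • D.pullGrad g i (D.toHomeo.symm x),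
    D.setIntegral_ball hR fun x => fderiv ℝ φ x (EuclideanSpace.single i 1) • f (D.toHomeo.symm x)]
  simp only [Homeomorph.symm_apply_apply, smul_smul]
  let ψ : EuclideanSpace ℝ (Fin m) → ℝ := fun y => φ (D.toHomeo y)
  -- These are `jac p` and `jac q` with `σ` cancelled, so that only powers of `l` occur in
  -- denominators when they are differentiated.
  let B : ℝ → ℝ := fun s => -(2 * deriv D.l s * D.l s ^ m) / D.l s ^ 2
  let A : ℝ → ℝ := fun s => D.l s ^ m / D.l s - s * B s
  have hB : ContDiff ℝ ∞ B := by
    refine ContDiff.div ?_ (D.contDiff_l.pow 2) fun s => pow_ne_zero 2 (D.l_ne s)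
    have := D.contDiff_l
    have := D.contDiff_deriv_l
    fun_prop
  have hA : ContDiff ℝ ∞ A :=
    ((D.contDiff_l.pow m).div D.contDiff_l D.l_ne).sub (contDiff_id.mul hB)
  have hAσ : ∀ s, A s = D.jac s * D.p s := by
    intro s
    have := D.l_ne s
    simp only [A, B, jac, p, σ]
    field_simp
    ring
  have hBq : ∀ s, B s = D.jac s * D.q s := by
    intro s
    have := D.l_ne s
    have := D.σ_ne s
    simp only [B, jac, q]
    field_simp
  -- The left side times `y i` is the divergence of the `i`-th row of `A δ + B y ⊗ y`.
  have piola : ∀ s, 2 * deriv A s + (m + 1) * B s + 2 * s * deriv B s = 0 := by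
    intro s
    have h0 := D.l_ne s
    have d1 := (D.contDiff_l.differentiable (by simp) s).hasDerivAt
    have d2 := (hB.differentiable (by simp) s).hasDerivAt
    have d3 := ((d1.fun_pow m).fun_div d1 h0).fun_sub ((hasDerivAt_id s).fun_mul d2)
    have : HasDerivAt A _ s := d3
    rw [this.deriv]
    simp only [id, B]
    rcases m with _ | m
    · simp
      field_simp
      ring
    · simp only [Nat.add_sub_cancel, Nat.cast_add, Nat.cast_one]
      field_simp
      ring
  have hΨ : ContDiff ℝ ∞ D.toHomeo := by
    have e : (D.toHomeo : EuclideanSpace ℝ (Fin m) → EuclideanSpace ℝ (Fin m))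
      = fun y => D.l (‖y‖ ^ 2) • y := funext D.toHomeo_apply
    rw [e]
    exact (contDiff_comp_normSq D.contDiff_l).smul contDiff_id
  have hψ : ContDiff ℝ ∞ ψ := hφ.comp hΨ
  have hψc : HasCompactSupport ψ := hc.comp_homeomorph D.toHomeo
  have hψs : tsupport ψ ⊆ ball 0 R := by
    change tsupport (φ ∘ D.toHomeo) ⊆ _
    rw [tsupport_comp_eq_preimage, ← D.preimage_ball hR]
    exact preimage_mono hs
  have dψ : ∀ y v, fderiv ℝ ψ y v = D.l (‖y‖ ^ 2) * fderiv ℝ φ (D.toHomeo y) v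
      + 2 * deriv D.l (‖y‖ ^ 2) * inner ℝ y v * fderiv ℝ φ (D.toHomeo y) y := by
    intro y v
    have := ((hφ.differentiable (by simp)) (D.toHomeo y)).hasFDerivAt.comp y (D.hasFDerivAt y)
    have h2 : HasFDerivAt ψ _ y := this
    rw [h2.fderiv]
    simp [diff_apply]
  have hxi : ∀ α : Fin m, ContDiff ℝ ∞ fun x : EuclideanSpace ℝ (Fin m) => x α := fun α =>
    EuclideanSpace.contDiff_coord α
  have hBn := contDiff_comp_normSq (m := m) hB
  have hAn := contDiff_comp_normSq (m := m) hA
  let G : EuclideanSpace ℝ (Fin m) → ℝ := fun y => ψ y * (B (‖y‖ ^ 2) * y i)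
  have hG : ContDiff ℝ ∞ G := hψ.mul (hBn.mul (hxi i))
  have hGc : HasCompactSupport G := hψc.mul_right
  have hGs : tsupport G ⊆ ball 0 R := tsupport_mul_subset_left.trans hψs
  have w0 := (h i).2.2 (fun y => ψ y * A (‖y‖ ^ 2)) (hψ.mul hAn) hψc.mul_right
    (tsupport_mul_subset_left.trans hψs)
  have w1 := fun α => (h α).2.2 (fun y => G y * y α) (hG.mul (hxi α)) hGc.mul_right
    (tsupport_mul_subset_left.trans hGs)
  have i0 : Integrable (fun y => fderiv ℝ (fun y => ψ y * A (‖y‖ ^ 2)) y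
      (EuclideanSpace.single i 1) • f y) (volume.restrict (ball 0 R)) :=
    integrable_smul_of_tsupport_subset measurableSet_ball
      (contDiff_fderiv_single (hψ.mul hAn) _).continuous
      (hasCompactSupport_fderiv_single hψc.mul_right _)
      ((tsupport_fderiv_single_subset _ _).trans (tsupport_mul_subset_left.trans hψs)) (h i).1
  have i1 : ∀ α, Integrable (fun y => fderiv ℝ (fun y => G y * y α) y
      (EuclideanSpace.single α 1) • f y) (volume.restrict (ball 0 R)) := fun α =>
    integrable_smul_of_tsupport_subset measurableSet_ball
      (contDiff_fderiv_single (hG.mul (hxi α)) _).continuous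
      (hasCompactSupport_fderiv_single hGc.mul_right _)
      ((tsupport_fderiv_single_subset _ _).trans (tsupport_mul_subset_left.trans hGs)) (h α).1
  have j0 : Integrable (fun y => (ψ y * A (‖y‖ ^ 2)) • g i y) (volume.restrict (ball 0 R)) :=
    integrable_smul_of_tsupport_subset measurableSet_ball (hψ.mul hAn).continuous
      hψc.mul_right (tsupport_mul_subset_left.trans hψs) (h i).2.1
  have j1 : ∀ α, Integrable (fun y => (G y * y α) • g α y) (volume.restrict (ball 0 R)) := fun α =>
    integrable_smul_of_tsupport_subset measurableSet_ball (hG.mul (hxi α)).continuous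
      hGc.mul_right (tsupport_mul_subset_left.trans hGs) (h α).2.1
  have lhs : ∀ y, (D.jac (‖y‖ ^ 2) * fderiv ℝ φ (D.toHomeo y) (EuclideanSpace.single i 1)) • f y
      = fderiv ℝ (fun y => ψ y * A (‖y‖ ^ 2)) y (EuclideanSpace.single i 1) • f y
        + ∑ α, fderiv ℝ (fun y => G y * y α) y (EuclideanSpace.single α 1) • f y := by
    intro y
    have dψy := hψ.differentiable (by simp) y
    have dGy := hG.differentiable (by simp) y
    have e0 : fderiv ℝ (fun y => ψ y * A (‖y‖ ^ 2)) y (EuclideanSpace.single i 1)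
        = ψ y * (2 * deriv A (‖y‖ ^ 2) * y i)
          + A (‖y‖ ^ 2) * fderiv ℝ ψ y (EuclideanSpace.single i 1) := by
      rw [fderiv_fun_mul dψy (hAn.differentiable (by simp) y)]
      simp [fderiv_comp_normSq (hA.differentiable (by simp)), EuclideanSpace.inner_single_right]
    have e1 : ∑ α, fderiv ℝ (fun y => G y * y α) y (EuclideanSpace.single α 1)
        = m * G y + fderiv ℝ G y y := by
      rw [ContinuousLinearMap.apply_eq_sum_single (fderiv ℝ G y) y]
      have : ∀ α, fderiv ℝ (fun y => G y * y α) y (EuclideanSpace.single α 1)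
          = G y + y α • fderiv ℝ G y (EuclideanSpace.single α 1) := by
        intro α
        rw [fderiv_fun_mul dGy ((hxi α).differentiable (by simp) y)]
        simp [EuclideanSpace.fderiv_coord]
      simp [this, Finset.sum_add_distrib]
    have e2 : fderiv ℝ G y y = ψ y * (2 * deriv B (‖y‖ ^ 2) * ‖y‖ ^ 2 * y i + B (‖y‖ ^ 2) * y i)
        + B (‖y‖ ^ 2) * y i * fderiv ℝ ψ y y := by
      rw [fderiv_fun_mul dψy ((hBn.mul (hxi i)).differentiable (by simp) y),
        fderiv_fun_mul (hBn.differentiable (by simp) y) ((hxi i).differentiable (by simp) y)]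
      simp only [add_apply, smul_apply, EuclideanSpace.fderiv_coord,
        fderiv_comp_normSq (hB.differentiable (by simp)), real_inner_self_eq_norm_sq, smul_eq_mul]
      ring
    rw [← Finset.sum_smul, ← add_smul, e0, e1, e2, dψ, dψ]
    congr 1
    have hp := piola (‖y‖ ^ 2)
    have hl := D.l_ne (‖y‖ ^ 2)
    have hσ := D.σ_ne (‖y‖ ^ 2)
    have hAl : A (‖y‖ ^ 2) * D.l (‖y‖ ^ 2) = D.jac (‖y‖ ^ 2) := by
      rw [hAσ, p, mul_assoc, inv_mul_cancel₀ hl, mul_one]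
    have hBs : B (‖y‖ ^ 2) * D.σ (‖y‖ ^ 2) + A (‖y‖ ^ 2) * (2 * deriv D.l (‖y‖ ^ 2)) = 0 := by
      rw [hAσ, hBq, p, q]
      field_simp
      ring
    unfold σ at hBs
    simp only [G, EuclideanSpace.inner_single_right, real_inner_self_eq_norm_sq, RCLike.conj_to_real]
    linear_combination (-(ψ y * y i)) * hp
      - fderiv ℝ φ (D.toHomeo y) (EuclideanSpace.single i 1) * hAl
      - y i * fderiv ℝ φ (D.toHomeo y) y * hBs
  have rhs : ∀ y, (D.jac (‖y‖ ^ 2) * φ (D.toHomeo y)) • D.pullGrad g i y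
      = (ψ y * A (‖y‖ ^ 2)) • g i y + ∑ α, (G y * y α) • g α y := by
    intro y
    simp only [pullGrad, smul_add, Finset.smul_sum, smul_smul, G, hAσ, hBq]
    congr 1
    · congr 1
      simp only [ψ]
      ring
    · refine Finset.sum_congr rfl fun α _ => ?_
      congr 1
      simp only [ψ]
      ring
  simp only [lhs, rhs]
  rw [integral_add i0 (integrable_finsetSum _ fun α _ => i1 α),
    integral_add j0 (integrable_finsetSum _ fun α _ => j1 α),
    integral_finsetSum _ fun α _ => i1 α, integral_finsetSum _ fun α _ => j1 α, w0]
  simp only [w1, Finset.sum_neg_distrib, neg_add]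

end

end RadialDiffeo

/-! ### Second derivatives and the Laplacian of composites. -/

namespace RadialDiffeo

noncomputable section

variable {m : ℕ} {R : ℝ} (D : RadialDiffeo m R)

/-- The weak partial derivative `∂_β` of `pullGrad g i`, if `h i β` is that of `g i`. -/
def pullGradDeriv {k : ℕ} (g : Fin m → EuclideanSpace ℝ (Fin m) → EuclideanSpace ℝ (Fin k))
    (h : Fin m → Fin m → EuclideanSpace ℝ (Fin m) → EuclideanSpace ℝ (Fin k))
    (i β : Fin m) (y : EuclideanSpace ℝ (Fin m)) : EuclideanSpace ℝ (Fin k) :=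
  (2 * deriv D.p (‖y‖ ^ 2) * y β) • g i y + D.p (‖y‖ ^ 2) • h i β y +
    ((2 * deriv D.q (‖y‖ ^ 2) * y β * y i + D.q (‖y‖ ^ 2) * (if i = β then 1 else 0)) •
      (∑ α, y α • g α y) +
      (D.q (‖y‖ ^ 2) * y i) • (g β y + ∑ α, y α • h α β y))

variable {k : ℕ} {g : Fin m → EuclideanSpace ℝ (Fin m) → EuclideanSpace ℝ (Fin k)}
  {h : Fin m → Fin m → EuclideanSpace ℝ (Fin m) → EuclideanSpace ℝ (Fin k)}

theorem hasWeakPartial_radial (hgh : ∀ i j, HasWeakPartial (ball 0 R) j (g i) (h i j)) (β : Fin m) :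
    HasWeakPartial (ball 0 R) β (fun y => ∑ α, y α • g α y)
      (fun y => g β y + ∑ α, y α • h α β y) := by
  refine (HasWeakPartial.sum Finset.univ measurableSet_ball fun α _ =>
    (hgh α β).smul isOpen_ball (EuclideanSpace.contDiff_coord α)).congr measurableSet_ball
    (fun _ _ => rfl) fun y _ => ?_
  simp only [EuclideanSpace.fderiv_coord, Finset.sum_add_distrib]
  congr 1
  simp

theorem hasWeakPartial_pullGrad (hgh : ∀ i j, HasWeakPartial (ball 0 R) j (g i) (h i j))
    (i β : Fin m) : HasWeakPartial (ball 0 R) β (D.pullGrad g i) (D.pullGradDeriv g h i β) := by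
  have hq := contDiff_comp_normSq (m := m) D.contDiff_q
  refine (((hgh i β).smul isOpen_ball (contDiff_comp_normSq D.contDiff_p)).add measurableSet_ball
    ((hasWeakPartial_radial hgh β).smul isOpen_ball
      (hq.mul (EuclideanSpace.contDiff_coord i)))).congr measurableSet_ball
    (fun _ _ => rfl) fun y _ => ?_
  unfold pullGradDeriv
  rw [fderiv_fun_mul (hq.differentiable (by simp) y)
    ((EuclideanSpace.contDiff_coord i).differentiable (by simp) y)]
  simp only [add_apply, smul_apply, EuclideanSpace.fderiv_coord, smul_eq_mul,
    fderiv_comp_normSq (D.contDiff_p.differentiable (by simp)),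
    fderiv_comp_normSq (D.contDiff_q.differentiable (by simp)), EuclideanSpace.inner_single_right,
    RCLike.conj_to_real, one_mul, PiLp.single_apply]
  congr 3
  ring

theorem memLp_pullGradDeriv {r : ENNReal} (hg : ∀ i, MemLp (g i) r (volume.restrict (ball 0 R)))
    (hh : ∀ i j, MemLp (h i j) r (volume.restrict (ball 0 R))) (i β : Fin m) :
    MemLp (D.pullGradDeriv g h i β) r (volume.restrict (ball 0 R)) := by
  have hx : ∀ i : Fin m, Continuous fun x : EuclideanSpace ℝ (Fin m) => x i := fun i =>
    (EuclideanSpace.contDiff_coord i).continuous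
  have hp1 : Continuous (deriv D.p) := D.contDiff_p.continuous_deriv (by simp)
  have hq1 : Continuous (deriv D.q) := D.contDiff_q.continuous_deriv (by simp)
  have hp := D.continuous_p
  have hq := D.continuous_q
  have hX : MemLp (fun y => ∑ α, y α • g α y) r (volume.restrict (ball 0 R)) :=
    memLp_finsetSum _ fun α _ => MemLp.continuous_smul_ball (hx α) (hg α)
  have hY : MemLp (fun y => g β y + ∑ α, y α • h α β y) r (volume.restrict (ball 0 R)) :=
    (hg β).add (memLp_finsetSum _ fun α _ => MemLp.continuous_smul_ball (hx α) (hh α β))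
  exact ((MemLp.continuous_smul_ball (by fun_prop) (hg i)).add
    (MemLp.continuous_smul_ball hp (hh i β))).add
    ((MemLp.continuous_smul_ball (by fun_prop) hX).add
      (MemLp.continuous_smul_ball (by fun_prop) hY))

/-- The coefficient of the radial part of the pulled back metric. -/
def a (s : ℝ) : ℝ := 2 * D.p s * D.q s + D.q s ^ 2 * s

/-- The coefficient of the radial derivative in the pulled back Laplacian. -/
def c (s : ℝ) : ℝ :=
  2 * D.p s * deriv D.p s + (m - 1) * D.p s * D.q s + 2 * D.p s * deriv D.q s * s
    + 2 * D.q s * deriv D.p s * s + 2 * D.q s * deriv D.q s * s ^ 2 + D.q s ^ 2 * s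

/-- The inverse differential `p δ + q y ⊗ y` is symmetric, with square `p² δ + (2 p q + q² s) y ⊗
y`. -/
theorem sum_norm_pullGrad_sq (y : EuclideanSpace ℝ (Fin m)) :
    ∑ i, ‖D.pullGrad g i y‖ ^ 2 = D.p (‖y‖ ^ 2) ^ 2 * ∑ i, ‖g i y‖ ^ 2
      + D.a (‖y‖ ^ 2) * ‖∑ α, y α • g α y‖ ^ 2 := by
  set X := ∑ α, y α • g α y with hX
  have h1 : ∀ i, ‖D.pullGrad g i y‖ ^ 2 = D.p (‖y‖ ^ 2) ^ 2 * ‖g i y‖ ^ 2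
      + 2 * D.p (‖y‖ ^ 2) * D.q (‖y‖ ^ 2) * inner ℝ (y i • g i y) X
      + D.q (‖y‖ ^ 2) ^ 2 * ‖X‖ ^ 2 * (y i) ^ 2 := by
    intro i
    unfold pullGrad
    rw [← hX, norm_add_sq_real, norm_smul, norm_smul, mul_pow, mul_pow, real_inner_smul_left,
      real_inner_smul_right, real_inner_smul_left, Real.norm_eq_abs, Real.norm_eq_abs, sq_abs,
      sq_abs]
    ring
  simp only [h1, Finset.sum_add_distrib, ← Finset.mul_sum, ← sum_inner, ← hX,
    real_inner_self_eq_norm_sq, a, EuclideanSpace.real_norm_sq_eq y]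
  ring

/-- With the Euler operator `D`, the pulled back Laplacian is `p² Δ + a D² + c D`. Writing it with
`D²` rather than with the bare Hessian in the radial direction gives the products that also occur in
the kinematic form. -/
theorem sum_pullGrad_pullGradDeriv (y : EuclideanSpace ℝ (Fin m)) :
    ∑ i, D.pullGrad (D.pullGradDeriv g h i) i y = D.p (‖y‖ ^ 2) ^ 2 • (∑ i, h i i y)
      + D.a (‖y‖ ^ 2) • (∑ β, y β • (g β y + ∑ α, y α • h α β y))
      + D.c (‖y‖ ^ 2) • ∑ α, y α • g α y := by
  set X := ∑ α, y α • g α y with hX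
  set Y := fun β => g β y + ∑ α, y α • h α β y with hY
  set DX := ∑ β, y β • Y β with hDX
  have hs : ∑ i, y i ^ 2 = ‖y‖ ^ 2 := (EuclideanSpace.real_norm_sq_eq y).symm
  have hZ : ∑ i, y i • ∑ β, y β • h i β y = DX - X := by
    simp only [hDX, hY, smul_add, Finset.sum_add_distrib, ← hX, add_sub_cancel_left, Finset.smul_sum]
    rw [Finset.sum_comm]
    exact Finset.sum_congr rfl fun β _ => Finset.sum_congr rfl fun α _ => smul_comm _ _ _
  have e1 : ∑ i, D.pullGradDeriv g h i i y = (2 * deriv D.p (‖y‖ ^ 2)) • X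
      + D.p (‖y‖ ^ 2) • (∑ i, h i i y)
      + ((2 * deriv D.q (‖y‖ ^ 2) * ‖y‖ ^ 2 + m * D.q (‖y‖ ^ 2)) • X + D.q (‖y‖ ^ 2) • DX) := by
    simp only [pullGradDeriv, Finset.sum_add_distrib, ← hX, if_true, mul_one, ← hs, mul_assoc,
      mul_smul, ← Finset.smul_sum, add_smul, ← Finset.sum_smul, ← sq, Finset.mul_sum, hDX, hY]
    simp [Finset.sum_smul, mul_smul, Finset.smul_sum, Nat.cast_smul_eq_nsmul]
    exact smul_comm _ _ _
  have e2 : ∀ i, ∑ β, y β • D.pullGradDeriv g h i β y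
      = (2 * deriv D.p (‖y‖ ^ 2) * ‖y‖ ^ 2) • g i y + D.p (‖y‖ ^ 2) • (∑ β, y β • h i β y)
        + (2 * deriv D.q (‖y‖ ^ 2) * ‖y‖ ^ 2 + D.q (‖y‖ ^ 2)) • y i • X
        + D.q (‖y‖ ^ 2) • y i • DX := by
    intro i
    have t : ∀ β, y β • D.pullGradDeriv g h i β y = (y β ^ 2) • (2 * deriv D.p (‖y‖ ^ 2)) • g i y
        + D.p (‖y‖ ^ 2) • y β • h i β y + (y β ^ 2) • (2 * deriv D.q (‖y‖ ^ 2) * y i) • X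
        + (D.q (‖y‖ ^ 2) * (if i = β then y β else 0)) • X
        + (D.q (‖y‖ ^ 2) * y i) • y β • Y β := by
      intro β
      simp only [pullGradDeriv, ← hX, hY]
      split_ifs <;> module
    simp only [t, Finset.sum_add_distrib, ← Finset.sum_smul, ← Finset.smul_sum, hs, ← hDX,
      ← Finset.mul_sum, Finset.sum_ite_eq, Finset.mem_univ, if_true]
    module
  have e3 : ∑ i, y i • ∑ β, y β • D.pullGradDeriv g h i β y
      = (2 * deriv D.p (‖y‖ ^ 2) * ‖y‖ ^ 2) • X + D.p (‖y‖ ^ 2) • (DX - X)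
        + (2 * deriv D.q (‖y‖ ^ 2) * ‖y‖ ^ 2 + D.q (‖y‖ ^ 2)) • ‖y‖ ^ 2 • X
        + D.q (‖y‖ ^ 2) • ‖y‖ ^ 2 • DX := by
    rw [← hZ, hX, Finset.smul_sum (r := 2 * deriv D.p (‖y‖ ^ 2) * ‖y‖ ^ 2), ← hX,
      Finset.smul_sum (r := D.p (‖y‖ ^ 2)), ← hs, Finset.sum_smul, Finset.smul_sum, Finset.sum_smul,
      Finset.smul_sum, ← Finset.sum_add_distrib, ← Finset.sum_add_distrib,
      ← Finset.sum_add_distrib]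
    refine Finset.sum_congr rfl fun i _ => ?_
    rw [e2, hs]
    module
  have e4 : ∑ i, D.pullGrad (D.pullGradDeriv g h i) i y
      = D.p (‖y‖ ^ 2) • ∑ i, D.pullGradDeriv g h i i y
        + D.q (‖y‖ ^ 2) • ∑ i, y i • ∑ β, y β • D.pullGradDeriv g h i β y := by
    simp only [pullGrad, Finset.sum_add_distrib, Finset.smul_sum, smul_smul, mul_assoc]
  rw [e4, e1, e3, a, c]
  module

end

end RadialDiffeo

/-! ### Competitors obtained by composition. -/

namespace SobolevSphereMap

noncomputable section

variable {m n : ℕ} {R : ℝ}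

/-- The composition of a Sobolev map with the inverse of a radial diffeomorphism. -/
def pull (u : SobolevSphereMap m n R) (D : RadialDiffeo m R) (hR : 0 < R) :
    SobolevSphereMap m n R where
  toFun x := u.toFun (D.toHomeo.symm x)
  grad i x := D.pullGrad u.grad i (D.toHomeo.symm x)
  hess i j x := D.pullGrad (D.pullGradDeriv u.grad u.hess i) j (D.toHomeo.symm x)
  hasWeakPartial_toFun := D.hasWeakPartial_comp_symm hR u.hasWeakPartial_toFun u.memLp_toFun
    u.memLp_grad
  hasWeakPartial_grad i := D.hasWeakPartial_comp_symm hR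
    (D.hasWeakPartial_pullGrad u.hasWeakPartial_grad i) (D.memLp_pullGrad u.memLp_grad i)
    (D.memLp_pullGradDeriv u.memLp_grad u.memLp_hess i)
  memLp_toFun := D.memLp_comp_symm hR u.memLp_toFun
  memLp_grad i := D.memLp_comp_symm hR (D.memLp_pullGrad u.memLp_grad i)
  memLp_hess i j := D.memLp_comp_symm hR
    (D.memLp_pullGrad (D.memLp_pullGradDeriv u.memLp_grad u.memLp_hess i) j)
  memLp_toFun' := D.memLp_comp_symm hR u.memLp_toFun'
  memLp_grad' i := D.memLp_comp_symm hR (D.memLp_pullGrad u.memLp_grad' i)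
  norm_eq_one := D.ae_comp_symm hR u.norm_eq_one

/-- The diffeomorphism is the identity for `‖x‖² ≥ b` with `b < R²`. The differences of the maps and
of their derivatives thus vanish near the boundary, and their extensions by zero are weakly
differentiable. -/
theorem sameBoundaryData_pull (u : SobolevSphereMap m n R) (D : RadialDiffeo m R) (hR : 0 < R) :
    SameBoundaryData u (u.pull D hR) := by
  have hb : √D.b < R := by
    rw [Real.sqrt_lt' hR]; exact D.b_lt
  have hb0 : 0 < √D.b := Real.sqrt_pos.2 D.b_pos
  have : IsFiniteMeasure (volume.restrict (ball (0 : EuclideanSpace ℝ (Fin m)) R)) :=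
    ⟨by simpa using measure_ball_lt_top⟩
  have key : ∀ x : EuclideanSpace ℝ (Fin m), √D.b < ‖x‖ → D.toHomeo.symm x = x ∧ D.p (‖x‖ ^ 2) = 1 ∧
      D.q (‖x‖ ^ 2) = 0 ∧ deriv D.p (‖x‖ ^ 2) = 0 ∧ deriv D.q (‖x‖ ^ 2) = 0 := by
    intro x hx
    have hs : D.b < ‖x‖ ^ 2 := (Real.sqrt_lt' (hb0.trans hx)).1 hx
    have hp : D.p =ᶠ[𝓝 (‖x‖ ^ 2)] fun _ => (1 : ℝ) := by
      filter_upwards [lt_mem_nhds hs] with t ht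
      simp [RadialDiffeo.p, D.l_eq_one t ht.le]
    have hq : D.q =ᶠ[𝓝 (‖x‖ ^ 2)] fun _ => (0 : ℝ) := by
      filter_upwards [lt_mem_nhds hs] with t ht
      simp [RadialDiffeo.q, D.deriv_l_eq_zero ht]
    refine ⟨?_, hp.self_of_nhds, hq.self_of_nhds, by rw [hp.deriv_eq]; simp,
      by rw [hq.deriv_eq]; simp⟩
    rw [Homeomorph.symm_apply_eq, D.toHomeo_eq_self hs.le]
  have z0 : ∀ x ∈ ball (0 : EuclideanSpace ℝ (Fin m)) R, √D.b < ‖x‖ →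
      (u.pull D hR).toFun x - u.toFun x = 0 := fun x _ hx => by
    simp [pull, (key x hx).1]
  have z1 : ∀ i, ∀ x ∈ ball (0 : EuclideanSpace ℝ (Fin m)) R, √D.b < ‖x‖ →
      (u.pull D hR).grad i x - u.grad i x = 0 := fun i x _ hx => by
    obtain ⟨k0, k1, k2, k3, k4⟩ := key x hx
    simp [pull, k0, RadialDiffeo.pullGrad, k1, k2]
  have z2 : ∀ i j, ∀ x ∈ ball (0 : EuclideanSpace ℝ (Fin m)) R, √D.b < ‖x‖ →
      (u.pull D hR).hess i j x - u.hess i j x = 0 := fun i j x _ hx => by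
    obtain ⟨k0, k1, k2, k3, k4⟩ := key x hx
    simp [pull, k0, RadialDiffeo.pullGrad, RadialDiffeo.pullGradDeriv, k1, k2, k3, k4]
  have int : ∀ {p q : EuclideanSpace ℝ (Fin m) → EuclideanSpace ℝ (Fin (n + 1))},
      MemLp p 2 (volume.restrict (ball 0 R)) → MemLp q 2 (volume.restrict (ball 0 R)) →
      IntegrableOn (fun x => p x - q x) (ball 0 R) := fun hp hq =>
    (hp.sub hq).integrable (by norm_num)
  have sub : ∀ {i} {p q p' q' : EuclideanSpace ℝ (Fin m) → EuclideanSpace ℝ (Fin (n + 1))},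
      HasWeakPartial (ball 0 R) i p p' → HasWeakPartial (ball 0 R) i q q' →
      HasWeakPartial (ball 0 R) i (fun x => p x - q x) (fun x => p' x - q' x) := fun hp hq => by
    simpa only [sub_eq_add_neg] using hp.add measurableSet_ball hq.neg
  exact ⟨fun i => (sub ((u.pull D hR).hasWeakPartial_toFun i)
      (u.hasWeakPartial_toFun i)).indicator_ball hb0 hb (int (u.pull D hR).memLp_toFun u.memLp_toFun)
      (int ((u.pull D hR).memLp_grad i) (u.memLp_grad i)) z0 (z1 i),
    fun i j => (sub ((u.pull D hR).hasWeakPartial_grad i j)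
      (u.hasWeakPartial_grad i j)).indicator_ball hb0 hb
      (int ((u.pull D hR).memLp_grad i) (u.memLp_grad i))
      (int ((u.pull D hR).memLp_hess i j) (u.memLp_hess i j)) (z1 i) (z2 i j)⟩

end

end SobolevSphereMap

/-! ### Small radial perturbations, and differentiation under the integral sign. -/

theorem HasCompactSupport.exists_abs_le {f : ℝ → ℝ} (hf : Continuous f) (hc : HasCompactSupport f) :
    ∃ M, 0 ≤ M ∧ ∀ s, |f s| ≤ M := by
  obtain ⟨C, hC⟩ := hf.bounded_above_of_compact_support hc
  exact ⟨C, (abs_nonneg _).trans (hC 0), hC⟩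

/-- Radial perturbations of the identity are radial diffeomorphisms. -/
theorem RadialDiffeo.exists_of_small {m : ℕ} {R : ℝ} (hR : 0 < R) {h : ℝ → ℝ} (hh : ContDiff ℝ ∞ h)
    (hc : HasCompactSupport h) {b : ℝ} (hb : b < R ^ 2) (hhb : ∀ s, b ≤ s → h s = 0) :
    ∃ t₀ > 0, ∀ t : ℝ, |t| < t₀ → ∃ D : RadialDiffeo m R, D.l = fun s => 1 + t * h s := by
  obtain ⟨M, hM0, hM⟩ := HasCompactSupport.exists_abs_le hh.continuous hc
  have hh1 : ContDiff ℝ ∞ (deriv h) := by simpa using hh.iterate_deriv 1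
  obtain ⟨M', hM'0, hM'⟩ := HasCompactSupport.exists_abs_le (f := fun s => 2 * s * deriv h s)
    (by have := hh1.continuous; fun_prop) hc.deriv.mul_left
  have hξ : ContDiff ℝ ∞ fun y : EuclideanSpace ℝ (Fin m) => h (‖y‖ ^ 2) • y :=
    (contDiff_comp_normSq hh).smul contDiff_id
  have hξc : HasCompactSupport fun y : EuclideanSpace ℝ (Fin m) => h (‖y‖ ^ 2) • y :=
    (hasCompactSupport_comp_normSq hc).smul_right
  obtain ⟨K, hK⟩ := hξ.lipschitzWith_of_hasCompactSupport hξc (by simp)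
  -- Here `M`, `M'` and `K` bound `h`, `2 s h'` and the Lipschitz constant of the perturbing field.
  -- This choice gives `|t| (M + M') < 1/2`, hence positive tangential and radial stretching, and
  -- `|t| K < 1`, hence invertibility as a Lipschitz perturbation of the identity.
  refine ⟨1 / (2 * (M + M' + K + 1)), by positivity, fun t ht => ?_⟩
  have hden : 0 < 2 * (M + M' + K + 1) := by positivity
  rw [lt_div_iff₀ hden] at ht
  have hK0 := K.2
  have htn := abs_nonneg t
  have ht1 : |t| * M + |t| * M' < 1 / 2 := by nlinarith [mul_nonneg htn hK0]
  have htK : |t| * K < 1 := by nlinarith [mul_nonneg htn hM0, mul_nonneg htn hM'0]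
  have b1 : ∀ s, |t * h s| ≤ |t| * M := fun s => by
    rw [abs_mul]; exact mul_le_mul_of_nonneg_left (hM s) htn
  have b2 : ∀ s, |t * (2 * s * deriv h s)| ≤ |t| * M' := fun s => by
    rw [abs_mul]; exact mul_le_mul_of_nonneg_left (hM' s) htn
  have hl : ∀ s, deriv (fun s => 1 + t * h s) s = t * deriv h s := fun s => by
    simp
  let f : EuclideanSpace ℝ (Fin m) → EuclideanSpace ℝ (Fin m) := fun y => (1 + t * h (‖y‖ ^ 2)) • y
  have happ : ApproximatesLinearOn f ((ContinuousLinearEquiv.refl ℝ (EuclideanSpace ℝ (Fin m)) :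
      EuclideanSpace ℝ (Fin m) ≃L[ℝ] EuclideanSpace ℝ (Fin m)) :
      EuclideanSpace ℝ (Fin m) →L[ℝ] EuclideanSpace ℝ (Fin m)) univ (‖t‖₊ * K) := by
    intro x _ y _
    have h1 := hK.dist_le_mul x y
    rw [dist_eq_norm, dist_eq_norm] at h1
    have e : f x - f y - ((ContinuousLinearEquiv.refl ℝ (EuclideanSpace ℝ (Fin m)) :
      EuclideanSpace ℝ (Fin m) ≃L[ℝ] EuclideanSpace ℝ (Fin m)) :
      EuclideanSpace ℝ (Fin m) →L[ℝ] EuclideanSpace ℝ (Fin m)) (x - y)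
      = t • (h (‖x‖ ^ 2) • x - h (‖y‖ ^ 2) • y) := by
      simp only [f, ContinuousLinearEquiv.coe_coe, ContinuousLinearEquiv.refl_apply]
      module
    rw [e, norm_smul]
    push_cast
    rw [mul_assoc]
    gcongr
  have hcN : Subsingleton (EuclideanSpace ℝ (Fin m)) ∨ ‖t‖₊ * K <
      ‖(((ContinuousLinearEquiv.refl ℝ (EuclideanSpace ℝ (Fin m))).symm :
      EuclideanSpace ℝ (Fin m) ≃L[ℝ] EuclideanSpace ℝ (Fin m)) :
      EuclideanSpace ℝ (Fin m) →L[ℝ] EuclideanSpace ℝ (Fin m))‖₊⁻¹ := by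
    rcases subsingleton_or_nontrivial (EuclideanSpace ℝ (Fin m)) with hs | hs
    · exact Or.inl hs
    · right
      rw [ContinuousLinearEquiv.refl_symm, ContinuousLinearEquiv.coe_refl]
      have : ‖ContinuousLinearMap.id ℝ (EuclideanSpace ℝ (Fin m))‖₊ = 1 := by
        ext
        simp
      rw [this, inv_one, ← NNReal.coe_lt_coe]
      simpa using htK
  -- The given `b` may be nonpositive, while the structure asks for a positive bound; hence the
  -- maximum with `R ^ 2 / 2`.
  refine ⟨⟨fun s => 1 + t * h s, contDiff_const.add (contDiff_const.mul hh), fun s => ?_,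
    fun s => ?_, max b (R ^ 2 / 2), lt_max_of_lt_right (by positivity), max_lt hb (by nlinarith),
    fun s hs => by simp [hhb s ((le_max_left _ _).trans hs)], happ.toHomeomorph f hcN,
    fun y => rfl⟩, rfl⟩
  · have := (abs_le.1 (b1 s)).1
    nlinarith [mul_nonneg htn hM'0]
  · rw [hl]
    have h1 := (abs_le.1 (b1 s)).1
    have h2 := (abs_le.1 (b2 s)).1
    nlinarith

/-- Differentiation under the integral sign, for a smooth kernel with parameters in a compact
set. -/
theorem hasDerivAt_integral_of_contDiffAt {α Z : Type*} [MeasurableSpace α] {μ : Measure α}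
    [NormedAddCommGroup Z] [NormedSpace ℝ Z] {K : Set Z} (hK : IsCompact K) {C : ℝ → Z → ℝ}
    {C' : Z → ℝ} (hC : ∀ z ∈ K, ContDiffAt ℝ 1 (fun w : ℝ × Z => C w.1 w.2) (0, z))
    (hC' : ∀ z ∈ K, HasDerivAt (fun t => C t z) (C' z) 0)
    {z : α → Z} (hz : ∀ᵐ y ∂μ, z y ∈ K) {g : α → ℝ} (hg : Integrable g μ)
    (hm : ∀ t, AEStronglyMeasurable (fun y => C t (z y)) μ) :
    HasDerivAt (fun t => ∫ y, C t (z y) * g y ∂μ) (∫ y, C' (z y) * g y ∂μ) 0 ∧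
      (∀ᶠ t in 𝓝 0, Integrable (fun y => C t (z y) * g y) μ) ∧
      Integrable (fun y => C' (z y) * g y) μ := by
  let F : ℝ × Z → ℝ := fun w => C w.1 w.2
  let U : Set (ℝ × Z) := {w | ContDiffAt ℝ 1 F w}
  have hU : IsOpen U := isOpen_iff_mem_nhds.2 fun w hw => by
    have hw' : ContDiffAt ℝ 1 F w := hw
    exact hw'.eventually (by simp)
  -- Smoothness is assumed only on the slice `t = 0`. The tube lemma extends it to a common interval
  -- of `t` for all parameters in `K`, and compactness then bounds the `t`-derivative there, giving
  -- the dominating function.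
  obtain ⟨V, W, hV, -, h0V, hKW, hVW⟩ := generalized_tube_lemma (s := {(0 : ℝ)}) (t := K)
    isCompact_singleton hK hU (by
      rintro ⟨t, z⟩ ⟨rfl, hz⟩
      exact hC z hz)
  obtain ⟨r, hr, hrV⟩ := Metric.nhds_basis_closedBall.mem_iff.1
    (hV.mem_nhds (h0V (mem_singleton 0)))
  have hsub : ∀ t ∈ closedBall (0 : ℝ) r, ∀ z ∈ K, ContDiffAt ℝ 1 F (t, z) := fun t ht z hz =>
    hVW ⟨hrV ht, hKW hz⟩
  have hcpt : IsCompact (closedBall (0 : ℝ) r ×ˢ K) := (isCompact_closedBall _ _).prod hK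
  obtain ⟨M, hM⟩ := hcpt.exists_bound_of_continuousOn (f := fun w => fderiv ℝ F w (1, 0))
    fun w hw => ((hsub w.1 hw.1 w.2 hw.2).continuousAt_fderiv (by simp)).clm_apply
      continuousAt_const |>.continuousWithinAt
  obtain ⟨M₀, hM₀⟩ := hcpt.exists_bound_of_continuousOn (f := F)
    fun w hw => (hsub w.1 hw.1 w.2 hw.2).continuousAt.continuousWithinAt
  have hder : ∀ t ∈ closedBall (0 : ℝ) r, ∀ z ∈ K,
      HasDerivAt (fun t => C t z) (fderiv ℝ F (t, z) (1, 0)) t := fun t ht z hz => by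
    have h1 := ((hsub t ht z hz).differentiableAt (by simp)).hasFDerivAt
    have h2 : HasDerivAt (fun t : ℝ => (t, z)) ((1 : ℝ), (0 : Z)) t :=
      (hasDerivAt_id t).prodMk (hasDerivAt_const t z)
    exact h1.comp_hasDerivAt t h2
  have hint : ∀ t ∈ closedBall (0 : ℝ) r, Integrable (fun y => C t (z y) * g y) μ := fun t ht =>
    hg.bdd_mul (c := M₀) (hm t) (by filter_upwards [hz] with y hy using hM₀ (t, z y) ⟨ht, hy⟩)
  -- Measurability of the derivative at `t = 0`, proved next, comes from its being a limit of
  -- difference quotients. For this reason `F'` below takes the value `C'` at `t = 0`.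
  have h0 : (0 : ℝ) ∈ closedBall (0 : ℝ) r := mem_closedBall_self hr.le
  have hmeas' : AEStronglyMeasurable (fun y => C' (z y) * g y) μ := by
    refine AEStronglyMeasurable.mul ?_ hg.aestronglyMeasurable
    refine aestronglyMeasurable_of_tendsto_ae (u := 𝓝[≠] (0 : ℝ))
      (f := fun t y => t⁻¹ • (C (0 + t) (z y) - C 0 (z y)))
      (fun t => ((hm (0 + t)).sub (hm 0)).const_smul t⁻¹) ?_
    filter_upwards [hz] with y hy using (hC' _ hy).tendsto_slope_zero
  have key := hasDerivAt_integral_of_dominated_loc_of_deriv_le (μ := μ) (x₀ := (0 : ℝ))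
    (F := fun t y => C t (z y) * g y)
    (F' := fun t y => if t = 0 then C' (z y) * g y else fderiv ℝ F (t, z y) (1, 0) * g y)
    (bound := fun y => M * ‖g y‖) (closedBall_mem_nhds 0 hr)
    (Eventually.of_forall fun t => (hm t).mul hg.aestronglyMeasurable) (hint 0 h0)
    (by simpa using hmeas') (by
      filter_upwards [hz] with y hy t ht
      have e : (if t = 0 then C' (z y) * g y else fderiv ℝ F (t, z y) (1, 0) * g y)
          = fderiv ℝ F (t, z y) (1, 0) * g y := by
        split_ifs with h
        · subst h
          rw [(hC' _ hy).unique (hder 0 h0 _ hy)]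
        · rfl
      simp only [e, norm_mul]
      exact mul_le_mul_of_nonneg_right (hM (t, z y) ⟨ht, hy⟩) (norm_nonneg _))
    (hg.norm.const_mul M) (by
      filter_upwards [hz] with y hy t ht
      have e : (if t = 0 then C' (z y) * g y else fderiv ℝ F (t, z y) (1, 0) * g y)
          = fderiv ℝ F (t, z y) (1, 0) * g y := by
        split_ifs with h
        · subst h
          rw [(hC' _ hy).unique (hder 0 h0 _ hy)]
        · rfl
      simp only [e]
      exact (hder t ht _ hy).mul_const _)
  simp only [if_true] at key
  exact ⟨key.2, by filter_upwards [closedBall_mem_nhds (0 : ℝ) hr] with t ht using hint t ht, key.1⟩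

/-! ### The coefficients of a radial perturbation as functions of t and s, and their t-derivatives
at 0. -/

namespace RadialPerturbation

noncomputable section

/-! The coefficients attached to the radial map `y ↦ (1 + t h(|y|²)) y`, as functions of `t` and
`s = |y|²`. -/

variable (m : ℕ) (h : ℝ → ℝ) (t s : ℝ)

/-- The stretching factor. -/
def l : ℝ := 1 + t * h s

/-- The derivative in the radial direction. -/
def σ : ℝ := 1 + t * h s + 2 * s * (t * deriv h s)

/-- The `s`-derivative of `σ`. -/
def σ' : ℝ := t * (3 * deriv h s + 2 * s * deriv (deriv h) s)

/-- The isotropic part of the inverse differential. -/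
def p : ℝ := (l h t s)⁻¹

/-- The radial part of the inverse differential. -/
def q : ℝ := -(2 * (t * deriv h s)) / (l h t s * σ h t s)

/-- The `s`-derivative of `p`. -/
def p' : ℝ := -(t * deriv h s) / l h t s ^ 2

/-- The `s`-derivative of `q`. -/
def q' : ℝ := (-(2 * (t * deriv (deriv h) s)) * (l h t s * σ h t s) -
  -(2 * (t * deriv h s)) * (t * deriv h s * σ h t s + l h t s * σ' h t s)) / (l h t s * σ h t s) ^ 2

/-- The Jacobian. -/
def jac : ℝ := l h t s ^ m * σ h t s / l h t s

/-- The coefficient of the radial part of the pulled back metric. -/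
def a : ℝ := 2 * p h t s * q h t s + q h t s ^ 2 * s

/-- The coefficient of the radial derivative in the pulled back Laplacian. -/
def c : ℝ := 2 * p h t s * p' h t s + (m - 1) * p h t s * q h t s + 2 * p h t s * q' h t s * s
    + 2 * q h t s * p' h t s * s + 2 * q h t s * q' h t s * s ^ 2 + q h t s ^ 2 * s

section Identify

variable {m h t} {R : ℝ} {D : RadialDiffeo m R} (hD : D.l = fun s => 1 + t * h s)
  (hh : ContDiff ℝ ∞ h)

include hD

theorem l_eq : D.l s = l h t s := by rw [hD, l]

theorem p_eq : D.p s = p h t s := by rw [RadialDiffeo.p, l_eq s hD, p]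

include hh

theorem hasDerivAt_l : HasDerivAt D.l (t * deriv h s) s := by
  rw [hD]
  exact ((hh.differentiable (by simp) s).hasDerivAt.const_mul t).const_add 1

theorem deriv_l : deriv D.l s = t * deriv h s := (hasDerivAt_l s hD hh).deriv

theorem σ_eq : D.σ s = σ h t s := by
  rw [RadialDiffeo.σ, deriv_l s hD hh, hD, σ]

theorem q_eq : D.q s = q h t s := by
  rw [RadialDiffeo.q, deriv_l s hD hh, l_eq s hD, σ_eq s hD hh, q]

theorem jac_eq : D.jac s = jac m h t s := by
  rw [RadialDiffeo.jac, l_eq s hD, σ_eq s hD hh, jac]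

theorem deriv_p_eq : deriv D.p s = p' h t s := by
  have := ((hasDerivAt_l s hD hh).inv (D.l_ne s)).deriv
  rw [l_eq s hD] at this
  exact this

theorem hasDerivAt_σ : HasDerivAt D.σ (σ' h t s) s := by
  have e : D.σ = fun s => 1 + t * h s + 2 * s * (t * deriv h s) := by
    ext s
    rw [σ_eq s hD hh, σ]
  have hh1 : ContDiff ℝ ∞ (deriv h) := by simpa using hh.iterate_deriv 1
  rw [e]
  refine ((((hh.differentiable (by simp) s).hasDerivAt.const_mul t).const_add 1).add
    (((hasDerivAt_id s).const_mul 2).mul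
      ((hh1.differentiable (by simp) s).hasDerivAt.const_mul t))).congr_deriv ?_
  simp only [id, σ']
  ring

theorem deriv_q_eq : deriv D.q s = q' h t s := by
  have hh1 : ContDiff ℝ ∞ (deriv h) := by simpa using hh.iterate_deriv 1
  have e : D.q = fun s => -(2 * (t * deriv h s)) / (D.l s * D.σ s) := by
    ext s
    rw [RadialDiffeo.q, deriv_l s hD hh]
  have := (((((hh1.differentiable (by simp) s).hasDerivAt.const_mul t).const_mul 2).neg).div
    ((hasDerivAt_l s hD hh).mul (hasDerivAt_σ s hD hh)) (mul_ne_zero (D.l_ne s) (D.σ_ne s))).deriv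
  simp only [Pi.mul_apply, l_eq s hD, σ_eq s hD hh, Pi.neg_apply] at this
  rw [e]
  exact this

theorem a_eq : D.a s = a h t s := by
  rw [RadialDiffeo.a, p_eq s hD, q_eq s hD hh, a]

theorem c_eq : D.c s = c m h t s := by
  rw [RadialDiffeo.c, p_eq s hD, q_eq s hD hh, deriv_p_eq s hD hh, deriv_q_eq s hD hh, c]

end Identify

section AtZero

@[simp] theorem l_zero : l h 0 s = 1 := by simp [l]
@[simp] theorem σ_zero : σ h 0 s = 1 := by simp [σ]
@[simp] theorem p_zero : p h 0 s = 1 := by simp [p]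
@[simp] theorem q_zero : q h 0 s = 0 := by simp [q]
@[simp] theorem p'_zero : p' h 0 s = 0 := by simp [p']
@[simp] theorem q'_zero : q' h 0 s = 0 := by simp [q']
@[simp] theorem jac_zero : jac m h 0 s = 1 := by simp [jac]
@[simp] theorem a_zero : a h 0 s = 0 := by simp [a]
@[simp] theorem c_zero : c m h 0 s = 0 := by simp [c]

variable {h} {E : Type*} [NormedAddCommGroup E] [NormedSpace ℝ E] {T S : E → ℝ} {e : E}

section Smooth

variable (hh : ContDiff ℝ ∞ h) (hT : ContDiffAt ℝ 1 T e) (hS : ContDiffAt ℝ 1 S e) (hT0 : T e = 0)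

include hh hS

theorem contDiffAt_comp : ContDiffAt ℝ 1 (fun e => h (S e)) e ∧
    ContDiffAt ℝ 1 (fun e => deriv h (S e)) e ∧
    ContDiffAt ℝ 1 (fun e => deriv (deriv h) (S e)) e := by
  have hh1 : ContDiff ℝ ∞ (deriv h) := by simpa using hh.iterate_deriv 1
  have hh2 : ContDiff ℝ ∞ (deriv (deriv h)) := by simpa using hh1.iterate_deriv 1
  have le : (1 : WithTop ℕ∞) ≤ ∞ := by exact_mod_cast le_top
  exact ⟨(hh.of_le le).contDiffAt.comp e hS, (hh1.of_le le).contDiffAt.comp e hS,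
    (hh2.of_le le).contDiffAt.comp e hS⟩

include hT

theorem contDiffAt_l : ContDiffAt ℝ 1 (fun e => l h (T e) (S e)) e := by
  obtain ⟨h0, h1, h2⟩ := contDiffAt_comp hh hS
  exact contDiffAt_const.add (hT.mul h0)

theorem contDiffAt_σ : ContDiffAt ℝ 1 (fun e => σ h (T e) (S e)) e := by
  obtain ⟨h0, h1, h2⟩ := contDiffAt_comp hh hS
  exact (contDiffAt_const.add (hT.mul h0)).add ((contDiffAt_const.mul hS).mul (hT.mul h1))

theorem contDiffAt_σ' : ContDiffAt ℝ 1 (fun e => σ' h (T e) (S e)) e := by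
  obtain ⟨h0, h1, h2⟩ := contDiffAt_comp hh hS
  unfold σ'
  fun_prop

include hT0

theorem contDiffAt_p : ContDiffAt ℝ 1 (fun e => p h (T e) (S e)) e :=
  (contDiffAt_l hh hT hS).inv (by simp [hT0])

theorem contDiffAt_q : ContDiffAt ℝ 1 (fun e => q h (T e) (S e)) e := by
  obtain ⟨h0, h1, h2⟩ := contDiffAt_comp hh hS
  exact ContDiffAt.div (by fun_prop) ((contDiffAt_l hh hT hS).mul (contDiffAt_σ hh hT hS))
    (by simp [hT0])

theorem contDiffAt_p' : ContDiffAt ℝ 1 (fun e => p' h (T e) (S e)) e := by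
  obtain ⟨h0, h1, h2⟩ := contDiffAt_comp hh hS
  exact ContDiffAt.div (by fun_prop) ((contDiffAt_l hh hT hS).pow 2) (by simp [hT0])

theorem contDiffAt_q' : ContDiffAt ℝ 1 (fun e => q' h (T e) (S e)) e := by
  obtain ⟨h0, h1, h2⟩ := contDiffAt_comp hh hS
  have hl := contDiffAt_l hh hT hS
  have hσ := contDiffAt_σ hh hT hS
  have hσ' := contDiffAt_σ' hh hT hS
  exact ContDiffAt.div (by fun_prop) ((hl.mul hσ).pow 2) (by simp [hT0])

theorem contDiffAt_jac : ContDiffAt ℝ 1 (fun e => jac m h (T e) (S e)) e := by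
  have hl := contDiffAt_l hh hT hS
  exact ContDiffAt.div ((hl.pow m).mul (contDiffAt_σ hh hT hS)) hl (by simp [hT0])

theorem contDiffAt_a : ContDiffAt ℝ 1 (fun e => a h (T e) (S e)) e := by
  have hp := contDiffAt_p hh hT hS hT0
  have hq := contDiffAt_q hh hT hS hT0
  unfold a
  fun_prop

theorem contDiffAt_c : ContDiffAt ℝ 1 (fun e => c m h (T e) (S e)) e := by
  have hp := contDiffAt_p hh hT hS hT0
  have hq := contDiffAt_q hh hT hS hT0
  have hp' := contDiffAt_p' hh hT hS hT0
  have hq' := contDiffAt_q' hh hT hS hT0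
  unfold c
  fun_prop

end Smooth

theorem hasDerivAt_smul_id (k : ℝ) : HasDerivAt (fun t : ℝ => t * k) k 0 := by
  simpa using (hasDerivAt_id (0 : ℝ)).mul_const k

theorem hasDerivAt_l_zero : HasDerivAt (fun t => l h t s) (h s) 0 := by
  exact (hasDerivAt_smul_id (h s)).const_add 1

theorem hasDerivAt_σ_zero : HasDerivAt (fun t => σ h t s) (h s + 2 * s * deriv h s) 0 := by
  exact ((hasDerivAt_smul_id (h s)).const_add 1).add
    ((hasDerivAt_smul_id (deriv h s)).const_mul (2 * s))

theorem hasDerivAt_σ'_zero : HasDerivAt (fun t => σ' h t s)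
    (3 * deriv h s + 2 * s * deriv (deriv h) s) 0 := by
  exact hasDerivAt_smul_id _

theorem hasDerivAt_p_zero : HasDerivAt (fun t => p h t s) (-h s) 0 := by
  refine ((hasDerivAt_l_zero (h := h) s).inv (by simp)).congr_deriv ?_
  simp

theorem hasDerivAt_q_zero : HasDerivAt (fun t => q h t s) (-2 * deriv h s) 0 := by
  refine ((((hasDerivAt_smul_id (deriv h s)).const_mul 2).neg).div
    ((hasDerivAt_l_zero (h := h) s).mul (hasDerivAt_σ_zero s)) (by simp)).congr_deriv ?_
  simp

theorem hasDerivAt_p'_zero : HasDerivAt (fun t => p' h t s) (-deriv h s) 0 := by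
  refine (((hasDerivAt_smul_id (deriv h s)).neg).div
    ((hasDerivAt_l_zero (h := h) s).pow 2) (by simp)).congr_deriv ?_
  simp

theorem hasDerivAt_q'_zero : HasDerivAt (fun t => q' h t s) (-2 * deriv (deriv h) s) 0 := by
  have hl := hasDerivAt_l_zero (h := h) s
  have hσ := hasDerivAt_σ_zero (h := h) s
  have hσ' := hasDerivAt_σ'_zero (h := h) s
  refine ((((((hasDerivAt_smul_id (deriv (deriv h) s)).const_mul 2).neg).mul (hl.mul hσ)).sub
    ((((hasDerivAt_smul_id (deriv h s)).const_mul 2).neg).mul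
      (((hasDerivAt_smul_id (deriv h s)).mul hσ).add (hl.mul hσ')))).div ((hl.mul hσ).pow 2)
    (by simp)).congr_deriv ?_
  simp [σ']

theorem hasDerivAt_jac_zero : HasDerivAt (fun t => jac m h t s) (m * h s + 2 * s * deriv h s) 0 := by
  have hl := hasDerivAt_l_zero (h := h) s
  refine (((hl.pow m).mul (hasDerivAt_σ_zero s)).div hl (by simp)).congr_deriv ?_
  simp
  ring

theorem hasDerivAt_a_zero : HasDerivAt (fun t => a h t s) (-4 * deriv h s) 0 := by
  have hq := hasDerivAt_q_zero (h := h) s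
  refine ((((hasDerivAt_p_zero s).const_mul 2).mul hq).add ((hq.pow 2).mul_const s)).congr_deriv ?_
  simp
  ring

theorem hasDerivAt_c_zero :
    HasDerivAt (fun t => c m h t s) (-2 * m * deriv h s - 4 * s * deriv (deriv h) s) 0 := by
  have hp := hasDerivAt_p_zero (h := h) s
  have hq := hasDerivAt_q_zero (h := h) s
  have hp' := hasDerivAt_p'_zero (h := h) s
  have hq' := hasDerivAt_q'_zero (h := h) s
  refine (((((((hp.const_mul 2).mul hp').add ((hp.const_mul ((m : ℝ) - 1)).mul hq)).add
    (((hp.const_mul 2).mul hq').mul_const s)).add (((hq.const_mul 2).mul hp').mul_const s)).add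
    (((hq.const_mul 2).mul hq').mul_const (s ^ 2))).add ((hq.pow 2).mul_const s)).congr_deriv ?_
  simp
  ring

end AtZero

end

end RadialPerturbation

/-! ### The first variation of the energy. -/

theorem MeasureTheory.MemLp.integrable_inner_two {α F : Type*} [MeasurableSpace α] {μ : Measure α}
    [NormedAddCommGroup F] [InnerProductSpace ℝ F] {f g : α → F} (hf : MemLp f 2 μ)
    (hg : MemLp g 2 μ) : Integrable (fun x => inner ℝ (f x) (g x)) μ := by
  refine (L2.integrable_inner (𝕜 := ℝ) (hf.toLp f) (hg.toLp g)).congr ?_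
  filter_upwards [hf.coeFn_toLp, hg.coeFn_toLp] with x h1 h2
  rw [h1, h2]

theorem norm_smul_add_smul_add_smul_sq {F : Type*} [NormedAddCommGroup F] [InnerProductSpace ℝ F]
    (a b c : ℝ) (x y z : F) : ‖a • x + b • y + c • z‖ ^ 2 = a ^ 2 * inner ℝ x x +
      2 * a * b * inner ℝ x y + 2 * a * c * inner ℝ x z + b ^ 2 * inner ℝ y y +
      2 * b * c * inner ℝ y z + c ^ 2 * inner ℝ z z := by
  rw [← real_inner_self_eq_norm_sq]
  simp only [inner_add_left, inner_add_right, real_inner_smul_left, real_inner_smul_right,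
    real_inner_comm x y, real_inner_comm x z, real_inner_comm y z]
  ring

namespace SobolevSphereMap

noncomputable section

variable {m n : ℕ} {R : ℝ} (u : SobolevSphereMap m n R)

/-- The gradient `u_β + x^α u_{αβ}` of the radial derivative. -/
def radialGrad (β : Fin m) (x : EuclideanSpace ℝ (Fin m)) : EuclideanSpace ℝ (Fin (n + 1)) :=
  u.grad β x + ∑ α, x α • u.hess α β x

/-- The second radial derivative `x^β (u_β + x^α u_{αβ})`. -/
def radialTwo (x : EuclideanSpace ℝ (Fin m)) : EuclideanSpace ℝ (Fin (n + 1)) :=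
  ∑ β, x β • u.radialGrad β x

theorem memLp_laplacian : MemLp u.laplacian 2 (volume.restrict (ball 0 R)) :=
  memLp_finsetSum _ fun α _ => u.memLp_hess α α

theorem continuous_coord (i : Fin m) : Continuous fun x : EuclideanSpace ℝ (Fin m) => x i :=
  (EuclideanSpace.contDiff_coord i).continuous

theorem memLp_radial : MemLp u.radial 2 (volume.restrict (ball 0 R)) :=
  memLp_finsetSum _ fun α _ => MemLp.continuous_smul_ball (continuous_coord α) (u.memLp_grad α)

theorem memLp_radialGrad (β : Fin m) : MemLp (u.radialGrad β) 2 (volume.restrict (ball 0 R)) :=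
  (u.memLp_grad β).add (memLp_finsetSum _ fun α _ =>
    MemLp.continuous_smul_ball (continuous_coord α) (u.memLp_hess α β))

theorem memLp_radialTwo : MemLp u.radialTwo 2 (volume.restrict (ball 0 R)) :=
  memLp_finsetSum _ fun β _ => MemLp.continuous_smul_ball (continuous_coord β)
    (u.memLp_radialGrad β)

theorem gradNorm_nonneg (x : EuclideanSpace ℝ (Fin m)) : 0 ≤ u.gradNorm x := Real.sqrt_nonneg _

theorem gradNorm_sq (x : EuclideanSpace ℝ (Fin m)) :
    u.gradNorm x ^ 2 = ∑ α, ‖u.grad α x‖ ^ 2 :=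
  Real.sq_sqrt (Finset.sum_nonneg fun _ _ => sq_nonneg _)

theorem memLp_gradNorm :
    MemLp u.gradNorm ((m + 1 : ℕ) : ENNReal) (volume.restrict (ball 0 R)) := by
  have h1 : MemLp (fun x => ∑ α, ‖u.grad α x‖) ((m + 1 : ℕ) : ENNReal)
      (volume.restrict (ball 0 R)) := memLp_finsetSum _ fun α _ => (u.memLp_grad' α).norm
  refine h1.mono ?_ (Eventually.of_forall fun x => ?_)
  · have : ∀ α, AEMeasurable (fun x => ‖u.grad α x‖ ^ 2) (volume.restrict (ball 0 R)) := fun α =>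
      (u.memLp_grad α).1.norm.aemeasurable.pow_const 2
    exact (Finset.aemeasurable_fun_sum Finset.univ fun α _ => this α).sqrt.aestronglyMeasurable
  · have h0 : 0 ≤ ∑ α, ‖u.grad α x‖ := Finset.sum_nonneg fun _ _ => norm_nonneg _
    rw [Real.norm_of_nonneg (u.gradNorm_nonneg x), Real.norm_of_nonneg h0]
    refine Real.sqrt_le_iff.2 ⟨h0, ?_⟩
    exact Finset.sum_sq_le_sq_sum_of_nonneg fun _ _ => norm_nonneg _

theorem integrable_gradNorm_pow :
    IntegrableOn (fun x => u.gradNorm x ^ (m + 1)) (ball 0 R) := by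
  have := u.memLp_gradNorm.integrable_norm_pow (by simp)
  unfold IntegrableOn
  simpa only [Real.norm_of_nonneg (u.gradNorm_nonneg _)] using this

theorem integrableOn_energyDensity (ε : ℝ) : IntegrableOn (u.energyDensity ε) (ball 0 R) := by
  refine Integrable.add ?_ (u.integrable_gradNorm_pow.const_mul ε)
  exact u.memLp_laplacian.integrable_norm_pow (by simp)

/-- Cauchy–Schwarz inequality. -/
theorem norm_radial_sq_le (x : EuclideanSpace ℝ (Fin m)) :
    ‖u.radial x‖ ^ 2 ≤ ‖x‖ ^ 2 * u.gradNorm x ^ 2 := by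
  rw [gradNorm_sq, EuclideanSpace.real_norm_sq_eq x]
  have h1 : ‖u.radial x‖ ≤ ∑ α, |x α| * ‖u.grad α x‖ :=
    (norm_sum_le _ _).trans (Finset.sum_le_sum fun α _ => by rw [norm_smul, Real.norm_eq_abs])
  calc ‖u.radial x‖ ^ 2 ≤ (∑ α, |x α| * ‖u.grad α x‖) ^ 2 := by gcongr
    _ ≤ (∑ α, |x α| ^ 2) * ∑ α, ‖u.grad α x‖ ^ 2 := Finset.sum_mul_sq_le_sq_mul_sq _ _ _
    _ = _ := by simp only [sq_abs]

/-- The radial fraction of the squared gradient. -/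
def radialRatio (x : EuclideanSpace ℝ (Fin m)) : ℝ := ‖u.radial x‖ ^ 2 / u.gradNorm x ^ 2

theorem radialRatio_nonneg (x : EuclideanSpace ℝ (Fin m)) : 0 ≤ u.radialRatio x := by
  unfold radialRatio
  positivity

theorem radialRatio_le (x : EuclideanSpace ℝ (Fin m)) : u.radialRatio x ≤ ‖x‖ ^ 2 :=
  div_le_of_le_mul₀ (sq_nonneg _) (sq_nonneg _) (u.norm_radial_sq_le x)

theorem radialRatio_mul (x : EuclideanSpace ℝ (Fin m)) :
    u.radialRatio x * u.gradNorm x ^ 2 = ‖u.radial x‖ ^ 2 := by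
  unfold radialRatio
  by_cases h : u.gradNorm x ^ 2 = 0
  · have := u.norm_radial_sq_le x
    rw [h, mul_zero] at this
    rw [h, mul_zero]
    exact (le_antisymm this (sq_nonneg _)).symm
  · exact div_mul_cancel₀ _ h

/-- Used to turn the first variation of the ε-term, found as a multiple of `radialRatio`, into the
density occurring in P. -/
theorem radialRatio_mul_pow (hm : 1 ≤ m) (x : EuclideanSpace ℝ (Fin m)) :
    u.radialRatio x * u.gradNorm x ^ (m + 1) = u.gradNorm x ^ (m - 1) * ‖u.radial x‖ ^ 2 := by
  rw [← radialRatio_mul, show m + 1 = (m - 1) + 2 by omega, pow_add]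
  ring

theorem aestronglyMeasurable_radialRatio :
    AEStronglyMeasurable u.radialRatio (volume.restrict (ball 0 R)) := by
  have h1 := u.memLp_radial.1.norm.aemeasurable.pow_const 2
  have h2 := u.memLp_gradNorm.1.aemeasurable.pow_const 2
  exact (h1.div h2).aestronglyMeasurable

/-- The gradient norm of the competitor is `|∇u|` times the square root of `p² + a κ`, where `κ` is
the radial ratio. So `|∇u|^{m+1}` splits off as a factor independent of the diffeomorphism, and
zeros of the gradient cause no loss of smoothness in the variation. -/
theorem energy_pull (ε : ℝ) (D : RadialDiffeo m R) (hR : 0 < R) :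
    (u.pull D hR).energy ε R = ∫ y in ball 0 R, D.jac (‖y‖ ^ 2) *
      (‖D.p (‖y‖ ^ 2) ^ 2 • u.laplacian y + D.a (‖y‖ ^ 2) • u.radialTwo y
        + D.c (‖y‖ ^ 2) • u.radial y‖ ^ 2
        + ε * (√(D.p (‖y‖ ^ 2) ^ 2 + D.a (‖y‖ ^ 2) * u.radialRatio y) ^ (m + 1)
          * u.gradNorm y ^ (m + 1))) := by
  rw [energy, D.setIntegral_ball hR]
  refine integral_congr_ae (Eventually.of_forall fun y => ?_)
  simp only [smul_eq_mul, energyDensity]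
  congr 2
  · rw [show (u.pull D hR).laplacian (D.toHomeo y) = D.p (‖y‖ ^ 2) ^ 2 • u.laplacian y
      + D.a (‖y‖ ^ 2) • u.radialTwo y + D.c (‖y‖ ^ 2) • u.radial y by
        simp only [laplacian, pull, D.toHomeo.symm_apply_apply]
        exact D.sum_pullGrad_pullGradDeriv y]
  · rw [← mul_pow]
    congr 2
    have : (u.pull D hR).gradNorm (D.toHomeo y) = √(∑ i, ‖D.pullGrad u.grad i y‖ ^ 2) := by
      simp only [gradNorm, pull, D.toHomeo.symm_apply_apply]
    rw [this, D.sum_norm_pullGrad_sq, ← gradNorm_sq]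
    change √(_ + D.a (‖y‖ ^ 2) * ‖u.radial y‖ ^ 2) = _
    rw [← radialRatio_mul, ← mul_assoc, ← add_mul, Real.sqrt_mul' _ (sq_nonneg _),
      Real.sqrt_sq (u.gradNorm_nonneg y)]

open RadialPerturbation in
/-- The first variation of the energy at a minimizer, for radial variations of the domain. -/
theorem IsMinimizer.integral_eq_zero {u : SobolevSphereMap m n R} {ε : ℝ} (hu : u.IsMinimizer ε)
    (hR : 0 < R) (hm : 1 ≤ m) {h : ℝ → ℝ} (hh : ContDiff ℝ ∞ h) (hc : HasCompactSupport h) {b : ℝ}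
    (hb : b < R ^ 2) (hhb : ∀ s, b ≤ s → h s = 0) :
    (∫ x in ball 0 R, ((((m : ℝ) - 4) * h (‖x‖ ^ 2) + 2 * ‖x‖ ^ 2 * deriv h (‖x‖ ^ 2))
        * ‖u.laplacian x‖ ^ 2
      - 8 * deriv h (‖x‖ ^ 2) * inner ℝ (u.laplacian x) (u.radialTwo x)
      - (4 * m * deriv h (‖x‖ ^ 2) + 8 * ‖x‖ ^ 2 * deriv (deriv h) (‖x‖ ^ 2))
        * inner ℝ (u.laplacian x) (u.radial x)
      + ε * ((-h (‖x‖ ^ 2) + 2 * ‖x‖ ^ 2 * deriv h (‖x‖ ^ 2)) * u.gradNorm x ^ (m + 1)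
        - 2 * (m + 1) * deriv h (‖x‖ ^ 2) * (u.gradNorm x ^ (m - 1) * ‖u.radial x‖ ^ 2)))) = 0 := by
  set μ := volume.restrict (ball (0 : EuclideanSpace ℝ (Fin m)) R) with hμ
  obtain ⟨t₀, ht₀, hD⟩ := RadialDiffeo.exists_of_small (m := m) hR hh hc hb hhb
  have hz : ∀ᵐ y ∂μ, ‖y‖ ^ 2 ∈ Icc 0 (R ^ 2) := by
    filter_upwards [ae_restrict_mem measurableSet_ball] with y hy
    rw [mem_ball_zero_iff] at hy
    exact ⟨sq_nonneg _, by gcongr⟩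
  have hh1 : ContDiff ℝ ∞ (deriv h) := by simpa using hh.iterate_deriv 1
  have hh2 : ContDiff ℝ ∞ (deriv (deriv h)) := by simpa using hh1.iterate_deriv 1
  have mh := hh.continuous.measurable
  have mh1 := hh1.continuous.measurable
  have mh2 := hh2.continuous.measurable
  have T : ContDiff ℝ 1 fun w : ℝ × ℝ => w.1 := contDiff_fst
  have S : ContDiff ℝ 1 fun w : ℝ × ℝ => w.2 := contDiff_snd
  have leib : ∀ {C : ℝ → ℝ → ℝ} {C' : ℝ → ℝ} {g : EuclideanSpace ℝ (Fin m) → ℝ},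
      (∀ s, ContDiffAt ℝ 1 (fun w : ℝ × ℝ => C w.1 w.2) (0, s)) →
      (∀ s, HasDerivAt (fun t => C t s) (C' s) 0) → Integrable g μ → (∀ t, Measurable (C t)) →
      HasDerivAt (fun t => ∫ y, C t (‖y‖ ^ 2) * g y ∂μ) (∫ y, C' (‖y‖ ^ 2) * g y ∂μ) 0 ∧
      (∀ᶠ t in 𝓝 0, Integrable (fun y => C t (‖y‖ ^ 2) * g y) μ) ∧
      Integrable (fun y => C' (‖y‖ ^ 2) * g y) μ := fun h1 h2 h3 h4 =>
    hasDerivAt_integral_of_contDiffAt isCompact_Icc (fun z _ => h1 z) (fun z _ => h2 z) hz h3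
      fun t => ((h4 t).comp (by fun_prop)).aestronglyMeasurable
  have mea : ∀ t, Measurable (jac m h t) ∧ Measurable (p h t) ∧ Measurable (a h t) ∧
      Measurable (c m h t) := fun t => by
    have l1 : Measurable (l h t) := by unfold l; fun_prop
    have l2 : Measurable (RadialPerturbation.σ h t) := by
      unfold RadialPerturbation.σ; fun_prop
    have l2' : Measurable (σ' h t) := by unfold σ'; fun_prop
    have l3 : Measurable (p h t) := by unfold p; fun_prop
    have l4 : Measurable (q h t) := by unfold q; fun_prop
    have l5 : Measurable (p' h t) := by unfold p'; fun_prop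
    have l6 : Measurable (q' h t) := by unfold q'; fun_prop
    exact ⟨by unfold jac; fun_prop, l3, by unfold a; fun_prop, by unfold c; fun_prop⟩
  have sJ : ∀ s, ContDiffAt ℝ 1 (fun w : ℝ × ℝ => jac m h w.1 w.2) (0, s) := fun s =>
    contDiffAt_jac m hh T.contDiffAt S.contDiffAt rfl
  have sp : ∀ s, ContDiffAt ℝ 1 (fun w : ℝ × ℝ => p h w.1 w.2) (0, s) := fun s =>
    contDiffAt_p hh T.contDiffAt S.contDiffAt rfl
  have sa : ∀ s, ContDiffAt ℝ 1 (fun w : ℝ × ℝ => a h w.1 w.2) (0, s) := fun s =>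
    contDiffAt_a hh T.contDiffAt S.contDiffAt rfl
  have sc : ∀ s, ContDiffAt ℝ 1 (fun w : ℝ × ℝ => c m h w.1 w.2) (0, s) := fun s =>
    contDiffAt_c m hh T.contDiffAt S.contDiffAt rfl
  have dJ := fun s => hasDerivAt_jac_zero (h := h) m s
  have dp := fun s => hasDerivAt_p_zero (h := h) s
  have da := fun s => hasDerivAt_a_zero (h := h) s
  have dc := fun s => hasDerivAt_c_zero (h := h) m s
  -- Expanding the square of `p² Δu + a D²u + c Du` gives six products, each a smooth function of
  -- `t` and `|y|²` times a fixed integrable function. Since `a` and `c` vanish at `t = 0`, the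
  -- three products without `Δu` have derivative zero there.
  have t1 := leib (C := fun t s => jac m h t s * p h t s ^ 4)
    (C' := fun s => ((m : ℝ) - 4) * h s + 2 * s * deriv h s) (fun s => (sJ s).mul ((sp s).pow 4))
    (fun s => ((dJ s).mul ((dp s).pow 4)).congr_deriv (by simp; ring))
    (u.memLp_laplacian.integrable_inner_two u.memLp_laplacian)
    (fun t => (mea t).1.mul ((mea t).2.1.pow_const 4))
  have t2 := leib (C := fun t s => jac m h t s * (2 * p h t s ^ 2 * a h t s))
    (C' := fun s => -8 * deriv h s)
    (fun s => (sJ s).mul ((contDiffAt_const.mul ((sp s).pow 2)).mul (sa s)))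
    (fun s => ((dJ s).mul ((((dp s).pow 2).const_mul 2).mul (da s))).congr_deriv (by simp; ring))
    (u.memLp_laplacian.integrable_inner_two u.memLp_radialTwo)
    (fun t => (mea t).1.mul ((((mea t).2.1.pow_const 2).const_mul 2).mul (mea t).2.2.1))
  have t3 := leib (C := fun t s => jac m h t s * (2 * p h t s ^ 2 * c m h t s))
    (C' := fun s => -(4 * m * deriv h s + 8 * s * deriv (deriv h) s))
    (fun s => (sJ s).mul ((contDiffAt_const.mul ((sp s).pow 2)).mul (sc s)))
    (fun s => ((dJ s).mul ((((dp s).pow 2).const_mul 2).mul (dc s))).congr_deriv (by simp; ring))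
    (u.memLp_laplacian.integrable_inner_two u.memLp_radial)
    (fun t => (mea t).1.mul ((((mea t).2.1.pow_const 2).const_mul 2).mul (mea t).2.2.2))
  have t4 := leib (C := fun t s => jac m h t s * a h t s ^ 2) (C' := fun s => 0)
    (fun s => (sJ s).mul ((sa s).pow 2))
    (fun s => ((dJ s).mul ((da s).pow 2)).congr_deriv (by simp))
    (u.memLp_radialTwo.integrable_inner_two u.memLp_radialTwo)
    (fun t => (mea t).1.mul ((mea t).2.2.1.pow_const 2))
  have t5 := leib (C := fun t s => jac m h t s * (2 * a h t s * c m h t s)) (C' := fun s => 0)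
    (fun s => (sJ s).mul ((contDiffAt_const.mul (sa s)).mul (sc s)))
    (fun s => ((dJ s).mul (((da s).const_mul 2).mul (dc s))).congr_deriv (by simp))
    (u.memLp_radialTwo.integrable_inner_two u.memLp_radial)
    (fun t => (mea t).1.mul (((mea t).2.2.1.const_mul 2).mul (mea t).2.2.2))
  have t6 := leib (C := fun t s => jac m h t s * c m h t s ^ 2) (C' := fun s => 0)
    (fun s => (sJ s).mul ((sc s).pow 2))
    (fun s => ((dJ s).mul ((dc s).pow 2)).congr_deriv (by simp))
    (u.memLp_radial.integrable_inner_two u.memLp_radial)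
    (fun t => (mea t).1.mul ((mea t).2.2.2.pow_const 2))
  -- The ε-term has the radial ratio as a second parameter, which stays in `[0, R²]`. At `t = 0` the
  -- radicand is 1, so the square root is smooth near it.
  have t7 := hasDerivAt_integral_of_contDiffAt (μ := μ) (Z := ℝ × ℝ)
    (K := Icc 0 (R ^ 2) ×ˢ Icc 0 (R ^ 2)) (isCompact_Icc.prod isCompact_Icc)
    (C := fun t z => jac m h t z.1 * (ε * √(p h t z.1 ^ 2 + a h t z.1 * z.2) ^ (m + 1)))
    (C' := fun z => ε * (-h z.1 + 2 * z.1 * deriv h z.1 - 2 * (m + 1) * deriv h z.1 * z.2))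
    (fun z _ => by
      have T : ContDiffAt ℝ 1 (fun w : ℝ × ℝ × ℝ => w.1) (0, z) := contDiffAt_fst
      have S : ContDiffAt ℝ 1 (fun w : ℝ × ℝ × ℝ => w.2.1) (0, z) :=
        contDiff_snd.fst.contDiffAt
      have κ : ContDiffAt ℝ 1 (fun w : ℝ × ℝ × ℝ => w.2.2) (0, z) :=
        contDiff_snd.snd.contDiffAt
      refine (contDiffAt_jac m hh T S rfl).mul (contDiffAt_const.mul (ContDiffAt.pow
        (ContDiffAt.sqrt (((contDiffAt_p hh T S rfl).pow 2).add
          ((contDiffAt_a hh T S rfl).mul κ)) ?_) _))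
      simp)
    (fun z _ => by
      have e := (((dp z.1).pow 2).add ((da z.1).mul_const z.2)).sqrt (by simp)
      refine ((dJ z.1).mul ((e.pow (m + 1)).const_mul ε)).congr_deriv ?_
      simp
      ring)
    (z := fun y => (‖y‖ ^ 2, u.radialRatio y))
    (by
      filter_upwards [hz] with y hy
      exact ⟨hy, u.radialRatio_nonneg y, (u.radialRatio_le y).trans hy.2⟩)
    u.integrable_gradNorm_pow
    (fun t => by
      have hn : Measurable fun y : EuclideanSpace ℝ (Fin m) => ‖y‖ ^ 2 := by fun_prop
      have hr := u.aestronglyMeasurable_radialRatio.aemeasurable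
      exact (((mea t).1.comp hn).aemeasurable.mul (((((((mea t).2.1.comp hn).pow_const 2).aemeasurable).add
        (((mea t).2.2.1.comp hn).aemeasurable.mul hr)).sqrt.pow_const _).const_mul ε)).aestronglyMeasurable)
  let Φ : ℝ → ℝ := fun t => ∫ y, jac m h t (‖y‖ ^ 2) *
      (‖p h t (‖y‖ ^ 2) ^ 2 • u.laplacian y + a h t (‖y‖ ^ 2) • u.radialTwo y
        + c m h t (‖y‖ ^ 2) • u.radial y‖ ^ 2
        + ε * (√(p h t (‖y‖ ^ 2) ^ 2 + a h t (‖y‖ ^ 2) * u.radialRatio y) ^ (m + 1)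
          * u.gradNorm y ^ (m + 1))) ∂μ
  have hΦ0 : Φ 0 = u.energy ε R := by
    simp only [Φ, jac_zero, p_zero, a_zero, c_zero, energy, energyDensity]
    simp [μ]
  -- For small `t` the value `Φ t` is the energy of the competitor defined by the diffeomorphism
  -- with `l = 1 + t h`.
  have hmin : IsLocalMin Φ 0 := by
    filter_upwards [Metric.ball_mem_nhds (0 : ℝ) ht₀] with t ht
    obtain ⟨D, hDl⟩ := hD t (by simpa using ht)
    rw [hΦ0]
    refine (hu _ (u.sameBoundaryData_pull D hR)).trans_eq ?_
    rw [energy_pull]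
    simp only [Φ, μ, jac_eq _ hDl hh, p_eq _ hDl, a_eq _ hDl hh, c_eq _ hDl hh]
  have hder := (((((t1.1.add t2.1).add t3.1).add t4.1).add t5.1).add t6.1).add t7.1
  have hΦ := hder.congr_of_eventuallyEq (f₁ := Φ) (by
    filter_upwards [t1.2.1, t2.2.1, t3.2.1, t4.2.1, t5.2.1, t6.2.1, t7.2.1] with
      t i1 i2 i3 i4 i5 i6 i7
    have := ((integral_add (((((i1.add i2).add i3).add i4).add i5).add i6) i7).trans
      (congrArg₂ _ ((integral_add ((((i1.add i2).add i3).add i4).add i5) i6).trans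
      (congrArg₂ _ ((integral_add (((i1.add i2).add i3).add i4) i5).trans
      (congrArg₂ _ ((integral_add ((i1.add i2).add i3) i4).trans
      (congrArg₂ _ ((integral_add (i1.add i2) i3).trans
      (congrArg₂ _ (integral_add i1 i2) rfl)) rfl)) rfl)) rfl)) rfl))
    refine Eq.trans ?_ this
    refine integral_congr_ae (Eventually.of_forall fun y => ?_)
    change (_ : ℝ) = _ + _ + _ + _ + _ + _ + _
    beta_reduce
    rw [norm_smul_add_smul_add_smul_sq]
    ring)
  have key := hmin.hasDerivAt_eq_zero hΦ
  have := ((integral_add (((((t1.2.2.add t2.2.2).add t3.2.2).add t4.2.2).add t5.2.2).add t6.2.2) t7.2.2).trans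
      (congrArg₂ _ ((integral_add ((((t1.2.2.add t2.2.2).add t3.2.2).add t4.2.2).add t5.2.2) t6.2.2).trans
      (congrArg₂ _ ((integral_add (((t1.2.2.add t2.2.2).add t3.2.2).add t4.2.2) t5.2.2).trans
      (congrArg₂ _ ((integral_add ((t1.2.2.add t2.2.2).add t3.2.2) t4.2.2).trans
      (congrArg₂ _ ((integral_add (t1.2.2.add t2.2.2) t3.2.2).trans
      (congrArg₂ _ (integral_add t1.2.2 t2.2.2) rfl)) rfl)) rfl)) rfl)) rfl))
  rw [← key]
  refine Eq.trans ?_ this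
  refine integral_congr_ae (Eventually.of_forall fun y => ?_)
  simp only [Pi.add_apply, real_inner_self_eq_norm_sq]
  rw [← u.radialRatio_mul_pow hm]
  ring

end

end SobolevSphereMap

/-! ### One-variable analysis: primitives and the lemma of du Bois-Reymond. -/

/-- Integration by parts of a smooth function against a primitive. -/
theorem integral_deriv_mul_add_mul_of_primitive {a b : ℝ} {g f F : ℝ → ℝ}
    (hg : ∀ x ∈ uIcc a b, ContDiffAt ℝ 1 g x) (hf : IntervalIntegrable f volume a b)
    (hF : ∀ x ∈ uIcc a b, F x = F a + ∫ t in a..x, f t) :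
    ∫ x in a..b, (deriv g x * F x + g x * f x) = g b * F b - g a * F a := by
  have hgac : AbsolutelyContinuousOnInterval g a b :=
    ContDiffOn.absolutelyContinuousOnInterval fun x hx => (hg x hx).contDiffWithinAt
  have hcac : AbsolutelyContinuousOnInterval (fun _ : ℝ => F a) a b :=
    ContDiffOn.absolutelyContinuousOnInterval contDiffOn_const
  have hFac := hcac.add (hf.absolutelyContinuousOnInterval_intervalIntegral (c := a) (by simp))
  have key := hgac.integral_deriv_mul_eq_sub hFac
  have e : ∀ x ∈ uIcc a b, ((fun _ : ℝ => F a) + fun x => ∫ t in a..x, f t) x = F x :=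
    fun x hx => (hF x hx).symm
  rw [e a (by simp), e b (by simp)] at key
  rw [← key]
  refine intervalIntegral.integral_congr_ae ?_
  filter_upwards [hf.ae_hasDerivAt_integral] with x hx hxm
  have hxm := uIoc_subset_uIcc hxm
  have hd : HasDerivAt ((fun _ : ℝ => F a) + fun x => ∫ t in a..x, f t) (f x) x :=
    (hx hxm a (by simp)).const_add (F a)
  rw [e x hxm, hd.deriv]

theorem IsCompact.exists_subset_Ioo {α β : ℝ} {K : Set ℝ} (hK : IsCompact K) (hne : K.Nonempty)
    (h : K ⊆ Ioo α β) : ∃ a b, α < a ∧ b < β ∧ K ⊆ Ioo a b := by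
  obtain ⟨x, hx, hxl⟩ := hK.exists_isLeast hne
  obtain ⟨y, hy, hyg⟩ := hK.exists_isGreatest hne
  have h1 := h hx
  have h2 := h hy
  refine ⟨(α + x) / 2, (y + β) / 2, by linarith [h1.1], by linarith [h2.2], fun z hz => ⟨?_, ?_⟩⟩
  · linarith [h1.1, hxl hz]
  · linarith [h2.2, hyg hz]

theorem MeasureTheory.LocallyIntegrableOn.intervalIntegrable_of_mem_Ioo {α β x y : ℝ} {f : ℝ → ℝ}
    (hf : LocallyIntegrableOn f (Ioo α β)) (hx : x ∈ Ioo α β) (hy : y ∈ Ioo α β) :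
    IntervalIntegrable f volume x y :=
  (hf.integrableOn_compact_subset (ordConnected_Ioo.uIcc_subset hx hy)
    isCompact_uIcc).intervalIntegrable

theorem MeasureTheory.LocallyIntegrableOn.continuousOn_primitive_Ioo {α β c : ℝ} {f : ℝ → ℝ}
    (hf : LocallyIntegrableOn f (Ioo α β)) (hc : c ∈ Ioo α β) :
    ContinuousOn (fun x => ∫ t in c..x, f t) (Ioo α β) := by
  intro x hx
  obtain ⟨a, b, ha, hb, hab⟩ := (isCompact_uIcc (a := c) (b := x)).exists_subset_Ioo
    nonempty_uIcc (ordConnected_Ioo.uIcc_subset hc hx)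
  have hca := hab (left_mem_uIcc)
  have hxa := hab (right_mem_uIcc)
  have hlt : a < b := hca.1.trans hca.2
  have ha' : a ∈ Ioo α β := ⟨ha, hlt.trans hb⟩
  have hb' : b ∈ Ioo α β := ⟨ha.trans hlt, hb⟩
  have := intervalIntegral.continuousOn_primitive_interval'
    (hf.intervalIntegrable_of_mem_Ioo ha' hb') (a := c)
    (by rw [uIcc_of_le hlt.le]; exact Ioo_subset_Icc_self hca)
  rw [uIcc_of_le hlt.le] at this
  exact (this.continuousAt (Icc_mem_nhds hxa.1 hxa.2)).continuousWithinAt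

/-- A function whose distributional derivative is locally integrable is almost everywhere equal to a
primitive of its derivative. -/
theorem exists_ae_eq_add_integral_of_forall_integral_eq_zero {α β c : ℝ} (hc : c ∈ Ioo α β)
    {b q : ℝ → ℝ} (hb : LocallyIntegrableOn b (Ioo α β)) (hq : LocallyIntegrableOn q (Ioo α β))
    (h : ∀ ζ : ℝ → ℝ, ContDiff ℝ ∞ ζ → HasCompactSupport ζ → tsupport ζ ⊆ Ioo α β →
      ∫ x, (ζ x * q x + deriv ζ x * b x) = 0) :
    ∃ C, ∀ᵐ x, x ∈ Ioo α β → b x = C + ∫ t in c..x, q t := by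
  set Q : ℝ → ℝ := fun x => ∫ t in c..x, q t with hQdef
  have hQc : ContinuousOn Q (Ioo α β) := hq.continuousOn_primitive_Ioo hc
  have hQ : LocallyIntegrableOn Q (Ioo α β) := hQc.locallyIntegrableOn measurableSet_Ioo
  have hbQ : LocallyIntegrableOn (fun x => b x - Q x) (Ioo α β) := hb.sub hQ
  -- Integration by parts for the primitive `Q` of `q` shows that `b - Q` has distributional
  -- derivative zero; it remains to see that such a function is constant.
  have step : ∀ ζ : ℝ → ℝ, ContDiff ℝ ∞ ζ → HasCompactSupport ζ → tsupport ζ ⊆ Ioo α β →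
      ∫ x, deriv ζ x * (b x - Q x) = 0 := by
    intro ζ hζ hζc hζs
    obtain ⟨x₁, x₂, h1, h2, h12⟩ := (hζc.isCompact.union (isCompact_singleton (x := c))).exists_subset_Ioo
      ⟨c, by simp⟩ (union_subset hζs (by simpa using hc))
    have hcx : c ∈ Ioo x₁ x₂ := h12 (by simp)
    have hlt := hcx.1.trans hcx.2
    have hx₁ : x₁ ∈ Ioo α β := ⟨h1, hlt.trans h2⟩
    have hx₂ : x₂ ∈ Ioo α β := ⟨h1.trans hlt, h2⟩
    have hsup : ∀ {f : ℝ → ℝ}, (∀ x, x ∉ tsupport ζ → f x = 0) →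
        ∫ x in x₁..x₂, f x = ∫ x, f x := fun {f} hf =>
      intervalIntegral.integral_eq_integral_of_support_subset fun x hx => by
        have : x ∈ tsupport ζ := by
          by_contra hn
          exact hx (hf x hn)
        exact Ioo_subset_Ioc_self (h12 (Or.inl this))
    have z0 : ∀ x, x ∉ tsupport ζ → ζ x = 0 := fun x hx => image_eq_zero_of_notMem_tsupport hx
    have z1 : ∀ x, x ∉ tsupport ζ → deriv ζ x = 0 := fun x hx =>
      image_eq_zero_of_notMem_tsupport fun hx' => hx (tsupport_deriv_subset hx')
    have hζ' := hζ.continuous_deriv (by simp)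
    have iq := hq.intervalIntegrable_of_mem_Ioo hx₁ hx₂
    have ib := hb.intervalIntegrable_of_mem_Ioo hx₁ hx₂
    have iQ := hQ.intervalIntegrable_of_mem_Ioo hx₁ hx₂
    have parts := integral_deriv_mul_add_mul_of_primitive (g := ζ) (F := Q) (a := x₁) (b := x₂)
      (fun x _ => (hζ.of_le (by exact_mod_cast le_top)).contDiffAt) iq (fun x hx => by
        have hx' : x ∈ Ioo α β := ordConnected_Ioo.uIcc_subset hx₁ hx₂ hx
        exact (intervalIntegral.integral_add_adjacent_intervals
          (hq.intervalIntegrable_of_mem_Ioo hc hx₁) (hq.intervalIntegrable_of_mem_Ioo hx₁ hx')).symm)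
    rw [z0 x₁ fun hx => lt_irrefl _ (h12 (Or.inl hx)).1,
      z0 x₂ fun hx => lt_irrefl _ (h12 (Or.inl hx)).2] at parts
    have hz := h ζ hζ hζc hζs
    rw [← hsup fun x hx => by rw [z0 x hx, z1 x hx]; ring] at hz
    rw [← hsup fun x hx => by rw [z1 x hx]; ring]
    · have j1 : IntervalIntegrable (fun x => ζ x * q x + deriv ζ x * b x) volume x₁ x₂ :=
        (iq.continuousOn_mul hζ.continuous.continuousOn).add
          (ib.continuousOn_mul hζ'.continuousOn)
      have j2 : IntervalIntegrable (fun x => deriv ζ x * Q x + ζ x * q x) volume x₁ x₂ :=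
        (iQ.continuousOn_mul hζ'.continuousOn).add
          (iq.continuousOn_mul hζ.continuous.continuousOn)
      have := intervalIntegral.integral_sub j1 j2
      rw [hz, parts] at this
      rw [← sub_zero (0 : ℝ), ← zero_mul (Q x₁), ← sub_self (0 * Q x₂)]
      convert this using 1
      · refine intervalIntegral.integral_congr fun x _ => ?_
        ring
      · ring
  -- The radii are fractions of the distance from `c` to the endpoints, which keeps the support
  -- inside the open interval.
  let ψ : ContDiffBump c := ⟨min (c - α) (β - c) / 3, min (c - α) (β - c) / 2, by
    have : 0 < min (c - α) (β - c) := lt_min (by linarith [hc.1]) (by linarith [hc.2])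
    positivity, by
    have : 0 < min (c - α) (β - c) := lt_min (by linarith [hc.1]) (by linarith [hc.2])
    linarith⟩
  set p : ℝ → ℝ := ψ.normed volume with hp
  have hpc : ContDiff ℝ ∞ p := ψ.contDiff_normed
  have hpcs : HasCompactSupport p := ψ.hasCompactSupport_normed
  have hps : tsupport p ⊆ Ioo α β := by
    rw [hp, ψ.tsupport_normed_eq, Real.closedBall_eq_Icc]
    have : 0 < min (c - α) (β - c) := lt_min (by linarith [hc.1]) (by linarith [hc.2])
    have h1 := min_le_left (c - α) (β - c)
    have h2 := min_le_right (c - α) (β - c)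
    refine fun x hx => ⟨?_, ?_⟩
    · have : c - min (c - α) (β - c) / 2 ≤ x := hx.1
      linarith
    · have : x ≤ c + min (c - α) (β - c) / 2 := hx.2
      linarith
  have hp1 : ∫ x, p x = 1 := ψ.integral_normed
  refine ⟨∫ x, p x * (b x - Q x), ?_⟩
  set C := ∫ x, p x * (b x - Q x) with hC
  have hint : ∀ φ : ℝ → ℝ, ContDiff ℝ ∞ φ → HasCompactSupport φ → tsupport φ ⊆ Ioo α β →
      Integrable fun x => φ x * (b x - Q x) := fun φ hφ hφc hφs =>
    IntegrableOn.integrable_of_forall_notMem_eq_zero (s := Ioo α β)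
      (integrable_smul_of_tsupport_subset measurableSet_Ioo hφ.continuous hφc hφs hbQ)
      fun x hx => by rw [image_eq_zero_of_notMem_tsupport fun h => hx (hφs h), zero_mul]
  have := isOpen_Ioo.ae_eq_zero_of_integral_contDiff_smul_eq_zero (μ := volume)
    (f := fun x => b x - Q x - C) (U := Ioo α β)
    (hbQ.sub (continuousOn_const.locallyIntegrableOn measurableSet_Ioo)) ?_
  · filter_upwards [this] with x hx hxm
    linarith [hx hxm]
  intro φ hφ hφc hφs
  set k := ∫ x, φ x with hk
  -- Subtracting `k p`, where `p` has integral 1, leaves a function of integral zero. Its primitive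
  -- has compact support and is therefore an admissible test function in `step`.
  let θ : ℝ → ℝ := fun x => φ x - k * p x
  have hθ : ContDiff ℝ ∞ θ := hφ.sub (contDiff_const.mul hpc)
  have iφ : Integrable φ := hφ.continuous.integrable_of_hasCompactSupport hφc
  have ip : Integrable p := hpc.continuous.integrable_of_hasCompactSupport hpcs
  obtain ⟨x₁, x₂, h1, h2, h12⟩ := ((hφc.isCompact.union hpcs.isCompact).union
    (isCompact_singleton (x := c))).exists_subset_Ioo
      ⟨c, by simp⟩ (union_subset (union_subset hφs hps) (by simpa using hc))
  have hθ0 : ∀ x, x ∉ Ioo x₁ x₂ → θ x = 0 := fun x hx => by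
    have e1 : φ x = 0 := image_eq_zero_of_notMem_tsupport fun h => hx (h12 (Or.inl (Or.inl h)))
    have e2 : p x = 0 := image_eq_zero_of_notMem_tsupport fun h => hx (h12 (Or.inl (Or.inr h)))
    simp [θ, e1, e2]
  have hθi : ∫ x, θ x = 0 := by
    rw [integral_sub iφ (ip.const_mul k), integral_const_mul, hp1, mul_one, sub_self]
  let ζ : ℝ → ℝ := fun x => ∫ t in x₁..x, θ t
  have hζd : ∀ x, HasDerivAt ζ (θ x) x := fun x =>
    intervalIntegral.integral_hasDerivAt_right (hθ.continuous.intervalIntegrable _ _)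
      hθ.continuous.aestronglyMeasurable.stronglyMeasurableAtFilter hθ.continuous.continuousAt
  have hζ' : deriv ζ = θ := funext fun x => (hζd x).deriv
  have hζ : ContDiff ℝ ∞ ζ := contDiff_infty_iff_deriv.2
    ⟨fun x => (hζd x).differentiableAt, by rw [hζ']; exact hθ⟩
  have hζ0 : ∀ x, x ∉ Icc x₁ x₂ → ζ x = 0 := by
    intro x hx
    by_cases hx1 : x < x₁
    · refine intervalIntegral.integral_zero_ae (Eventually.of_forall fun t ht => hθ0 t fun ht' => ?_)
      rw [uIoc_of_ge hx1.le] at ht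
      exact absurd ht.2 (not_le.2 ht'.1)
    · have hx2 : x₂ < x := by
        by_contra hn
        exact hx ⟨not_lt.1 hx1, not_lt.1 hn⟩
      rw [← hθi]
      refine intervalIntegral.integral_eq_integral_of_support_subset fun t ht => ?_
      have : t ∈ Ioo x₁ x₂ := by
        by_contra hn
        exact ht (hθ0 t hn)
      exact ⟨this.1, (this.2.trans hx2).le⟩
  have hζs : tsupport ζ ⊆ Icc x₁ x₂ := closure_minimal (fun x hx => by
    by_contra hn
    exact hx (hζ0 x hn)) isClosed_Icc
  have hsub : Icc x₁ x₂ ⊆ Ioo α β := fun x hx => ⟨h1.trans_le hx.1, hx.2.trans_lt h2⟩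
  have key := step ζ hζ (HasCompactSupport.of_support_subset_isCompact isCompact_Icc
    (subset_closure.trans hζs)) (hζs.trans hsub)
  rw [hζ'] at key
  have e : ∀ x, φ x • (b x - Q x - C) = θ x * (b x - Q x) + k * (p x * (b x - Q x)) - C * φ x := by
    intro x
    simp only [θ, smul_eq_mul]
    ring
  have iθ : Integrable fun x => θ x * (b x - Q x) := by
    have := (hint φ hφ hφc hφs).sub ((hint p hpc hpcs hps).const_mul k)
    refine this.congr (Eventually.of_forall fun x => ?_)
    simp only [θ, Pi.sub_apply]
    ring
  simp only [e]
  have iθp : Integrable fun x => θ x * (b x - Q x) + k * (p x * (b x - Q x)) :=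
    iθ.add ((hint p hpc hpcs hps).const_mul k)
  rw [integral_sub iθp (iφ.const_mul C),
    integral_add iθ ((hint p hpc hpcs hps).const_mul k), key, integral_const_mul,
    integral_const_mul, ← hC, ← hk]
  ring

/-! ### Polar coordinates. -/

noncomputable section

variable {m : ℕ}

/-- The integral of `f` over the sphere of radius `τ`. -/
def sphericalIntegral (f : EuclideanSpace ℝ (Fin m) → ℝ) (τ : ℝ) : ℝ :=
  τ ^ (m - 1) * ∫ y : sphere (0 : EuclideanSpace ℝ (Fin m)) 1,
    f (τ • (y : EuclideanSpace ℝ (Fin m))) ∂volume.toSphere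

theorem norm_smul_sphere {τ : ℝ} (hτ : 0 ≤ τ) (y : sphere (0 : EuclideanSpace ℝ (Fin m)) 1) :
    ‖τ • (y : EuclideanSpace ℝ (Fin m))‖ = τ := by
  rw [norm_smul, Real.norm_of_nonneg hτ, norm_eq_of_mem_sphere, mul_one]

theorem sphericalIntegral_norm_mul (g : ℝ → ℝ) (f : EuclideanSpace ℝ (Fin m) → ℝ) {τ : ℝ}
    (hτ : 0 ≤ τ) :
    sphericalIntegral (fun x => g ‖x‖ * f x) τ = g τ * sphericalIntegral f τ := by
  unfold sphericalIntegral
  simp only [norm_smul_sphere hτ, integral_const_mul]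
  ring

/-- Integration in polar coordinates. -/
theorem MeasureTheory.Integrable.sphericalIntegral (hm : 1 ≤ m)
    {f : EuclideanSpace ℝ (Fin m) → ℝ} (hf : Integrable f) :
    (∀ᵐ τ ∂(volume.restrict (Ioi (0 : ℝ))),
      Integrable (fun y : sphere (0 : EuclideanSpace ℝ (Fin m)) 1 =>
        f (τ • (y : EuclideanSpace ℝ (Fin m)))) volume.toSphere) ∧
    IntegrableOn (_root_.sphericalIntegral f) (Ioi 0) ∧
    ∫ τ in Ioi (0 : ℝ), _root_.sphericalIntegral f τ = ∫ x, f x := by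
  have : Nonempty (Fin m) := ⟨⟨0, hm⟩⟩
  have hdim : Module.finrank ℝ (EuclideanSpace ℝ (Fin m)) = m := by simp
  let E := EuclideanSpace ℝ (Fin m)
  let G : sphere (0 : E) 1 × Ioi (0 : ℝ) → ℝ := fun w => f ((w.2 : ℝ) • (w.1 : E))
  have hG : ∀ x : ({(0)}ᶜ : Set E), G (homeomorphUnitSphereProd E x) = f x := fun x => by
    have := congrArg Subtype.val ((homeomorphUnitSphereProd E).symm_apply_apply x)
    simp only [homeomorphUnitSphereProd_symm_apply_coe] at this
    exact congrArg f this
  -- Outside the origin, Lebesgue measure is the product of the sphere measure and the measure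
  -- `r^{m-1} dr`. Fubini is applied to this product, and the density then becomes the prefactor of
  -- the spherical integral.
  have mp := (volume : Measure E).measurePreserving_homeomorphUnitSphereProd
  have emb := (homeomorphUnitSphereProd E).measurableEmbedding
  have h1 : Integrable (fun x : ({(0)}ᶜ : Set E) => f x) ((volume : Measure E).comap (↑)) := by
    have := (integrableOn_iff_comap_subtypeVal (μ := volume)
      (measurableSet_singleton (0 : E)).compl).1 hf.integrableOn
    exact this
  have hGi : Integrable G ((volume : Measure E).toSphere.prod
      (Measure.volumeIoiPow (Module.finrank ℝ E - 1))) := by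
    rw [← mp.integrable_comp_emb emb]
    exact h1.congr (Eventually.of_forall fun x => (hG x).symm)
  have hGint : ∫ w, G w ∂((volume : Measure E).toSphere.prod
      (Measure.volumeIoiPow (Module.finrank ℝ E - 1))) = ∫ x, f x := by
    rw [← mp.integral_comp emb]
    simp only [hG]
    rw [integral_subtype_comap (measurableSet_singleton _).compl fun x => f x,
      restrict_compl_singleton]
  have hdens : Measurable fun r : Ioi (0 : ℝ) => ENNReal.ofReal (r.1 ^ (Module.finrank ℝ E - 1)) := by
    fun_prop
  have hsm : ∀ r : Ioi (0 : ℝ), (ENNReal.ofReal (r.1 ^ (Module.finrank ℝ E - 1))).toReal •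
      (∫ y, G (y, r) ∂(volume : Measure E).toSphere) = _root_.sphericalIntegral f r := fun r => by
    rw [ENNReal.toReal_ofReal (pow_nonneg r.2.out.le _), hdim]
    rfl
  have hright := hGi.integral_prod_right
  rw [Measure.volumeIoiPow, integrable_withDensity_iff_integrable_smul' hdens
    (Eventually.of_forall fun _ => ENNReal.ofReal_lt_top)] at hright
  simp only [hsm] at hright
  refine ⟨?_, (integrableOn_iff_comap_subtypeVal measurableSet_Ioi).2 hright, ?_⟩
  · have h2 := hGi.prod_left_ae
    rw [Measure.volumeIoiPow, ae_withDensity_iff hdens] at h2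
    rw [ae_restrict_iff_subtype measurableSet_Ioi]
    filter_upwards [h2] with r hr
    exact hr (by simpa using pow_pos r.2.out _)
  · rw [← hGint, integral_prod_symm _ hGi]
    conv_rhs => rw [Measure.volumeIoiPow]
    rw [integral_withDensity_eq_integral_toReal_smul hdens
      (Eventually.of_forall fun _ => ENNReal.ofReal_lt_top)]
    simp only [hsm]
    rw [integral_subtype_comap measurableSet_Ioi fun r => _root_.sphericalIntegral f r]

/-- Integration over a shell in polar coordinates. -/
theorem MeasureTheory.IntegrableOn.sphericalIntegral (hm : 1 ≤ m) {ρ r : ℝ} (hρ : 0 ≤ ρ)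
    {f : EuclideanSpace ℝ (Fin m) → ℝ} (hf : IntegrableOn f (ball 0 r \ ball 0 ρ)) :
    (∀ᵐ τ ∂(volume.restrict (Ioo ρ r)),
      Integrable (fun y : sphere (0 : EuclideanSpace ℝ (Fin m)) 1 =>
        f (τ • (y : EuclideanSpace ℝ (Fin m)))) volume.toSphere) ∧
    IntegrableOn (_root_.sphericalIntegral f) (Ioo ρ r) ∧
    ∫ τ in Ioo ρ r, _root_.sphericalIntegral f τ = ∫ x in ball 0 r \ ball 0 ρ, f x := by
  have hms : MeasurableSet (ball (0 : EuclideanSpace ℝ (Fin m)) r \ ball 0 ρ) :=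
    measurableSet_ball.diff measurableSet_ball
  have mem : ∀ {τ : ℝ} (_ : 0 ≤ τ) (y : sphere (0 : EuclideanSpace ℝ (Fin m)) 1),
      τ • (y : EuclideanSpace ℝ (Fin m)) ∈ ball (0 : EuclideanSpace ℝ (Fin m)) r \ ball 0 ρ ↔
        τ ∈ Ico ρ r := fun hτ y => by
    rw [Set.mem_sdiff, mem_ball_zero_iff, mem_ball_zero_iff, norm_smul_sphere hτ, not_lt, mem_Ico,
      and_comm]
  obtain ⟨h1, h2, h3⟩ := ((integrable_indicator_iff hms).2 hf).sphericalIntegral hm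
  have hsub : Ioo ρ r ⊆ Ioi 0 := fun τ hτ => hρ.trans_lt hτ.1
  have e : ∀ τ ∈ Ioi (0 : ℝ), _root_.sphericalIntegral
      ((ball (0 : EuclideanSpace ℝ (Fin m)) r \ ball 0 ρ).indicator f) τ
      = (Ico ρ r).indicator (_root_.sphericalIntegral f) τ := by
    intro τ hτ
    by_cases h : τ ∈ Ico ρ r
    · rw [indicator_of_mem h]
      simp only [_root_.sphericalIntegral, indicator_of_mem ((mem (le_of_lt hτ) _).2 h)]
    · rw [indicator_of_notMem h]
      simp only [_root_.sphericalIntegral,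
        indicator_of_notMem fun h' => h ((mem (le_of_lt hτ) _).1 h')]
      simp
  refine ⟨?_, ?_, ?_⟩
  · filter_upwards [ae_restrict_of_ae_restrict_of_subset hsub h1,
      ae_restrict_mem measurableSet_Ioo] with τ hτ hτm
    simpa only [indicator_of_mem ((mem (hρ.trans hτm.1.le) _).2 (Ioo_subset_Ico_self hτm))] using hτ
  · refine (h2.mono_set hsub).congr_fun (fun τ hτ => ?_) measurableSet_Ioo
    rw [e τ (hsub hτ), indicator_of_mem (Ioo_subset_Ico_self hτ)]
  · rw [integral_indicator hms] at h3
    rw [← h3, setIntegral_congr_fun measurableSet_Ioi e,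
      setIntegral_congr_set (Ioo_ae_eq_Ico), ← integral_indicator measurableSet_Ico,
      setIntegral_indicator measurableSet_Ico,
      ← integral_indicator (measurableSet_Ioi.inter measurableSet_Ico)]
    refine integral_congr_ae ?_
    filter_upwards [compl_mem_ae_iff.2 (measure_singleton (0 : ℝ))] with τ hτ
    by_cases h : τ ∈ Ico ρ r
    · have : τ ∈ Ioi (0 : ℝ) := lt_of_le_of_ne (hρ.trans h.1) (Ne.symm hτ)
      rw [indicator_of_mem h, indicator_of_mem (show τ ∈ Ioi 0 ∩ Ico ρ r from ⟨this, h⟩)]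
    · rw [indicator_of_notMem h, indicator_of_notMem fun h' : τ ∈ Ioi 0 ∩ Ico ρ r => h h'.2]

end

/-! ### The radial profile belonging to a cut-off. -/

/-- The profile of the radial variation whose radial weight is a given cut-off. -/
theorem exists_radialProfile (m : ℕ) {R : ℝ} {ζ : ℝ → ℝ} (hR : 0 < R) (hζ : ContDiff ℝ ∞ ζ)
    (hζc : HasCompactSupport ζ) (hζs : tsupport ζ ⊆ Ioo 0 R) :
    ∃ h : ℝ → ℝ, ∃ b, ContDiff ℝ ∞ h ∧ HasCompactSupport h ∧ b < R ^ 2 ∧ (∀ s, b ≤ s → h s = 0) ∧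
      (∀ τ, 0 < τ → deriv h (τ ^ 2) = -(1 / 2) * ζ τ * (τ ^ 2 * (τ ^ m)⁻¹)) ∧
      (∀ τ, 0 < τ → deriv (deriv h) (τ ^ 2)
        = -(1 / 4) * deriv ζ τ * (τ * (τ ^ m)⁻¹) + (m - 2) / 4 * ζ τ * (τ ^ m)⁻¹) := by
  -- The point `R / 2` is added only to make the compact set nonempty, in case `ζ` is zero.
  obtain ⟨x₁, x₂, h1, h2, h12⟩ := (hζc.isCompact.union (isCompact_singleton (x := R / 2))).exists_subset_Ioo
      ⟨R / 2, by simp⟩ (union_subset hζs (by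
        rw [singleton_subset_iff]
        exact ⟨by linarith, by linarith⟩))
  have hlt : x₁ < x₂ := by
    have : R / 2 ∈ Ioo x₁ x₂ := h12 (by simp)
    exact this.1.trans this.2
  have hx₂ : 0 < x₂ := h1.trans hlt
  have hζ0 : ∀ τ, τ ≤ x₁ ∨ x₂ ≤ τ → ζ τ = 0 := fun τ hτ =>
    image_eq_zero_of_notMem_tsupport fun h => by
      have := h12 (Or.inl h)
      rcases hτ with hτ | hτ
      · exact absurd this.1 (not_lt.2 hτ)
      · exact absurd this.2 (not_lt.2 hτ)
  -- Thus `k (τ²) = ζ(τ) τ^{2-m}`. The derivative of the profile is `-k/2`, which makes the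
  -- `τ`-derivative of `h (τ²)` equal to `-ζ(τ) τ^{3-m}`.
  let k : ℝ → ℝ := fun s => ζ (√s) * (s * (√s ^ m)⁻¹)
  have hk0 : ∀ s, s ≤ x₁ ^ 2 → k s = 0 := fun s hs => by
    simp only [k]
    rw [hζ0 _ (Or.inl ((Real.sqrt_le_left h1.le).2 hs)), zero_mul]
  have hk1 : ∀ s, x₂ ^ 2 ≤ s → k s = 0 := fun s hs => by
    simp only [k]
    rw [hζ0 _ (Or.inr (Real.le_sqrt_of_sq_le hs)), zero_mul]
  -- The square root is not smooth at 0, but `k` vanishes to the left of `x₁ ^ 2`.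
  have hk : ContDiff ℝ ∞ k := by
    rw [contDiff_iff_contDiffAt]
    intro s
    by_cases hs : s < x₁ ^ 2
    · refine (contDiffAt_const (c := (0 : ℝ))).congr_of_eventuallyEq ?_
      filter_upwards [gt_mem_nhds hs] with t ht using hk0 t ht.le
    · have hs0 : 0 < s := (pow_pos h1 2).trans_le (not_lt.1 hs)
      have hsq : ContDiffAt ℝ ∞ Real.sqrt s := Real.contDiffAt_sqrt hs0.ne'
      exact (hζ.contDiffAt.comp s hsq).mul (contDiffAt_id.mul ((hsq.pow m).inv
        (pow_pos (Real.sqrt_pos.2 hs0) m).ne'))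
  let H : ℝ → ℝ := fun s => -(1 / 2) * ∫ t in (x₂ ^ 2)..s, k t
  have hHd : ∀ s, HasDerivAt H (-(1 / 2) * k s) s := fun s =>
    (intervalIntegral.integral_hasDerivAt_right (hk.continuous.intervalIntegrable _ _)
      hk.continuous.aestronglyMeasurable.stronglyMeasurableAtFilter hk.continuous.continuousAt).const_mul _
  have hH' : deriv H = fun s => -(1 / 2) * k s := funext fun s => (hHd s).deriv
  have hH : ContDiff ℝ ∞ H := contDiff_infty_iff_deriv.2
    ⟨fun x => (hHd x).differentiableAt, by rw [hH']; exact contDiff_const.mul hk⟩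
  have hH0 : ∀ s, x₂ ^ 2 ≤ s → H s = 0 := fun s hs => by
    simp only [H]
    rw [intervalIntegral.integral_zero_ae, mul_zero]
    refine Eventually.of_forall fun t ht => hk1 t ?_
    rw [uIoc_of_le hs] at ht
    exact ht.1.le
  -- To the left of `x₁ ^ 2` the function `H` is constant and in general not zero. The transition
  -- cuts it off between -2 and -1, away from the values of `‖x‖²`, to obtain compact support.
  let h : ℝ → ℝ := fun s => Real.smoothTransition (s + 2) * H s
  have hh : ContDiff ℝ ∞ h :=
    (Real.smoothTransition.contDiff.comp (contDiff_id.add contDiff_const)).mul hH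
  have hhH : ∀ s, -1 < s → h s = H s := fun s hs => by
    simp only [h]
    rw [Real.smoothTransition.one_of_one_le (by linarith), one_mul]
  have hh' : ∀ s, -1 < s → deriv h s = -(1 / 2) * k s := fun s hs => by
    have : h =ᶠ[𝓝 s] H := by filter_upwards [lt_mem_nhds hs] with t ht using hhH t ht
    rw [this.deriv_eq, hH']
  have hd1 : ∀ τ, 0 < τ → deriv h (τ ^ 2) = -(1 / 2) * ζ τ * (τ ^ 2 * (τ ^ m)⁻¹) := fun τ hτ => by
    rw [hh' _ (by nlinarith)]
    simp only [k]
    rw [Real.sqrt_sq hτ.le, mul_assoc]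
  refine ⟨h, x₂ ^ 2, hh, ?_, by gcongr, fun s hs => ?_, hd1, fun τ hτ => ?_⟩
  · refine HasCompactSupport.of_support_subset_isCompact (isCompact_Icc (a := -2) (b := x₂ ^ 2)) ?_
    intro s hs
    by_contra hn
    apply hs
    rw [mem_Icc, not_and_or, not_le, not_le] at hn
    rcases hn with hn | hn
    · simp only [h]
      rw [Real.smoothTransition.zero_of_nonpos (by linarith), zero_mul]
    · simp only [h]
      rw [hH0 s hn.le, mul_zero]
  · simp only [h]
    rw [hH0 s hs, mul_zero]
  · have hh1 : ContDiff ℝ ∞ (deriv h) := by simpa using hh.iterate_deriv 1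
    have e1 : HasDerivAt (fun τ => deriv h (τ ^ 2)) (deriv (deriv h) (τ ^ 2) * (2 * τ)) τ := by
      have e0 : HasDerivAt (fun τ : ℝ => τ ^ 2) (2 * τ) τ := by simpa using hasDerivAt_pow 2 τ
      exact (hh1.differentiable (by simp) (τ ^ 2)).hasDerivAt.comp τ e0
    have e2 : HasDerivAt (fun τ => -(1 / 2) * ζ τ * (τ ^ 2 * (τ ^ m)⁻¹))
        (-(1 / 2) * deriv ζ τ * (τ ^ 2 * (τ ^ m)⁻¹) + -(1 / 2) * ζ τ *
          (2 * τ * (τ ^ m)⁻¹ + τ ^ 2 * (-(m * τ ^ (m - 1)) / (τ ^ m) ^ 2))) τ := by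
      exact (((hζ.differentiable (by simp) τ).hasDerivAt.const_mul (-(1 / 2 : ℝ))).mul
        ((hasDerivAt_pow 2 τ).mul ((hasDerivAt_pow m τ).inv (pow_pos hτ m).ne'))).congr_deriv
        (by simp)
    have e3 := e1.unique (e2.congr_of_eventuallyEq (by
      filter_upwards [lt_mem_nhds hτ] with t ht using hd1 t ht))
    have e4 : (m : ℝ) * τ ^ (m - 1) * τ = m * τ ^ m := by
      rcases m with _ | m
      · simp
      · rw [Nat.add_sub_cancel]; ring
    have e5 : τ * (-(m * τ ^ (m - 1)) / (τ ^ m) ^ 2) = -m * (τ ^ m)⁻¹ := by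
      have := pow_pos hτ m
      field_simp
      linarith
    have hτ' : (2 * τ) ≠ 0 := by positivity
    apply mul_right_cancel₀ hτ'
    rw [e3]
    linear_combination (-(1 / 2) * ζ τ * τ) * e5

theorem MeasureTheory.IntegrableOn.continuous_mul_ball {m : ℕ} {R : ℝ}
    {c f : EuclideanSpace ℝ (Fin m) → ℝ} (hf : IntegrableOn f (ball 0 R)) (hc : Continuous c) :
    IntegrableOn (fun x => c x * f x) (ball 0 R) :=
  memLp_one_iff_integrable.1 (MemLp.continuous_smul_ball hc (memLp_one_iff_integrable.2 hf))

/-! ### From the first variation to the densities of the monotonicity formula. -/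

namespace SobolevSphereMap

variable {m n : ℕ} {R : ℝ} (u : SobolevSphereMap m n R)

theorem sum_inner_grad_radialGrad (x : EuclideanSpace ℝ (Fin m)) :
    ∑ β, inner ℝ (u.grad β x) (u.radialGrad β x) = u.gradNorm x ^ 2 +
      ∑ α, ∑ β, x α * inner ℝ (u.grad β x) (u.hess α β x) := by
  rw [gradNorm_sq, Finset.sum_comm, ← Finset.sum_add_distrib]
  refine Finset.sum_congr rfl fun β _ => ?_
  rw [radialGrad, inner_add_right, real_inner_self_eq_norm_sq, inner_sum]
  simp only [real_inner_smul_right]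

/-- The integer powers are collected into the single factor `(‖x‖ ^ m)⁻¹` used by the radial
profile, leaving a numerator that is integrable up to the origin; the next two lemmas do the same.
-/
theorem bulkDensity_eq {x : EuclideanSpace ℝ (Fin m)} (hx : x ≠ 0) :
    u.bulkDensity x = (‖x‖ ^ m)⁻¹ * (4 * (‖x‖ ^ 2 * ∑ β, ‖u.radialGrad β x‖ ^ 2
      + (m - 2) * ‖u.radial x‖ ^ 2)) := by
  have hr := norm_ne_zero_iff.2 hx
  unfold bulkDensity radialGrad
  rw [zpow_sub₀ hr, zpow_natCast, div_eq_mul_inv, inv_div]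
  norm_cast
  field_simp

theorem bulkDensityEps_eq {x : EuclideanSpace ℝ (Fin m)} (hx : x ≠ 0) :
    u.bulkDensityEps x = (‖x‖ ^ m)⁻¹ * (‖x‖ ^ 2 * (u.gradNorm x ^ (m - 1) * ‖u.radial x‖ ^ 2)) := by
  have hr := norm_ne_zero_iff.2 hx
  unfold bulkDensityEps
  rw [zpow_sub₀ hr, zpow_natCast, div_eq_mul_inv, inv_div]
  norm_cast
  field_simp

/-- Replacing `x^α ⟨u_β, u_{αβ}⟩` by `⟨u_β, u_β + x^α u_{αβ}⟩ - |∇u|²` changes the coefficient -2 of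
`|∇u|²` into -1, so that both quadratic terms have the same weight, as in the kinematic form. -/
theorem boundaryDensity_eq {x : EuclideanSpace ℝ (Fin m)} (hx : x ≠ 0) :
    u.boundaryDensity x = (‖x‖ ^ m)⁻¹ * (2 * (‖x‖ ^ 3 * (-(∑ β, inner ℝ (u.grad β x)
      (u.radialGrad β x)) - u.gradNorm x ^ 2) + 2 * ‖x‖ * ‖u.radial x‖ ^ 2)) := by
  have hr := norm_ne_zero_iff.2 hx
  unfold boundaryDensity
  rw [sum_inner_grad_radialGrad, zpow_sub₀ hr, zpow_sub₀ hr, zpow_natCast, zpow_one,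
    show (3 : ℤ) = (3 : ℕ) by rfl, zpow_natCast]
  field_simp
  ring

theorem kinematicForm_grad (a a' : ℝ) (x : EuclideanSpace ℝ (Fin m)) :
    kinematicForm a a' x (fun i => u.grad i x) (fun i j => u.hess i j x) =
      4 * a * inner ℝ (u.laplacian x) (u.radialTwo x)
    + 2 * (2 * ‖x‖ ^ 2 * a' + m * a) * inner ℝ (u.laplacian x) (u.radial x)
    - 4 * a * ∑ β, ‖u.radialGrad β x‖ ^ 2 + 8 * a' * ‖u.radial x‖ ^ 2
    - (2 * ‖x‖ ^ 2 * a' + (m - 2) * a) *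
      (2 * ∑ β, inner ℝ (u.grad β x) (u.radialGrad β x) + 2 * u.gradNorm x ^ 2) := by
  rw [gradNorm_sq]
  rfl

theorem integrable_radialGrad_sq :
    IntegrableOn (fun x => ∑ β, ‖u.radialGrad β x‖ ^ 2) (ball 0 R) :=
  integrable_finsetSum _ fun β _ => (u.memLp_radialGrad β).integrable_norm_pow (p := 2) (by simp)

theorem integrable_inner_grad_radialGrad :
    IntegrableOn (fun x => ∑ β, inner ℝ (u.grad β x) (u.radialGrad β x)) (ball 0 R) :=
  integrable_finsetSum _ fun β _ => (u.memLp_grad β).integrable_inner_two (u.memLp_radialGrad β)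

theorem integrable_radial_sq : IntegrableOn (fun x => ‖u.radial x‖ ^ 2) (ball 0 R) :=
  u.memLp_radial.integrable_norm_pow (p := 2) (by simp)

theorem integrable_gradNorm_sq : IntegrableOn (fun x => u.gradNorm x ^ 2) (ball 0 R) := by
  simp only [gradNorm_sq]
  exact integrable_finsetSum _ fun β _ => (u.memLp_grad β).integrable_norm_pow (p := 2) (by simp)

theorem integrable_gradNorm_mul_radial_sq (hm : 1 ≤ m) :
    IntegrableOn (fun x => u.gradNorm x ^ (m - 1) * ‖u.radial x‖ ^ 2) (ball 0 R) := by
  simp only [← u.radialRatio_mul_pow hm]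
  refine u.integrable_gradNorm_pow.bdd_mul (c := R ^ 2) u.aestronglyMeasurable_radialRatio ?_
  filter_upwards [ae_restrict_mem measurableSet_ball] with x hx
  rw [mem_ball_zero_iff] at hx
  rw [Real.norm_of_nonneg (u.radialRatio_nonneg x)]
  exact (u.radialRatio_le x).trans (by gcongr)

/-- The first variation of the energy, in terms of the densities of the monotonicity formula. -/
theorem IsMinimizer.integral_densities_eq_zero {u : SobolevSphereMap m n R} {ε : ℝ}
    (hu : u.IsMinimizer ε) (hR : 0 < R) (hm : 1 ≤ m) {ζ : ℝ → ℝ} {h : ℝ → ℝ} {b : ℝ}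
    (hh : ContDiff ℝ ∞ h) (hc : HasCompactSupport h) (hb : b < R ^ 2) (hhb : ∀ s, b ≤ s → h s = 0)
    (h1 : ∀ τ, 0 < τ → deriv h (τ ^ 2) = -(1 / 2) * ζ τ * (τ ^ 2 * (τ ^ m)⁻¹))
    (h2 : ∀ τ, 0 < τ → deriv (deriv h) (τ ^ 2)
        = -(1 / 4) * deriv ζ τ * (τ * (τ ^ m)⁻¹) + (m - 2) / 4 * ζ τ * (τ ^ m)⁻¹) :
    (∫ x in ball 0 R, (((m : ℝ) - 4) * h (‖x‖ ^ 2) * u.energyDensity ε x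
      - ζ ‖x‖ * (‖x‖ ^ 4 * (‖x‖ ^ m)⁻¹) * u.energyDensity ε x
      - ε * (m - 3) * h (‖x‖ ^ 2) * u.gradNorm x ^ (m + 1)
      + ζ ‖x‖ * (u.bulkDensity x + ε * (m + 1) * u.bulkDensityEps x)
      - deriv ζ ‖x‖ * u.boundaryDensity x)) = 0 := by
  have hh1 : ContDiff ℝ ∞ (deriv h) := by simpa using hh.iterate_deriv 1
  have hh2 : ContDiff ℝ ∞ (deriv (deriv h)) := by simpa using hh1.iterate_deriv 1
  have c0 := hh.continuous
  have c1 := hh1.continuous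
  have c2 := hh2.continuous
  have k1 := hu.integral_eq_zero hR hm hh hc hb hhb
  have hda : deriv (fun s => -2 * deriv h s) = fun s => -2 * deriv (deriv h) s := by
    ext s
    exact deriv_const_mul _ (hh1.differentiable (by simp) s)
  -- With the weight `-2 h'` the mixed products with `Δu` agree with those of the first variation,
  -- so they drop out of the difference. The bound is enlarged to `(b + R ^ 2) / 2` because the
  -- vanishing of `h` from `b` on is used to get `h' = 0` strictly beyond `b`.
  have k2 := integral_ball_kinematicForm hR (b := (b + R ^ 2) / 2) (by linarith)
    u.hasWeakPartial_toFun u.hasWeakPartial_grad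
    u.memLp_toFun u.memLp_grad u.memLp_hess (a := fun s => -2 * deriv h s)
    (contDiff_const.mul hh1) hc.deriv.mul_left (fun s hs => by
      rw [deriv_eq_zero_of_forall_ge hhb (by linarith), mul_zero])
  rw [hda] at k2
  simp only [kinematicForm_grad] at k2
  have iLL := u.memLp_laplacian.integrable_norm_pow (p := 2) (by simp)
  have iLD : IntegrableOn (fun x => inner ℝ (u.laplacian x) (u.radialTwo x)) (ball 0 R) :=
    u.memLp_laplacian.integrable_inner_two u.memLp_radialTwo
  have iLX : IntegrableOn (fun x => inner ℝ (u.laplacian x) (u.radial x)) (ball 0 R) :=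
    u.memLp_laplacian.integrable_inner_two u.memLp_radial
  have iGX := u.integrable_gradNorm_mul_radial_sq hm
  have iA : IntegrableOn (fun x => (((m : ℝ) - 4) * h (‖x‖ ^ 2)
        + 2 * ‖x‖ ^ 2 * deriv h (‖x‖ ^ 2)) * ‖u.laplacian x‖ ^ 2
      - 8 * deriv h (‖x‖ ^ 2) * inner ℝ (u.laplacian x) (u.radialTwo x)
      - (4 * m * deriv h (‖x‖ ^ 2) + 8 * ‖x‖ ^ 2 * deriv (deriv h) (‖x‖ ^ 2))
        * inner ℝ (u.laplacian x) (u.radial x)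
      + ε * ((-h (‖x‖ ^ 2) + 2 * ‖x‖ ^ 2 * deriv h (‖x‖ ^ 2)) * u.gradNorm x ^ (m + 1)
        - 2 * (m + 1) * deriv h (‖x‖ ^ 2) * (u.gradNorm x ^ (m - 1) * ‖u.radial x‖ ^ 2)))
      (ball 0 R) :=
    (((IntegrableOn.continuous_mul_ball iLL (by fun_prop)).sub
      (iLD.continuous_mul_ball (by fun_prop))).sub (iLX.continuous_mul_ball (by fun_prop))).add
      (((u.integrable_gradNorm_pow.continuous_mul_ball (by fun_prop)).sub
        (iGX.continuous_mul_ball (by fun_prop))).const_mul ε)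
  have iB : IntegrableOn (fun x => 4 * (-2 * deriv h (‖x‖ ^ 2))
        * inner ℝ (u.laplacian x) (u.radialTwo x)
      + 2 * (2 * ‖x‖ ^ 2 * (-2 * deriv (deriv h) (‖x‖ ^ 2)) + m * (-2 * deriv h (‖x‖ ^ 2)))
        * inner ℝ (u.laplacian x) (u.radial x)
      - 4 * (-2 * deriv h (‖x‖ ^ 2)) * ∑ β, ‖u.radialGrad β x‖ ^ 2
      + 8 * (-2 * deriv (deriv h) (‖x‖ ^ 2)) * ‖u.radial x‖ ^ 2
      - (2 * ‖x‖ ^ 2 * (-2 * deriv (deriv h) (‖x‖ ^ 2)) + (m - 2) * (-2 * deriv h (‖x‖ ^ 2))) *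
        (2 * ∑ β, inner ℝ (u.grad β x) (u.radialGrad β x) + 2 * u.gradNorm x ^ 2)) (ball 0 R) :=
    ((((iLD.continuous_mul_ball (by fun_prop)).add (iLX.continuous_mul_ball (by fun_prop))).sub
      (u.integrable_radialGrad_sq.continuous_mul_ball (by fun_prop))).add
      (u.integrable_radial_sq.continuous_mul_ball (by fun_prop))).sub
      (IntegrableOn.continuous_mul_ball ((u.integrable_inner_grad_radialGrad.const_mul 2).add
        (u.integrable_gradNorm_sq.const_mul 2)) (by fun_prop))
  have key := integral_sub iA iB
  rw [k1, k2, sub_zero] at key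
  rw [← key]
  refine integral_congr_ae ?_
  have : Nonempty (Fin m) := ⟨⟨0, hm⟩⟩
  filter_upwards [ae_restrict_of_ae (compl_mem_ae_iff.2
    (measure_singleton (0 : EuclideanSpace ℝ (Fin m))))] with x hx
  have hx0 : x ≠ 0 := hx
  have hr : 0 < ‖x‖ := norm_pos_iff.2 hx0
  -- For these values of `h'` and `h''` the factor `2 s a' + (m - 2) a` with `a = -2 h'` reduces to
  -- `ζ' |x|^{3-m}`: its terms in `ζ` cancel. The term `16 h'' |x^α u_α|²` contributes to P through
  -- `ζ` and to the boundary density through `ζ'`.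
  have e1 := h1 _ hr
  have e2 := h2 _ hr
  rw [u.bulkDensity_eq hx0, u.bulkDensityEps_eq hx0, u.boundaryDensity_eq hx0, energyDensity, e1, e2]
  ring

end SobolevSphereMap

/-! ### Integrals over balls and shells as integrals over the radius. -/

section Radial

variable {m : ℕ} {R : ℝ} {f : EuclideanSpace ℝ (Fin m) → ℝ}

theorem ball_diff_ball_zero (r : ℝ) :
    ball (0 : EuclideanSpace ℝ (Fin m)) r \ ball 0 0 = ball 0 r := by simp

theorem intervalIntegrable_sphericalIntegral (hm : 1 ≤ m) (hR : 0 ≤ R)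
    (hf : IntegrableOn f (ball 0 R)) : IntervalIntegrable (sphericalIntegral f) volume 0 R := by
  rw [← ball_diff_ball_zero] at hf
  rw [intervalIntegrable_iff_integrableOn_Ioo_of_le hR]
  exact (hf.sphericalIntegral hm le_rfl).2.1

theorem setIntegral_ball_eq_integral (hm : 1 ≤ m) (hf : IntegrableOn f (ball 0 R)) {τ : ℝ}
    (h0 : 0 ≤ τ) (hτ : τ ≤ R) : ∫ x in ball 0 τ, f x = ∫ t in 0..τ, sphericalIntegral f t := by
  have hf' := hf.mono_set (ball_subset_ball hτ)
  rw [← ball_diff_ball_zero] at hf'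
  rw [intervalIntegral.integral_of_le h0, integral_Ioc_eq_integral_Ioo,
    (hf'.sphericalIntegral hm le_rfl).2.2, ball_diff_ball_zero]

theorem setIntegral_ball_eq_add (hm : 1 ≤ m) (hf : IntegrableOn f (ball 0 R)) {σ τ : ℝ}
    (hσ : σ ∈ Icc 0 R) (hτ : τ ∈ Icc 0 R) :
    ∫ x in ball 0 τ, f x = (∫ x in ball 0 σ, f x) + ∫ t in σ..τ, sphericalIntegral f t := by
  have hR : 0 ≤ R := hσ.1.trans hσ.2
  have hi := intervalIntegrable_sphericalIntegral hm hR hf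
  have sub : ∀ {a b : ℝ}, a ∈ Icc 0 R → b ∈ Icc 0 R →
      IntervalIntegrable (sphericalIntegral f) volume a b := fun ha hb =>
    hi.mono_set (by rw [uIcc_of_le hR]; exact ordConnected_Icc.uIcc_subset ha hb)
  rw [setIntegral_ball_eq_integral hm hf hσ.1 hσ.2, setIntegral_ball_eq_integral hm hf hτ.1 hτ.2,
    intervalIntegral.integral_add_adjacent_intervals (sub ⟨le_rfl, hR⟩ hσ) (sub hσ hτ)]

theorem continuousOn_setIntegral_ball (hm : 1 ≤ m) (hR : 0 ≤ R) (hf : IntegrableOn f (ball 0 R)) :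
    ContinuousOn (fun τ => ∫ x in ball 0 τ, f x) (Icc 0 R) := by
  have := intervalIntegral.continuousOn_primitive_interval'
    (intervalIntegrable_sphericalIntegral hm hR hf) (a := 0) (by simp)
  rw [uIcc_of_le hR] at this
  exact this.congr fun τ hτ => setIntegral_ball_eq_integral hm hf hτ.1 hτ.2

/-- Integration by parts in the radial variable. -/
theorem integral_mul_sphericalIntegral (hm : 1 ≤ m) (hR : 0 ≤ R) (hf : IntegrableOn f (ball 0 R))
    {η : ℝ → ℝ} (hη : ContDiff ℝ 1 η) (hηR : η R = 0) :
    ∫ t in 0..R, η t * sphericalIntegral f t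
      = -∫ t in 0..R, deriv η t * ∫ x in ball 0 t, f x := by
  have hi := intervalIntegrable_sphericalIntegral hm hR hf
  have key := integral_deriv_mul_add_mul_of_primitive (a := 0) (b := R) (g := η)
    (F := fun τ => ∫ x in ball 0 τ, f x) (fun x _ => hη.contDiffAt) hi
    (fun x hx => setIntegral_ball_eq_add hm hf ⟨le_rfl, hR⟩ (by rwa [uIcc_of_le hR] at hx))
  have hc := continuousOn_setIntegral_ball hm hR hf
  rw [intervalIntegral.integral_add _ (hi.continuousOn_mul hη.continuous.continuousOn), hηR] at key
  -- No boundary terms: the ball of radius 0 is empty, and `η` vanishes at `R`.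
  · simp only [ball_zero, setIntegral_empty, mul_zero, zero_mul, sub_zero] at key
    linarith
  · refine ContinuousOn.intervalIntegrable ?_
    rw [uIcc_of_le hR]
    exact (hη.continuous_deriv (by simp)).continuousOn.mul hc

/-- Integration of a function with a radial weight. -/
theorem integrableOn_norm_mul (hm : 1 ≤ m) {ρ : ℝ} (hρ : 0 ≤ ρ)
    (hf : IntegrableOn f (ball 0 R \ ball 0 ρ)) {g : ℝ → ℝ} (hg : ContinuousOn g (Icc ρ R))
    (hg0 : ∀ τ, 0 ≤ τ → τ < ρ → g τ = 0) :
    IntegrableOn (fun x => g ‖x‖ * f x) (ball 0 R) ∧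
    IntegrableOn (fun τ => g τ * sphericalIntegral f τ) (Ioo ρ R) ∧
    ∫ x in ball 0 R, g ‖x‖ * f x = ∫ τ in Ioo ρ R, g τ * sphericalIntegral f τ := by
  have hms : MeasurableSet (ball (0 : EuclideanSpace ℝ (Fin m)) R \ ball 0 ρ) :=
    measurableSet_ball.diff measurableSet_ball
  have hmap : MapsTo (fun x : EuclideanSpace ℝ (Fin m) => ‖x‖) (ball 0 R \ ball 0 ρ) (Icc ρ R) :=
    fun x hx => ⟨by simpa using hx.2, (mem_ball_zero_iff.1 hx.1).le⟩
  obtain ⟨C, hC⟩ := isCompact_Icc.exists_bound_of_continuousOn hg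
  have i1 : IntegrableOn (fun x => g ‖x‖ * f x) (ball 0 R \ ball 0 ρ) := by
    refine Integrable.bdd_mul (c := C) hf
      ((hg.comp continuous_norm.continuousOn hmap).aestronglyMeasurable hms) ?_
    filter_upwards [ae_restrict_mem hms] with x hx using hC _ (hmap hx)
  have z : ∀ x ∈ ball (0 : EuclideanSpace ℝ (Fin m)) R \ (ball 0 R \ ball 0 ρ),
      g ‖x‖ * f x = 0 := fun x hx => by
    rw [hg0 _ (norm_nonneg x), zero_mul]
    by_contra hn
    exact hx.2 ⟨hx.1, by simpa using hn⟩
  have e : EqOn (sphericalIntegral fun x => g ‖x‖ * f x) (fun τ => g τ * sphericalIntegral f τ)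
      (Ioo ρ R) := fun τ hτ => sphericalIntegral_norm_mul g f (hρ.trans hτ.1.le)
  refine ⟨i1.of_forall_sdiff_eq_zero measurableSet_ball z,
    (i1.sphericalIntegral hm hρ).2.1.congr_fun e measurableSet_Ioo, ?_⟩
  rw [setIntegral_eq_of_subset_of_forall_sdiff_eq_zero measurableSet_ball Set.sdiff_subset z,
    ← (i1.sphericalIntegral hm hρ).2.2]
  exact setIntegral_congr_fun measurableSet_Ioo e

theorem integrableOn_shell_inv_norm_pow_mul {ρ : ℝ} (hρ : 0 < ρ) (k : ℕ)
    (hf : IntegrableOn f (ball 0 R)) :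
    IntegrableOn (fun x => (‖x‖ ^ k)⁻¹ * f x) (ball 0 R \ ball 0 ρ) := by
  have hms : MeasurableSet (ball (0 : EuclideanSpace ℝ (Fin m)) R \ ball 0 ρ) :=
    measurableSet_ball.diff measurableSet_ball
  refine Integrable.bdd_mul (c := (ρ ^ k)⁻¹) (hf.mono_set Set.sdiff_subset)
    (by fun_prop) ?_
  filter_upwards [ae_restrict_mem hms] with x hx
  have : ρ ≤ ‖x‖ := by simpa using hx.2
  rw [Real.norm_of_nonneg (by positivity)]
  gcongr

theorem locallyIntegrableOn_Ioo_of_forall {f : ℝ → ℝ}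
    (hf : ∀ ρ, 0 < ρ → IntegrableOn f (Ioo ρ R)) : LocallyIntegrableOn f (Ioo 0 R) :=
  fun x hx => ⟨Ioo (x / 2) R, mem_nhdsWithin_of_mem_nhds
    (Ioo_mem_nhds (by linarith [hx.1]) hx.2), hf _ (by linarith [hx.1])⟩

end Radial

/-! ### Integrability of the densities and the sign of P. -/

namespace SobolevSphereMap

variable {m n : ℕ} {R : ℝ} (u : SobolevSphereMap m n R)

theorem ne_zero_of_mem_shell {ρ r : ℝ} (hρ : 0 < ρ) {x : EuclideanSpace ℝ (Fin m)}
    (hx : x ∈ ball (0 : EuclideanSpace ℝ (Fin m)) r \ ball 0 ρ) : x ≠ 0 := by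
  rintro rfl
  exact hx.2 (mem_ball_self hρ)

theorem integrableOn_bulkDensity {ρ : ℝ} (hρ : 0 < ρ) :
    IntegrableOn u.bulkDensity (ball 0 R \ ball 0 ρ) :=
  (integrableOn_shell_inv_norm_pow_mul hρ m
    (((u.integrable_radialGrad_sq.continuous_mul_ball (c := fun x => ‖x‖ ^ 2) (by fun_prop)).add
      (u.integrable_radial_sq.const_mul ((m : ℝ) - 2))).const_mul 4)).congr_fun
    (fun _ hx => (u.bulkDensity_eq (ne_zero_of_mem_shell hρ hx)).symm)
    (measurableSet_ball.diff measurableSet_ball)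

theorem integrableOn_bulkDensityEps (hm : 1 ≤ m) {ρ : ℝ} (hρ : 0 < ρ) :
    IntegrableOn u.bulkDensityEps (ball 0 R \ ball 0 ρ) :=
  (integrableOn_shell_inv_norm_pow_mul hρ m
    ((u.integrable_gradNorm_mul_radial_sq hm).continuous_mul_ball (c := fun x => ‖x‖ ^ 2)
      (by fun_prop))).congr_fun
    (fun _ hx => (u.bulkDensityEps_eq (ne_zero_of_mem_shell hρ hx)).symm)
    (measurableSet_ball.diff measurableSet_ball)

theorem integrableOn_boundaryNumerator : IntegrableOn (fun x => 2 * (‖x‖ ^ 3 *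
    (-(∑ β, inner ℝ (u.grad β x) (u.radialGrad β x)) - u.gradNorm x ^ 2)
      + 2 * ‖x‖ * ‖u.radial x‖ ^ 2)) (ball 0 R) :=
  ((IntegrableOn.continuous_mul_ball (c := fun x => ‖x‖ ^ 3)
    (u.integrable_inner_grad_radialGrad.neg.sub u.integrable_gradNorm_sq) (by fun_prop)).add
    (u.integrable_radial_sq.continuous_mul_ball (c := fun x => 2 * ‖x‖) (by fun_prop))).const_mul 2

theorem integrableOn_boundaryDensity {ρ : ℝ} (hρ : 0 < ρ) :
    IntegrableOn u.boundaryDensity (ball 0 R \ ball 0 ρ) :=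
  (integrableOn_shell_inv_norm_pow_mul hρ m u.integrableOn_boundaryNumerator).congr_fun
    (fun _ hx => (u.boundaryDensity_eq (ne_zero_of_mem_shell hρ hx)).symm)
    (measurableSet_ball.diff measurableSet_ball)

/-- On a sphere the singular factor is the constant `(τ ^ m)⁻¹`, so it suffices that the numerator
is integrable over the whole ball. -/
theorem ae_boundaryIntegrable (hm : 1 ≤ m) :
    ∀ᵐ τ ∂(volume.restrict (Ioo 0 R)), u.BoundaryIntegrable τ := by
  have h := u.integrableOn_boundaryNumerator
  rw [← ball_diff_ball_zero] at h
  filter_upwards [(h.sphericalIntegral hm le_rfl).1, ae_restrict_mem measurableSet_Ioo] with τ hτ hm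
  refine (hτ.const_mul (τ ^ m)⁻¹).congr (Eventually.of_forall fun y => ?_)
  have hn := norm_smul_sphere hm.1.le y
  have h0 : τ • (y : EuclideanSpace ℝ (Fin m)) ≠ 0 := by
    rw [← norm_ne_zero_iff, hn]
    exact hm.1.ne'
  simp only
  rw [u.boundaryDensity_eq h0, hn]

theorem bulkTerm_nonneg {ε : ℝ} (hε : 0 ≤ ε) (hm : 2 ≤ m) (ρ r : ℝ) : 0 ≤ u.bulkTerm ε ρ r := by
  have hm' : (0 : ℝ) ≤ m - 2 := by
    have : (2 : ℝ) ≤ m := by exact_mod_cast hm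
    linarith
  refine add_nonneg (integral_nonneg fun x => ?_)
    (mul_nonneg (by positivity) (integral_nonneg fun x => ?_))
  · have : 0 ≤ ∑ β, ‖u.grad β x + ∑ α, x α • u.hess α β x‖ ^ 2 :=
      Finset.sum_nonneg fun _ _ => sq_nonneg _
    unfold bulkDensity
    simp only [Pi.zero_apply]
    positivity
  · have := u.gradNorm_nonneg x
    unfold bulkDensityEps
    simp only [Pi.zero_apply]
    positivity

end SobolevSphereMap

/-! ### The distributional derivative of the boundary integral. -/

theorem integral_five {α : Type*} [MeasurableSpace α] {μ : Measure α} {f₁ f₂ f₃ f₄ f₅ : α → ℝ}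
    (h₁ : Integrable f₁ μ) (h₂ : Integrable f₂ μ) (h₃ : Integrable f₃ μ) (h₄ : Integrable f₄ μ)
    (h₅ : Integrable f₅ μ) (c d : ℝ) :
    ∫ x, (c * f₁ x - f₂ x - d * f₃ x + f₄ x - f₅ x) ∂μ = c * ∫ x, f₁ x ∂μ - ∫ x, f₂ x ∂μ
      - d * ∫ x, f₃ x ∂μ + ∫ x, f₄ x ∂μ - ∫ x, f₅ x ∂μ := by
  have i₁ : Integrable (fun x => c * f₁ x - f₂ x) μ := (h₁.const_mul c).sub h₂
  have i₂ : Integrable (fun x => c * f₁ x - f₂ x - d * f₃ x) μ := i₁.sub (h₃.const_mul d)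
  have i₃ : Integrable (fun x => c * f₁ x - f₂ x - d * f₃ x + f₄ x) μ := i₂.add h₄
  rw [integral_sub i₃ h₅, integral_add i₂ h₄, integral_sub i₁ (h₃.const_mul d),
    integral_sub (h₁.const_mul c) h₂, integral_const_mul, integral_const_mul]

namespace SobolevSphereMap

noncomputable section

variable {m n : ℕ} {R : ℝ} (u : SobolevSphereMap m n R)

/-- The derivative of the boundary term in the monotonicity formula. -/
def boundaryDeriv (ε : ℝ) (u : SobolevSphereMap m n R) (τ : ℝ) : ℝ :=
  (4 - m) * (τ ^ 3 * (τ ^ m)⁻¹) * u.energy ε τ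
    + τ ^ 4 * (τ ^ m)⁻¹ * sphericalIntegral (u.energyDensity ε) τ
    - ε * (3 - m) * (τ ^ 3 * (τ ^ m)⁻¹ *
      ∫ x in ball (0 : EuclideanSpace ℝ (Fin m)) τ, u.gradNorm x ^ (m + 1))
    - sphericalIntegral (fun x => u.bulkDensity x + ε * (m + 1) * u.bulkDensityEps x) τ

/-- The first variation for the profile of `ζ`, written in polar coordinates. It says that
`boundaryDeriv` is the distributional derivative of `boundaryIntegral` on `(0, R)`. -/
theorem IsMinimizer.integral_boundaryDeriv {u : SobolevSphereMap m n R} {ε : ℝ}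
    (hu : u.IsMinimizer ε) (hR : 0 < R) (hm : 1 ≤ m) {ζ : ℝ → ℝ} (hζ : ContDiff ℝ ∞ ζ)
    (hζc : HasCompactSupport ζ) (hζs : tsupport ζ ⊆ Ioo 0 R) :
    ∫ τ, (ζ τ * u.boundaryDeriv ε τ + deriv ζ τ * u.boundaryIntegral τ) = 0 := by
  obtain ⟨h, b, hh, hc, hb, hhb, h1, h2⟩ := exists_radialProfile m hR hζ hζc hζs
  have key := hu.integral_densities_eq_zero hR hm hh hc hb hhb h1 h2
  obtain ⟨ρ, r, hρ, hr, hρr⟩ := (hζc.isCompact.union (isCompact_singleton (x := R / 2))).exists_subset_Ioo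
      ⟨R / 2, by simp⟩ (union_subset hζs (by
        rw [singleton_subset_iff]
        exact ⟨by linarith, by linarith⟩))
  have z0 : ∀ τ, τ ∉ Ioo ρ R → ζ τ = 0 := fun τ hτ => image_eq_zero_of_notMem_tsupport fun h =>
    hτ ⟨(hρr (Or.inl h)).1, (hρr (Or.inl h)).2.trans hr⟩
  have z1 : ∀ τ, τ ∉ Ioo ρ R → deriv ζ τ = 0 := fun τ hτ =>
    image_eq_zero_of_notMem_tsupport fun h => hτ
      ⟨(hρr (Or.inl (tsupport_deriv_subset h))).1, (hρr (Or.inl (tsupport_deriv_subset h))).2.trans hr⟩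
  have hζ1 : Continuous (deriv ζ) := hζ.continuous_deriv (by simp)
  have hV : ContinuousOn (fun τ : ℝ => (τ ^ m)⁻¹) (Icc ρ R) :=
    (continuous_pow m).continuousOn.inv₀ fun τ hτ => (pow_pos (hρ.trans_le hτ.1) m).ne'
  have hη : ContDiff ℝ 1 fun τ => h (τ ^ 2) :=
    (hh.of_le (by exact_mod_cast le_top)).comp (contDiff_id.pow 2)
  have hη' : ∀ τ ∈ Ioo 0 R, deriv (fun τ => h (τ ^ 2)) τ = -(ζ τ * (τ ^ 3 * (τ ^ m)⁻¹)) := by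
    intro τ hτ
    have e0 : HasDerivAt (fun τ : ℝ => τ ^ 2) (2 * τ) τ := by simpa using hasDerivAt_pow 2 τ
    have e1 : HasDerivAt (fun τ => h (τ ^ 2)) (deriv h (τ ^ 2) * (2 * τ)) τ :=
      (hh.differentiable (by simp) (τ ^ 2)).hasDerivAt.comp τ e0
    rw [e1.deriv, h1 τ hτ.1]
    ring
  -- The weight `h (‖x‖²)` does not vanish near the origin, but it can be traded for `ζ`:
  -- integrating by parts in the radius replaces it by minus its derivative `ζ(τ) τ^{3-m}`,
  -- multiplied by the integral of `f` over the ball of radius `τ`.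
  have profile : ∀ {f : EuclideanSpace ℝ (Fin m) → ℝ}, IntegrableOn f (ball 0 R) →
      IntegrableOn (fun x => h (‖x‖ ^ 2) * f x) (ball 0 R) ∧
      IntegrableOn (fun τ => ζ τ * (τ ^ 3 * (τ ^ m)⁻¹) * ∫ x in ball 0 τ, f x) (Ioo ρ R) ∧
      ∫ x in ball 0 R, h (‖x‖ ^ 2) * f x
        = ∫ τ in Ioo ρ R, ζ τ * (τ ^ 3 * (τ ^ m)⁻¹) * ∫ x in ball 0 τ, f x := by
    intro f hf
    have hf' := hf
    rw [← ball_diff_ball_zero] at hf'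
    obtain ⟨a1, a2, a3⟩ := integrableOn_norm_mul hm le_rfl hf'
      (g := fun τ => h (τ ^ 2)) hη.continuous.continuousOn
      (fun τ h1 h2 => absurd h2 (not_lt.2 h1))
    refine ⟨a1, ?_, ?_⟩
    · refine (ContinuousOn.integrableOn_Icc ?_).mono_set Ioo_subset_Icc_self
      exact (hζ.continuous.continuousOn.mul ((continuous_pow 3).continuousOn.mul hV)).mul
        ((continuousOn_setIntegral_ball hm hR.le hf).mono (Icc_subset_Icc_left hρ.le))
    · rw [a3, ← integral_Ioc_eq_integral_Ioo, ← intervalIntegral.integral_of_le hR.le,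
        integral_mul_sphericalIntegral hm hR.le hf hη (hhb _ hb.le),
        intervalIntegral.integral_of_le hR.le, integral_Ioc_eq_integral_Ioo,
        ← integral_neg, setIntegral_congr_fun measurableSet_Ioo (g := fun τ =>
          ζ τ * (τ ^ 3 * (τ ^ m)⁻¹) * ∫ x in ball (0 : EuclideanSpace ℝ (Fin m)) τ, f x)
          fun τ hτ => by simp only [hη' τ hτ]; ring]
      refine setIntegral_eq_of_subset_of_forall_sdiff_eq_zero measurableSet_Ioo
        (Ioo_subset_Ioo_left hρ.le) fun τ hτ => ?_
      rw [z0 τ hτ.2, zero_mul, zero_mul]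
  have ie := u.integrableOn_energyDensity ε
  have shell : ∀ {f : EuclideanSpace ℝ (Fin m) → ℝ}, IntegrableOn f (ball 0 R) →
      IntegrableOn f (ball 0 R \ ball 0 ρ) := fun hf => hf.mono_set Set.sdiff_subset
  obtain ⟨a1, a2, a3⟩ := profile ie
  obtain ⟨b1, b2, b3⟩ := integrableOn_norm_mul hm hρ.le (shell ie)
    (g := fun τ => ζ τ * (τ ^ 4 * (τ ^ m)⁻¹))
    (hζ.continuous.continuousOn.mul ((continuous_pow 4).continuousOn.mul hV))
    (fun τ _ h2 => by rw [z0 τ fun h => absurd h.1 (not_lt.2 h2.le), zero_mul])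
  obtain ⟨c1, c2, c3⟩ := profile u.integrable_gradNorm_pow
  obtain ⟨d1, d2, d3⟩ := integrableOn_norm_mul hm hρ.le ((u.integrableOn_bulkDensity hρ).add
    ((u.integrableOn_bulkDensityEps hm hρ).const_mul (ε * (m + 1)))) (g := ζ)
    hζ.continuous.continuousOn (fun τ _ h2 => z0 τ fun h => absurd h.1 (not_lt.2 h2.le))
  obtain ⟨e1, e2, e3⟩ := integrableOn_norm_mul hm hρ.le (u.integrableOn_boundaryDensity hρ)
    (g := deriv ζ) hζ1.continuousOn (fun τ _ h2 => z1 τ fun h => absurd h.1 (not_lt.2 h2.le))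
  -- The same linear combination is split once over the ball and once over the radii; the five
  -- identities above match the pieces.
  have k1 := integral_five a1 b1 c1 d1 e1 (m - 4) (ε * (m - 3))
  have k2 := integral_five a2 b2 c2 d2 e2 (m - 4) (ε * (m - 3))
  rw [a3, b3, c3, d3, e3, ← k2] at k1
  have k3 := k1.symm.trans (Eq.trans (setIntegral_congr_fun measurableSet_ball fun x _ => by
    simp only [Pi.add_apply]
    ring) key)
  rw [← setIntegral_eq_integral_of_forall_compl_eq_zero (s := Ioo ρ R) fun τ hτ => by
    rw [z0 τ hτ, z1 τ hτ, zero_mul, zero_mul, add_zero]]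
  rw [← neg_eq_zero, ← k3, ← integral_neg]
  refine setIntegral_congr_fun measurableSet_Ioo fun τ hτ => ?_
  change -(ζ τ * u.boundaryDeriv ε τ + deriv ζ τ * sphericalIntegral u.boundaryDensity τ) =
    (m - 4) * (ζ τ * (τ ^ 3 * (τ ^ m)⁻¹) * u.energy ε τ) - _ - _ +
      ζ τ * sphericalIntegral (fun x => u.bulkDensity x + ε * (m + 1) * u.bulkDensityEps x) τ - _
  unfold boundaryDeriv
  ring

theorem locallyIntegrableOn_boundaryIntegral (hm : 1 ≤ m) :
    LocallyIntegrableOn u.boundaryIntegral (Ioo 0 R) :=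
  locallyIntegrableOn_Ioo_of_forall fun _ hρ =>
    ((u.integrableOn_boundaryDensity hρ).sphericalIntegral hm hρ.le).2.1

end

end SobolevSphereMap

/-! ### The integral of the derivative of the boundary term. -/

namespace SobolevSphereMap

variable {m n : ℕ} {R : ℝ} (u : SobolevSphereMap m n R)

theorem integrableOn_sphericalIntegral_bulk (hm : 1 ≤ m) (ε : ℝ) {ρ r : ℝ} (hρ : 0 < ρ)
    (hr : r ≤ R) :
    IntegrableOn (sphericalIntegral fun x => u.bulkDensity x + ε * (m + 1) * u.bulkDensityEps x)
      (Ioo ρ r) ∧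
    ∫ τ in Ioo ρ r, sphericalIntegral
      (fun x => u.bulkDensity x + ε * (m + 1) * u.bulkDensityEps x) τ = u.bulkTerm ε ρ r := by
  have hsub : ball (0 : EuclideanSpace ℝ (Fin m)) r \ ball 0 ρ ⊆ ball 0 R \ ball 0 ρ :=
    Set.sdiff_subset_sdiff_left (ball_subset_ball hr)
  have i1 := (u.integrableOn_bulkDensity hρ).mono_set hsub
  have i2 := ((u.integrableOn_bulkDensityEps hm hρ).mono_set hsub).const_mul (ε * (m + 1))
  have i12 : IntegrableOn (fun x => u.bulkDensity x + ε * (m + 1) * u.bulkDensityEps x)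
      (ball 0 r \ ball 0 ρ) := i1.add i2
  obtain ⟨-, h2, h3⟩ := i12.sphericalIntegral hm hρ.le
  exact ⟨h2, by rw [h3, integral_add i1 i2, integral_const_mul, bulkTerm]⟩

theorem locallyIntegrableOn_boundaryDeriv (hR : 0 < R) (hm : 1 ≤ m) (ε : ℝ) :
    LocallyIntegrableOn (u.boundaryDeriv ε) (Ioo 0 R) := by
  have ie := u.integrableOn_energyDensity ε
  have hV : ContinuousOn (fun τ : ℝ => (τ ^ m)⁻¹) (Ioo 0 R) :=
    (continuous_pow m).continuousOn.inv₀ fun τ hτ => (pow_pos hτ.1 m).ne'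
  have hE := (continuousOn_setIntegral_ball hm hR.le ie).mono Ioo_subset_Icc_self
  have hG := (continuousOn_setIntegral_ball hm hR.le u.integrable_gradNorm_pow).mono
    Ioo_subset_Icc_self
  have h3 : ContinuousOn (fun τ : ℝ => τ ^ 3 * (τ ^ m)⁻¹) (Ioo 0 R) :=
    (continuous_pow 3).continuousOn.mul hV
  have h4 : ContinuousOn (fun τ : ℝ => τ ^ 4 * (τ ^ m)⁻¹) (Ioo 0 R) :=
    (continuous_pow 4).continuousOn.mul hV
  have he : LocallyIntegrableOn (sphericalIntegral (u.energyDensity ε)) (Ioo 0 R) := by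
    have := intervalIntegrable_sphericalIntegral hm hR.le ie
    rw [intervalIntegrable_iff_integrableOn_Ioo_of_le hR.le] at this
    exact this.locallyIntegrableOn
  exact (((((continuousOn_const.mul h3).mul hE).locallyIntegrableOn measurableSet_Ioo).add
    (he.continuousOn_mul h4 isOpen_Ioo.isLocallyClosed)).sub
    ((continuousOn_const.mul (h3.mul hG)).locallyIntegrableOn measurableSet_Ioo)).sub
    (locallyIntegrableOn_Ioo_of_forall fun ρ hρ =>
      (u.integrableOn_sphericalIntegral_bulk hm ε hρ le_rfl).1)

theorem scaledGradEnergy_eq {τ : ℝ} (hτ : 0 < τ) : u.scaledGradEnergy τ =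
    τ ^ 3 * (τ ^ m)⁻¹ * ∫ x in ball (0 : EuclideanSpace ℝ (Fin m)) τ, u.gradNorm x ^ (m + 1) := by
  rw [scaledGradEnergy, zpow_sub₀ hτ.ne', zpow_natCast, div_eq_mul_inv]
  norm_cast

theorem intervalIntegrable_scaledGradEnergy (hm : 1 ≤ m) {ρ r : ℝ} (hρ : 0 < ρ) (hρr : ρ ≤ r)
    (hr : r ≤ R) : IntervalIntegrable u.scaledGradEnergy volume ρ r := by
  refine ContinuousOn.intervalIntegrable ?_
  rw [uIcc_of_le hρr]
  refine ContinuousOn.mul (fun τ hτ => (continuousAt_zpow₀ τ _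
    (Or.inl (hρ.trans_le hτ.1).ne')).continuousWithinAt) ?_
  exact (continuousOn_setIntegral_ball hm (hρ.le.trans (hρr.trans hr)) u.integrable_gradNorm_pow).mono
    (Icc_subset_Icc hρ.le hr)

/-- The first two terms of `boundaryDeriv` are the derivative of `τ^{4-m}` times the energy on
`B_τ`, which is a primitive of its spherical density, so that integration by parts applies. The
other two integrate to `-Q` and `-P`. -/
theorem integral_boundaryDeriv (hm : 1 ≤ m) (ε : ℝ) {ρ r : ℝ} (hρ : 0 < ρ) (hρr : ρ ≤ r)
    (hr : r ≤ R) : ∫ τ in ρ..r, u.boundaryDeriv ε τ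
      = r ^ (4 - (m : ℤ)) * u.energy ε r - ρ ^ (4 - (m : ℤ)) * u.energy ε ρ
        - u.bulkTerm ε ρ r - u.extraTerm ε ρ r := by
  have hR : 0 ≤ R := hρ.le.trans (hρr.trans hr)
  have ie := u.integrableOn_energyDensity ε
  have hpos : ∀ τ ∈ uIcc ρ r, 0 < τ := fun τ hτ => by
    rw [uIcc_of_le hρr] at hτ
    exact hρ.trans_le hτ.1
  have hsub : uIcc ρ r ⊆ Icc 0 R := by
    rw [uIcc_of_le hρr]
    exact Icc_subset_Icc hρ.le hr
  have hi : IntervalIntegrable (sphericalIntegral (u.energyDensity ε)) volume ρ r :=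
    (intervalIntegrable_sphericalIntegral hm hR ie).mono_set (by rwa [uIcc_of_le hR])
  have hg : ∀ τ ∈ uIcc ρ r, ContDiffAt ℝ 1 (fun τ : ℝ => τ ^ (4 - (m : ℤ))) τ := fun τ hτ => by
    have e : (fun τ : ℝ => τ ^ (4 - (m : ℤ))) =ᶠ[𝓝 τ] fun τ => τ ^ 4 * (τ ^ m)⁻¹ := by
      filter_upwards [lt_mem_nhds (hpos τ hτ)] with t ht
      rw [zpow_sub₀ ht.ne', zpow_natCast, div_eq_mul_inv]
      norm_cast
    refine ContDiffAt.congr_of_eventuallyEq ?_ e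
    exact (contDiffAt_id.pow 4).mul ((contDiffAt_id.pow m).inv (pow_pos (hpos τ hτ) m).ne')
  have parts := integral_deriv_mul_add_mul_of_primitive (F := u.energy ε) hg hi
    fun τ hτ => setIntegral_ball_eq_add hm ie (hsub left_mem_uIcc) (hsub hτ)
  obtain ⟨p1, p2⟩ := u.integrableOn_sphericalIntegral_bulk hm ε hρ hr
  rw [← intervalIntegrable_iff_integrableOn_Ioo_of_le hρr] at p1
  rw [← integral_Ioc_eq_integral_Ioo, ← intervalIntegral.integral_of_le hρr] at p2
  have iS := u.intervalIntegrable_scaledGradEnergy hm hρ hρr hr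
  have cE : ContinuousOn (u.energy ε) (uIcc ρ r) := (continuousOn_setIntegral_ball hm hR ie).mono hsub
  have cz : ∀ k : ℤ, ContinuousOn (fun τ : ℝ => τ ^ k) (uIcc ρ r) := fun k τ hτ =>
    (continuousAt_zpow₀ τ _ (Or.inl (hpos τ hτ).ne')).continuousWithinAt
  have hd : ∀ τ, deriv (fun τ : ℝ => τ ^ (4 - (m : ℤ))) τ = (4 - m) * τ ^ (3 - (m : ℤ)) := by
    intro τ
    rw [deriv_zpow]
    push_cast
    congr 2
    ring
  simp only [hd] at parts
  have i1 : IntervalIntegrable (fun τ => (4 - m) * τ ^ (3 - (m : ℤ)) * u.energy ε τ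
      + τ ^ (4 - (m : ℤ)) * sphericalIntegral (u.energyDensity ε) τ) volume ρ r :=
    ((continuousOn_const.mul (cz _)).mul cE).intervalIntegrable.add (hi.continuousOn_mul (cz _))
  rw [← parts, ← p2, extraTerm, ← intervalIntegral.integral_const_mul,
    ← intervalIntegral.integral_sub i1 p1,
    ← intervalIntegral.integral_sub (i1.sub p1) (iS.const_mul _)]
  refine intervalIntegral.integral_congr fun τ hτ => ?_
  have h0 := hpos τ hτ
  have e3 : τ ^ (3 - (m : ℤ)) = τ ^ 3 * (τ ^ m)⁻¹ := by
    rw [zpow_sub₀ h0.ne', zpow_natCast, div_eq_mul_inv]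
    norm_cast
  have e4 : τ ^ (4 - (m : ℤ)) = τ ^ 4 * (τ ^ m)⁻¹ := by
    rw [zpow_sub₀ h0.ne', zpow_natCast, div_eq_mul_inv]
    norm_cast
  simp only [boundaryDeriv, u.scaledGradEnergy_eq h0, e3, e4]
  ring

end SobolevSphereMap

/-! ### The monotonicity formula. -/

theorem mainTheorem4 (m n : ℕ) (hm : 1 ≤ m) (ε R₀ : ℝ) (hε : 0 < ε) (hR₀ : 0 < R₀)
    (u : SobolevSphereMap m n R₀) (hu : u.IsMinimizer ε) :
    IntegrableOn (u.energyDensity ε) (ball 0 R₀) ∧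
    (∀ᵐ τ ∂(volume.restrict (Ioo 0 (R₀ / 2))), u.BoundaryIntegrable τ) ∧
    ∃ b : ℝ → ℝ, ContinuousOn b (Ioo 0 (R₀ / 2)) ∧
      (∀ᵐ τ ∂(volume.restrict (Ioo 0 (R₀ / 2))), b τ = u.boundaryIntegral τ) ∧
      ∀ ρ r : ℝ, 0 < ρ → ρ < r → r < R₀ / 2 →
        IntegrableOn u.bulkDensity (ball 0 r \ ball 0 ρ) ∧
        IntegrableOn u.bulkDensityEps (ball 0 r \ ball 0 ρ) ∧
        IntervalIntegrable u.scaledGradEnergy volume ρ r ∧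
        (2 ≤ m → 0 ≤ u.bulkTerm ε ρ r) ∧
        r ^ (4 - (m : ℤ)) * u.energy ε r - ρ ^ (4 - (m : ℤ)) * u.energy ε ρ
          = u.bulkTerm ε ρ r + (b r - b ρ) + u.extraTerm ε ρ r := by
  -- The argument runs on all of `(0, R₀)`, where `R₀ / 2` is an interior point and can serve as
  -- base point of the primitive.
  have hc : R₀ / 2 ∈ Ioo 0 R₀ := ⟨by linarith, by linarith⟩
  have hsub : Ioo 0 (R₀ / 2) ⊆ Ioo 0 R₀ := Ioo_subset_Ioo_right hc.2.le
  have hq := u.locallyIntegrableOn_boundaryDeriv hR₀ hm ε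
  obtain ⟨C, hC⟩ := exists_ae_eq_add_integral_of_forall_integral_eq_zero hc
    (u.locallyIntegrableOn_boundaryIntegral hm) hq
    fun ζ hζ hζc hζs => hu.integral_boundaryDeriv hR₀ hm hζ hζc hζs
  refine ⟨u.integrableOn_energyDensity ε,
    ae_restrict_of_ae_restrict_of_subset hsub (u.ae_boundaryIntegrable hm),
    fun τ => C + ∫ t in (R₀ / 2)..τ, u.boundaryDeriv ε t,
    (continuousOn_const.add (hq.continuousOn_primitive_Ioo hc)).mono hsub, ?_,
    fun ρ r hρ hρr hr => ?_⟩
  · filter_upwards [ae_restrict_of_ae hC, ae_restrict_mem measurableSet_Ioo] with τ hτ hmem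
    exact (hτ (hsub hmem)).symm
  · have hrR : r ≤ R₀ := by linarith
    have hball : ball (0 : EuclideanSpace ℝ (Fin m)) r \ ball 0 ρ ⊆ ball 0 R₀ \ ball 0 ρ :=
      Set.sdiff_subset_sdiff_left (ball_subset_ball hrR)
    refine ⟨(u.integrableOn_bulkDensity hρ).mono_set hball,
      (u.integrableOn_bulkDensityEps hm hρ).mono_set hball,
      u.intervalIntegrable_scaledGradEnergy hm hρ hρr.le hrR,
      fun h2 => u.bulkTerm_nonneg hε.le h2 ρ r, ?_⟩
    have hρ' : ρ ∈ Ioo 0 R₀ := ⟨hρ, by linarith⟩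
    have hr' : r ∈ Ioo 0 R₀ := ⟨hρ.trans hρr, by linarith⟩
    have e1 := intervalIntegral.integral_interval_sub_left
      (hq.intervalIntegrable_of_mem_Ioo hc hr') (hq.intervalIntegrable_of_mem_Ioo hc hρ')
    rw [u.integral_boundaryDeriv hm ε hρ hρr.le hrR] at e1
    linarith
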